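/- **Setting.** Let $W$ be a finite Coxeter group with set $S$ of simple reflections, length function $\ell$, sign character $\epsilon(w)=(-1)^{\ell(w)}$ and reflection representation $V=\bigoplus_{s\in S}\mathbb R\alpha_s$, where $\langle\alpha_s,\alpha_t\rangle=-\cos(\pi/m_{st})$ and $s$ acts by $v\mapsto v-2\langle\alpha_s,v\rangle\alpha_s$. For $J\subseteq S$ let $W_J=\langle J\rangle$, write $J^x=x^{-1}Jx$, and put $$X_J=\{w\in W:\ell(sw)>\ell(w)\ \forall s\in J\},\qquad X_J^\sharp=\{x\in X_J: J^x\subseteq S\},\qquad N_J=\{x\in X_J:J^x=J\}.$$ The normalizer $N_W(W_J)$ is the semidirect product $W_J\rtimes N_J$. The parabolic subgroup $W_J$ is *bulky* if $N_J$ centralizes $W_J$. The group $W_J$ is itself a Coxeter group with simple reflections $J$, and its reflection representation is the orthogonal complement $V_J$ of $\operatorname{Fix}(W_J)$ in $V$. Let $\alpha_J(w)=\det(w|_{\operatorname{Fix}(W_J)})$ for $w\in N_W(W_J)$. *Group algebra.* Let $x_J=\sum_{x\in X_J}x^{-1}\in\mathbb CW$. Let $m_{KL}=|X_K\cap X_L^\sharp|$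 if $L\subseteq K$ and $m_{KL}=0$ otherwise; this matrix is invertible, and $(e_L)_{L\subseteq S}$ is defined by $x_K=\sum_{L\subseteq S}m_{KL}e_L$. Let $\Phi_S$ be the character of $W$ on the right ideal $e_S\mathbb CW$; the same construction applied to $(W_L,L)$ gives the character $\Phi_L$ of $W_L$. Let $\widetilde\Phi_L$ be the character of $N_W(W_L)$ on $e_L\mathbb CW_L=e_L\mathbb CN_W(W_L)$, acting by right multiplication; it extends $\Phi_L$. *Orlik–Solomon algebra.* Let $T$ be the set of reflections of $W$, and $H_t\subseteq V$ the $1$-eigenspace of $t\in T$. Let $A(W)$ be the $\mathbb C$-algebra generated by $a_t$ ($t\in T$) subject to $a_ta_{t'}=-a_{t'}a_t$ for all $t,t'\in T$, and $\sum_{i=1}^p(-1)^i a_{t_1}\cdots\widehat{a_{t_i}}\cdots a_{t_p}=0$ whenever $\operatorname{codim}(H_{t_1}\cap\dots\cap H_{t_p})<p$. The group $W$ acts on the right by $a_t.w=a_{w^{-1}tw}$. For an intersection $X$ of hyperplanes $H_t$ of codimension $p$ let $A_X$ be the span of the $a_{t_1}\cdots a_{t_p}$ with $H_{t_1}\cap\dots\cap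 H_{t_p}=X$. Let $\Psi_S$ be the character of $W$ on $A_{\{0\}}$; the same construction applied to $(W_L,L,V_L)$ gives the character $\Psi_L$ of $W_L$. Let $\widetilde\Psi_L$ be the character of $N_W(W_L)$ on $A_X$, where $X=\operatorname{Fix}(W_L)$; it extends $\Psi_L$. *Cuspidal classes.* An element of $W_L$ is cuspidal if it has no nonzero fixed point in $V_L$. Let $\mathcal C_L$ be the set of conjugacy classes of $W_L$ that consist of cuspidal elements, and fix a representative $w_C\in C$ for each $C\in\mathcal C_L$. One has $C_W(w_C)\subseteq N_W(W_L)$. **Conjecture B for $W_L$** (satisfied by linear characters $\varphi_{w_C},\psi_{w_C}$ of $C_{W_L}(w_C)$, $C\in\mathcal C_L$): (i) $\Phi_L=\sum_{C}\operatorname{Ind}_{C_{W_L}(w_C)}^{W_L}\varphi_{w_C}$; (ii) $\Psi_L=\sum_{C}\operatorname{Ind}_{C_{W_L}(w_C)}^{W_L}\psi_{w_C}$; (iii) $\psi_{w_C}=\varphi_{w_C}\epsilon$ for all $C$. **Conjecture C for $L\subseteq S$** (satisfied by linear characters $\widetilde\varphi_{w_C},\widetilde\psi_{w_C}$ of $C_W(w_C)$,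 $C\in\mathcal C_L$): (i) $\widetilde\Phi_L=\sum_{C}\operatorname{Ind}_{C_W(w_C)}^{N_W(W_L)}\widetilde\varphi_{w_C}$; (ii) $\widetilde\Psi_L=\sum_{C}\operatorname{Ind}_{C_W(w_C)}^{N_W(W_L)}\widetilde\psi_{w_C}$; (iii) $\widetilde\psi_{w_C}=\widetilde\varphi_{w_C}\,\epsilon\,\alpha_L$ for all $C$. **Theorem.** Let $L\subseteq S$, and suppose that $W_L$ is a bulky parabolic subgroup of $W$. If Conjecture B holds for $W_L$, then Conjecture C holds for $L$. More precisely, whenever linear characters $\varphi_{w_C},\psi_{w_C}$ of $C_{W_L}(w_C)$ satisfy Conjecture B for $W_L$, then for each $C\in\mathcal C_L$ the centralizer $C_W(w_C)$ is the internal direct product $C_{W_L}(w_C)\times N_L$, and the linear characters $\widetilde\varphi_{w_C}=\varphi_{w_C}\times 1_{N_L}$ and $\widetilde\psi_{w_C}=\psi_{w_C}\times 1_{N_L}$ of $C_W(w_C)$ satisfy Conjecture C for $L$. -/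

import Mathlib

noncomputable section

namespace CoxArr

open Module

/-! ## Induced characters -/

open Classical in
/-- The induced class function `Ind_H^K χ` (for subgroups `H ≤ K` of a finite group `G`),
`(Ind_H^K χ)(g) = |H|⁻¹ ∑_{x ∈ K} χ°(x g x⁻¹)`, where `χ°` is `χ` extended by zero outside `H`. -/
def indChar {G : Type*} [Group G] (H K : Subgroup G) (χ : H → ℂ) (g : K) : ℂ :=
  (Nat.card H : ℂ)⁻¹ *
    ∑ᶠ x : K, if h : (x : G) * g * (x : G)⁻¹ ∈ H then χ ⟨(x : G) * g * (x : G)⁻¹, h⟩ else 0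

/-! ## Minimal coset representatives and the descent algebra

Everything in this section depends on a group `G` together with a family `s : B → G` of
generators.  It is used for a finite Coxeter group `W` with its simple reflections, and for a
parabolic subgroup `W_L` with its simple reflections `s_i`, `i ∈ L`. -/

section Descent

variable {G B : Type*} [Group G] (s : B → G)

/-- The length of `g` with respect to the generators `s`. -/
def wordLength (g : G) : ℕ :=
  sInf {n | ∃ ω : List B, ω.length = n ∧ (ω.map s).prod = g}

/-- For a Coxeter system this is the usual length function. -/
theorem wordLength_simple {M : CoxeterMatrix B} (cs : CoxeterSystem M G) (g : G) :
    wordLength cs.simple g = cs.length g := by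
  apply le_antisymm
  · obtain ⟨ω, hω, rfl⟩ := cs.exists_isReduced g
    exact Nat.sInf_le ⟨ω, hω.symm, rfl⟩
  · have hne : {n | ∃ ω : List B, ω.length = n ∧ (ω.map cs.simple).prod = g}.Nonempty := by
      obtain ⟨ω, -, h⟩ := cs.exists_isReduced g
      exact ⟨ω.length, ω, rfl, h.symm⟩
    obtain ⟨ω, h1, h2⟩ := Nat.sInf_mem hne
    rw [wordLength, ← h1, ← h2]
    exact cs.length_wordProd_le ω

/-- The sign character `ε(g) = (-1) ^ ℓ(g)`. -/
def sgn (g : G) : ℂ := (-1) ^ wordLength s g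

/-- The parabolic subgroup `W_J = ⟨J⟩`. -/
def parabolic (J : Finset B) : Subgroup G := Subgroup.closure (s '' (J : Set B))

/-- `X_J = {w : ℓ(s_j w) > ℓ(w) for all j ∈ J}`. -/
def transversal (J : Finset B) : Set G :=
  {w | ∀ j ∈ J, wordLength s w < wordLength s (s j * w)}

/-- `X_J^♯ = {x ∈ X_J : J^x ⊆ S}`, where `J^x = x⁻¹ J x`. -/
def transversalSharp (J : Finset B) : Set G :=
  {x | x ∈ transversal s J ∧ ∀ j ∈ J, x⁻¹ * s j * x ∈ Set.range s}

/-- `N_J = {x ∈ X_J : J^x = J}`. -/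
def normalizerComplement (J : Finset B) : Set G :=
  {x | x ∈ transversal s J ∧
    (fun g => x⁻¹ * g * x) '' (s '' (J : Set B)) = s '' (J : Set B)}

/-- `W_J` is bulky: the complement `N_J` of `W_J` in its normalizer centralizes `W_J`. -/
def IsBulky (J : Finset B) : Prop :=
  ∀ n ∈ normalizerComplement s J, ∀ u ∈ parabolic s J, n * u = u * n

/-- `x_J = ∑_{x ∈ X_J} x⁻¹` in the group algebra. -/
def xElt (J : Finset B) : MonoidAlgebra ℂ G :=
  ∑ᶠ x ∈ transversal s J, MonoidAlgebra.single x⁻¹ (1 : ℂ)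

open Classical in
/-- The matrix `m_{KL} = |X_K ∩ X_L^♯|` if `L ⊆ K`, and `0` otherwise. -/
def mMatrix : Matrix (Finset B) (Finset B) ℂ := fun K L =>
  if L ⊆ K then ((transversal s K ∩ transversalSharp s L).ncard : ℂ) else 0

variable [Fintype B] [DecidableEq B]

/-- The basis `e_L` of the descent algebra determined by `x_K = ∑_L m_{KL} e_L`. -/
def eElt (L : Finset B) : MonoidAlgebra ℂ G :=
  ∑ K : Finset B, (mMatrix s)⁻¹ L K • xElt s K

/-- The right `ℂH`-module `e_L ℂH` inside `ℂG`, for a subgroup `H` of `G`. -/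
def descentModule (L : Finset B) (H : Subgroup G) : Submodule ℂ (MonoidAlgebra ℂ G) :=
  Submodule.span ℂ (Set.range fun h : H => eElt s L * MonoidAlgebra.single (h : G) (1 : ℂ))

theorem descentModule_stable (L : Finset B) (H : Subgroup G) (h : H) :
    ∀ a ∈ descentModule s L H,
      LinearMap.mulRight ℂ (MonoidAlgebra.single (h : G) (1 : ℂ)) a ∈ descentModule s L H := by
  intro a ha
  refine Submodule.span_induction (p := fun a _ =>
    LinearMap.mulRight ℂ (MonoidAlgebra.single (h : G) (1 : ℂ)) a ∈ descentModule s L H)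
    ?_ ?_ ?_ ?_ ha
  · rintro _ ⟨k, rfl⟩
    refine Submodule.subset_span ⟨k * h, ?_⟩
    simp [mul_assoc, MonoidAlgebra.single_mul_single]
  · simp
  · intro x y _ _ hx hy
    rw [map_add]
    exact Submodule.add_mem _ hx hy
  · intro c x _ hx
    rw [map_smul]
    exact Submodule.smul_mem _ _ hx

/-- The character of `H` on `e_L ℂH` (acting by right multiplication). -/
def descentChar (L : Finset B) (H : Subgroup G) (h : H) : ℂ :=
  LinearMap.trace ℂ (descentModule s L H)
    ((LinearMap.mulRight ℂ (MonoidAlgebra.single (h : G) (1 : ℂ))).restrict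
      (descentModule_stable s L H h))

/-- The character `Φ_S` of the top component `E_{[S]} = e_S ℂG` of the group algebra. (The
shape of `S` is `[S] = {S}`, so that `e_{[S]} = e_S`.) -/
def topPhi (g : G) : ℂ :=
  descentChar s Finset.univ ⊤ ⟨g, Subgroup.mem_top g⟩

end Descent

/-! ## The Orlik-Solomon algebra

Here `ρ` is the reflection representation of the group `G` generated by `s`. -/

section OrlikSolomon

variable {G B V : Type*} [Group G] (s : B → G) [AddCommGroup V] [Module ℝ V]
  (ρ : Representation ℝ G V)

/-- The set `T` of reflections: the conjugates of the generators. -/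
def reflections : Set G := {t | ∃ g i, t = g⁻¹ * s i * g}

/-- The hyperplane `H_t`: the `1`-eigenspace of `t`. -/
def hyperplane (t : G) : Submodule ℝ V := LinearMap.ker (ρ t - LinearMap.id)

/-- `H_{t_1} ∩ ⋯ ∩ H_{t_p}`. -/
def meet (l : List (reflections s)) : Submodule ℝ V := ⨅ t ∈ l, hyperplane ρ (t : G)

/-- The hyperplanes `H_{t_1}, …, H_{t_p}` are linearly dependent, that is, the codimension of
their intersection is less than `p`. -/
def Dependent (l : List (reflections s)) : Prop :=
  finrank ℝ V < finrank ℝ (meet s ρ l) + l.length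

/-- The defining relations of the Orlik-Solomon algebra (list positions start at `0`). -/
inductive OSRel : FreeAlgebra ℂ (reflections s) → FreeAlgebra ℂ (reflections s) → Prop
  | anticomm (t t' : reflections s) :
      OSRel (FreeAlgebra.ι ℂ t * FreeAlgebra.ι ℂ t')
        (-(FreeAlgebra.ι ℂ t' * FreeAlgebra.ι ℂ t))
  | dependent (l : List (reflections s)) (hl : Dependent s ρ l) :
      OSRel (∑ i ∈ Finset.range l.length,
        (-1 : ℂ) ^ (i + 1) • ((l.eraseIdx i).map (FreeAlgebra.ι ℂ)).prod) 0

/-- The Orlik-Solomon algebra `A(G)`. -/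
abbrev OSAlgebra : Type _ := RingQuot (OSRel s ρ)

/-- The generator `a_t`. -/
def osGen (t : reflections s) : OSAlgebra s ρ :=
  RingQuot.mkAlgHom ℂ (OSRel s ρ) (FreeAlgebra.ι ℂ t)

/-- `t^g = g⁻¹ t g`. -/
def reflConj (g : G) (t : reflections s) : reflections s :=
  ⟨g⁻¹ * t * g, by
    obtain ⟨t, k, i, rfl⟩ := t
    exact ⟨k * g, i, by simp [mul_assoc]⟩⟩

theorem meet_map_reflConj (g : G) (l : List (reflections s)) :
    meet s ρ (l.map (reflConj s g)) = (meet s ρ l).comap (ρ g) := by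
  ext v
  have hinj : Function.Injective (ρ g⁻¹) := by
    intro x y hxy
    have := congrArg (ρ g) hxy
    simpa [← Module.End.mul_apply, ← map_mul] using this
  have key : ∀ t : G, ρ (g⁻¹ * t * g) v = v ↔ ρ t (ρ g v) = ρ g v := by
    intro t
    have h1 : ρ (g⁻¹ * t * g) v = ρ g⁻¹ (ρ t (ρ g v)) := by
      simp [map_mul, Module.End.mul_apply]
    have h2 : v = ρ g⁻¹ (ρ g v) := by
      simp [← Module.End.mul_apply, ← map_mul]
    rw [h1]
    constructor
    · intro h
      exact hinj (h.trans h2)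
    · intro h
      rw [h, ← h2]
  simp only [meet, Submodule.mem_iInf, List.mem_map, forall_exists_index, and_imp,
    forall_apply_eq_imp_iff₂, Submodule.mem_comap, hyperplane, LinearMap.mem_ker,
    LinearMap.sub_apply, LinearMap.id_apply, sub_eq_zero]
  exact forall₂_congr fun t _ => key t

/-- The action of `g` on `V` as a linear equivalence. -/
def repEquiv (g : G) : V ≃ₗ[ℝ] V :=
  LinearEquiv.ofLinearMap (ρ g) (ρ g⁻¹)
    (by rw [← Module.End.mul_eq_comp, ← map_mul]; simp; rfl)
    (by rw [← Module.End.mul_eq_comp, ← map_mul]; simp; rfl)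

theorem finrank_comap (g : G) (X : Submodule ℝ V) :
    finrank ℝ (X.comap (ρ g)) = finrank ℝ X := by
  have h : X.comap (ρ g) = X.map ((repEquiv ρ g).symm : V →ₗ[ℝ] V) := by
    rw [Submodule.map_equiv_eq_comap_symm]
    rfl
  rw [h]
  exact LinearEquiv.finrank_map_eq (repEquiv ρ g).symm X

/-- The right action of `g` on the Orlik-Solomon algebra, `a_t . g = a_{t^g}`. -/
def osAct (g : G) : OSAlgebra s ρ →ₐ[ℂ] OSAlgebra s ρ :=
  RingQuot.liftAlgHom ℂ ⟨FreeAlgebra.lift ℂ fun t => osGen s ρ (reflConj s g t), by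
    intro x y hxy
    induction hxy with
    | anticomm t t' =>
      have := RingQuot.mkAlgHom_rel ℂ
        (OSRel.anticomm (ρ := ρ) (reflConj s g t) (reflConj s g t'))
      simpa [osGen] using this
    | dependent l hl =>
      have hl' : Dependent s ρ (l.map (reflConj s g)) := by
        unfold Dependent at hl ⊢
        rw [meet_map_reflConj, finrank_comap, List.length_map]
        exact hl
      have := RingQuot.mkAlgHom_rel ℂ (OSRel.dependent _ hl')
      simp only [map_sum, map_smul, map_list_prod, List.map_map, List.length_map,
        List.eraseIdx_map, map_zero] at this ⊢
      rw [← this]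
      refine Finset.sum_congr rfl fun i _ => ?_
      congr 3
      funext t
      simp [osGen]⟩

@[simp] theorem osAct_osGen (g : G) (t : reflections s) :
    osAct s ρ g (osGen s ρ t) = osGen s ρ (reflConj s g t) := by
  simp [osAct, osGen, RingQuot.liftAlgHom_mkAlgHom_apply]

/-- The subspace `A_X` of `A(G)` spanned by the monomials `a_{t_1} ⋯ a_{t_p}` with
`H_{t_1} ∩ ⋯ ∩ H_{t_p} = X`, where `p` is the codimension of `X`. -/
def osComponent (X : Submodule ℝ V) : Submodule ℂ (OSAlgebra s ρ) :=
  Submodule.span ℂ {a | ∃ l : List (reflections s), meet s ρ l = X ∧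
    l.length + finrank ℝ X = finrank ℝ V ∧ a = (l.map (osGen s ρ)).prod}

theorem osComponent_stable (X : Submodule ℝ V) (g : G) (hX : X.comap (ρ g) = X) :
    ∀ a ∈ osComponent s ρ X, (osAct s ρ g).toLinearMap a ∈ osComponent s ρ X := by
  intro a ha
  refine Submodule.span_induction (p := fun a _ =>
    (osAct s ρ g).toLinearMap a ∈ osComponent s ρ X) ?_ ?_ ?_ ?_ ha
  · rintro _ ⟨l, hl, hp, rfl⟩
    refine Submodule.subset_span ⟨l.map (reflConj s g), ?_, ?_, ?_⟩
    · rw [meet_map_reflConj, hl, hX]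
    · rw [List.length_map, hp]
    · simp [map_list_prod, List.map_map, Function.comp_def]
  · simp
  · intro x y _ _ hx hy
    rw [map_add]
    exact Submodule.add_mem _ hx hy
  · intro c x _ hx
    rw [map_smul]
    exact Submodule.smul_mem _ _ hx

/-- The character of `g` on `A_X`, for `g` stabilizing `X`. -/
def osChar (X : Submodule ℝ V) (g : G) (hX : X.comap (ρ g) = X) : ℂ :=
  LinearMap.trace ℂ (osComponent s ρ X)
    ((osAct s ρ g).toLinearMap.restrict (osComponent_stable s ρ X g hX))

theorem comap_bot (g : G) : (⊥ : Submodule ℝ V).comap (ρ g) = ⊥ :=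
  LinearMap.ker_eq_bot.mpr (repEquiv ρ g).injective

/-- The character `Ψ_S` of the top component `A_{0}` of the Orlik-Solomon algebra. -/
def topPsi (g : G) : ℂ := osChar s ρ ⊥ g (comap_bot ρ g)

end OrlikSolomon

/-! ## Cuspidal classes and the absolute conjecture -/

section ConjB

variable {G B V : Type*} [Group G] (s : B → G) [AddCommGroup V] [Module ℝ V]
  (ρ : Representation ℝ G V)

/-- `g` is cuspidal: it has no (nonzero) fixed points in the reflection representation. -/
def IsCuspidal (g : G) : Prop := ∀ v : V, ρ g v = v → v = 0

/-- The set of cuspidal conjugacy classes. -/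
abbrev CuspidalClass : Type _ :=
  {C : ConjClasses G // ∀ g : G, ConjClasses.mk g = C → IsCuspidal ρ g}

variable [Fintype B] [DecidableEq B]

/-- The linear characters `φ_{w_C}`, `ψ_{w_C}` of the centralizers `C_G(w_C)` of the
representatives `w_C` of the cuspidal classes satisfy (i)-(iii) of the conjecture for `G`:
`Φ_S = ∑_C Ind φ_{w_C}`, `Ψ_S = ∑_C Ind ψ_{w_C}`, and `ψ_{w_C} = φ_{w_C} ε`. -/
structure SatisfiesB (w : CuspidalClass ρ → G)
    (φ ψ : ∀ C : CuspidalClass ρ, Subgroup.centralizer {w C} →* ℂˣ) : Prop where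
  phi_eq : ∀ g : G, topPhi s g =
    ∑ᶠ C, indChar (Subgroup.centralizer {w C}) ⊤ (fun c => (φ C c : ℂ)) ⟨g, Subgroup.mem_top g⟩
  psi_eq : ∀ g : G, topPsi s ρ g =
    ∑ᶠ C, indChar (Subgroup.centralizer {w C}) ⊤ (fun c => (ψ C c : ℂ)) ⟨g, Subgroup.mem_top g⟩
  psi_eq_phi : ∀ C, ∀ c : Subgroup.centralizer {w C}, (ψ C c : ℂ) = φ C c * sgn s (c : G)

/-- Conjecture B for `G`, with representatives `w_C` of the cuspidal classes. -/
def ConjectureB (w : CuspidalClass ρ → G) : Prop :=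
  ∃ φ ψ : ∀ C : CuspidalClass ρ, Subgroup.centralizer {w C} →* ℂˣ, SatisfiesB s ρ w φ ψ

end ConjB

/-! ## The reflection representation of a Coxeter group -/

section Reflection

variable {B W : Type*} [Fintype B] [DecidableEq B] [Group W] {M : CoxeterMatrix B}

/-- The bilinear form on `V = ℝ^B` with `⟨α_i, α_j⟩ = -cos(π / m_{ij})`. -/
def form (M : CoxeterMatrix B) : LinearMap.BilinForm ℝ (B → ℝ) :=
  Matrix.toBilin' (Matrix.of fun i j => -Real.cos (Real.pi / M i j))

/-- The simple root `α_i`. -/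
def simpleRoot (i : B) : B → ℝ := Pi.single i 1

theorem form_simpleRoot (i j : B) :
    form M (simpleRoot i) (simpleRoot j) = -Real.cos (Real.pi / M i j) := by
  simp [form, simpleRoot, Matrix.toBilin'_single]

theorem two_form_self (i : B) :
    (((2 : ℝ) • form M (simpleRoot i) : (B → ℝ) →ₗ[ℝ] ℝ)) (simpleRoot i) = 2 := by
  simp [form_simpleRoot]

/-- The reflection `v ↦ v - 2 ⟨α_i, v⟩ α_i`. -/
def simpleReflection (M : CoxeterMatrix B) (i : B) : (B → ℝ) ≃ₗ[ℝ] (B → ℝ) :=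
  Module.reflection (two_form_self (M := M) i)

theorem simpleReflection_isLiftable (M : CoxeterMatrix B) :
    M.IsLiftable fun i => (simpleReflection M i : Module.End ℝ (B → ℝ)) := by
  intro i j
  have hcoe : ((simpleReflection M i : Module.End ℝ (B → ℝ)) *
      (simpleReflection M j : Module.End ℝ (B → ℝ))) ^ M i j =
      (((simpleReflection M i * simpleReflection M j) ^ M i j :
        (B → ℝ) ≃ₗ[ℝ] (B → ℝ)) : Module.End ℝ (B → ℝ)) := by
    induction M i j with
    | zero => rfl
    | succ n ih => rw [pow_succ, pow_succ, ih]; rfl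
  rw [hcoe]
  by_cases hij : i = j
  · subst hij
    have : simpleReflection M i * simpleReflection M i = 1 := by
      ext1 v
      exact Module.involutive_reflection _ v
    rw [this, one_pow]
    rfl
  have h1 : M i j ≠ 1 := M.off_diagonal i j hij
  obtain h0 | h0 := eq_or_ne (M i j) 0
  · rw [h0]; rfl
  refine LinearMap.ext fun z => ?_
  change ((Module.reflection (two_form_self (M := M) i) *
    Module.reflection (two_form_self (M := M) j)) ^ M i j) z = z
  have hgx : (((2 : ℝ) • form M (simpleRoot j) : (B → ℝ) →ₗ[ℝ] ℝ)) (simpleRoot i) =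
      -2 * Real.cos (Real.pi / M i j) := by
    simp [form_simpleRoot, M.symmetric j i]
  have hfy : (((2 : ℝ) • form M (simpleRoot i) : (B → ℝ) →ₗ[ℝ] ℝ)) (simpleRoot j) =
      -2 * Real.cos (Real.pi / M i j) := by
    simp [form_simpleRoot]
  have ht : 2 * Real.cos (2 * (Real.pi / M i j)) =
      (((2 : ℝ) • form M (simpleRoot i) : (B → ℝ) →ₗ[ℝ] ℝ)) (simpleRoot j) *
      (((2 : ℝ) • form M (simpleRoot j) : (B → ℝ) →ₗ[ℝ] ℝ)) (simpleRoot i) - 2 := by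
    rw [hgx, hfy, Real.cos_two_mul]; ring
  rw [Module.reflection_mul_reflection_pow_apply _ _ _ z _ ht]
  obtain h2 | h2 := eq_or_ne (M i j) 2
  · rw [hgx, hfy, h2]
    norm_num [Polynomial.Chebyshev.S_zero, Polynomial.Chebyshev.S_one,
      Polynomial.Chebyshev.S_neg_one, mul_div_cancel₀]
    abel
  have h3 : 3 ≤ M i j := by lia
  set m := M i j with hm
  have hmR : (3 : ℝ) ≤ m := by exact_mod_cast h3
  set θ := 2 * (Real.pi / m) with hθ
  have hmθ : (m : ℝ) * θ = 2 * Real.pi := by rw [hθ]; field_simp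
  have hsin : Real.sin θ ≠ 0 := by
    refine (Real.sin_pos_of_pos_of_lt_pi ?_ ?_).ne'
    · have := Real.pi_pos; positivity
    · have := Real.pi_pos
      nlinarith
  have hS (n : ℤ) : (Polynomial.Chebyshev.S ℝ n).eval (2 * Real.cos θ) * Real.sin θ =
      Real.sin ((n + 1) * θ) := Polynomial.Chebyshev.S_two_mul_real_cos θ n
  suffices h : (Polynomial.Chebyshev.S ℝ (((m : ℤ) - 2) / 2)).eval (2 * Real.cos θ) *
        ((Polynomial.Chebyshev.S ℝ (((m : ℤ) - 1) / 2)).eval (2 * Real.cos θ) +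
          (Polynomial.Chebyshev.S ℝ (((m : ℤ) - 3) / 2)).eval (2 * Real.cos θ)) = 0 ∧
      (Polynomial.Chebyshev.S ℝ (((m : ℤ) - 1) / 2)).eval (2 * Real.cos θ) *
        ((Polynomial.Chebyshev.S ℝ ((m : ℤ) / 2)).eval (2 * Real.cos θ) +
          (Polynomial.Chebyshev.S ℝ (((m : ℤ) - 2) / 2)).eval (2 * Real.cos θ)) = 0 by
    rw [h.1, h.2]; simp
  obtain ⟨k, hk | hk⟩ := Nat.even_or_odd' m
  · have e1 : ((m : ℤ) - 2) / 2 = k - 1 := by lia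
    have e2 : ((m : ℤ) - 1) / 2 = k - 1 := by lia
    have hz : (Polynomial.Chebyshev.S ℝ ((k : ℤ) - 1)).eval (2 * Real.cos θ) = 0 := by
      have := hS ((k : ℤ) - 1)
      have hkθ : (((k : ℤ) - 1 : ℤ) + 1 : ℝ) * θ = Real.pi := by
        rw [hk] at hmθ; push_cast at hmθ ⊢; linarith
      rw [hkθ, Real.sin_pi] at this
      exact (mul_eq_zero.mp this).resolve_right hsin
    rw [e1, e2, hz]; simp
  · have e1 : ((m : ℤ) - 2) / 2 = k - 1 := by lia
    have e2 : ((m : ℤ) - 1) / 2 = k := by lia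
    have e3 : ((m : ℤ) - 3) / 2 = k - 1 := by lia
    have e4 : (m : ℤ) / 2 = k := by lia
    have hz : (Polynomial.Chebyshev.S ℝ (k : ℤ)).eval (2 * Real.cos θ) +
        (Polynomial.Chebyshev.S ℝ ((k : ℤ) - 1)).eval (2 * Real.cos θ) = 0 := by
      have ha := hS (k : ℤ)
      have hb := hS ((k : ℤ) - 1)
      have hkθ : ((k : ℤ) + 1 : ℝ) * θ = 2 * Real.pi - (((k : ℤ) - 1 : ℤ) + 1 : ℝ) * θ := by
        rw [hk] at hmθ; push_cast at hmθ ⊢; linarith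
      rw [hkθ, Real.sin_two_pi_sub] at ha
      refine (mul_eq_zero.mp (?_ : _ * Real.sin θ = 0)).resolve_right hsin
      rw [add_mul, ha, hb]; ring
    rw [e1, e2, e3, e4, hz]; simp

/-- The reflection representation of a Coxeter group `W` on `V = ℝ^B`, in which the simple
reflection `s_i` acts as `v ↦ v - 2 ⟨α_i, v⟩ α_i`. -/
def reflRep (cs : CoxeterSystem M W) : Representation ℝ W (B → ℝ) :=
  cs.lift ⟨_, simpleReflection_isLiftable M⟩

theorem reflRep_simple (cs : CoxeterSystem M W) (i : B) (v : B → ℝ) :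
    reflRep cs (cs.simple i) v = v - (2 * form M (simpleRoot i) v) • simpleRoot i := by
  have h : reflRep cs (cs.simple i) = simpleReflection M i :=
    cs.lift_apply_simple (simpleReflection_isLiftable M) i
  rw [h]
  simp [simpleReflection, Module.reflection_apply]

theorem form_symm (x y : B → ℝ) : form M x y = form M y x := by
  simp only [form, Matrix.toBilin'_apply, Matrix.of_apply]
  rw [Finset.sum_comm]
  refine Finset.sum_congr rfl fun j _ => Finset.sum_congr rfl fun i _ => ?_
  rw [M.symmetric i j]
  ring

theorem form_reflRep (cs : CoxeterSystem M W) (w : W) (x y : B → ℝ) :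
    form M (reflRep cs w x) (reflRep cs w y) = form M x y := by
  induction w using cs.simple_induction_left generalizing x y with
  | one => simp
  | mul_simple_left w i ih =>
    rw [map_mul, Module.End.mul_apply, Module.End.mul_apply, reflRep_simple, reflRep_simple]
    simp only [map_sub, map_smul, LinearMap.sub_apply, LinearMap.smul_apply, smul_eq_mul,
      form_simpleRoot, ih, form_symm _ (simpleRoot i)]
    simp
    ring

/-- The fixed point space `Fix(H)` of a subgroup `H` of `W`. -/
def fixedSpace (cs : CoxeterSystem M W) (H : Subgroup W) : Submodule ℝ (B → ℝ) where
  carrier := {v | ∀ h ∈ H, reflRep cs h v = v}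
  add_mem' := fun hx hy h hh => by rw [map_add, hx h hh, hy h hh]
  zero_mem' := fun h _ => map_zero _
  smul_mem' := fun c x hx h hh => by rw [map_smul, hx h hh]

theorem fixedSpace_comap (cs : CoxeterSystem M W) (H : Subgroup W) (w : W)
    (hw : w ∈ Subgroup.normalizer (H : Set W)) :
    (fixedSpace cs H).comap (reflRep cs w) = fixedSpace cs H := by
  ext v
  have hinv : ∀ u : B → ℝ, reflRep cs w⁻¹ (reflRep cs w u) = u := fun u => by
    rw [← Module.End.mul_apply, ← map_mul]; simp
  have hinv' : ∀ u : B → ℝ, reflRep cs w (reflRep cs w⁻¹ u) = u := fun u => by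
    rw [← Module.End.mul_apply, ← map_mul]; simp
  rw [Subgroup.mem_normalizer_iff] at hw
  constructor
  · intro hv h hh
    have := hv (w * h * w⁻¹) ((hw h).mp hh)
    rw [map_mul, map_mul, Module.End.mul_apply, Module.End.mul_apply, hinv] at this
    have h2 := congrArg (reflRep cs w⁻¹) this
    rwa [hinv, hinv] at h2
  · intro hv h hh
    have hmem : w⁻¹ * h * w ∈ H := by
      rw [hw]; simpa [mul_assoc] using hh
    have := congrArg (reflRep cs w) (hv _ hmem)
    rwa [map_mul, map_mul, Module.End.mul_apply, Module.End.mul_apply, hinv'] at this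

/-- The parabolic subgroup `W_L` of a Coxeter group. -/
abbrev para (cs : CoxeterSystem M W) (L : Finset B) : Subgroup W := parabolic cs.simple L

/-- The simple reflections `s_i`, `i ∈ L`, as elements of `W_L`. -/
def paraSimple (cs : CoxeterSystem M W) (L : Finset B) (i : L) : para cs L :=
  ⟨cs.simple i, Subgroup.subset_closure ⟨i, i.2, rfl⟩⟩

/-- `V_L`, the orthogonal complement of `Fix(W_L)` in `V`. -/
def paraSpace (cs : CoxeterSystem M W) (L : Finset B) : Submodule ℝ (B → ℝ) :=
  (form M).orthogonal (fixedSpace cs (para cs L))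

theorem paraSpace_stable (cs : CoxeterSystem M W) (L : Finset B) (u : para cs L) :
    paraSpace cs L ≤ (paraSpace cs L).comap (reflRep cs (u : W)) := by
  intro v hv x hx
  have h := hv x hx
  have hu : reflRep cs (u : W) x = x := hx u u.2
  change form M x (reflRep cs (u : W) v) = 0
  rw [← hu, form_reflRep]
  exact h

/-- The reflection representation of `W_L`, on `V_L`. -/
def paraRep (cs : CoxeterSystem M W) (L : Finset B) :
    Representation ℝ (para cs L) (paraSpace cs L) :=
  Representation.subrepresentation ((reflRep cs).comp (para cs L).subtype) (paraSpace cs L)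
    (paraSpace_stable cs L)

/-! ## The relative conjecture -/

/-- The normalizer `N_W(W_L)`. -/
abbrev paraNormalizer (cs : CoxeterSystem M W) (L : Finset B) : Subgroup W :=
  Subgroup.normalizer (para cs L : Set W)

/-- `α_L(w) = det(w | Fix(W_L))` for `w ∈ N_W(W_L)`. -/
def alpha (cs : CoxeterSystem M W) (L : Finset B) (w : paraNormalizer cs L) : ℝ :=
  LinearMap.det ((reflRep cs (w : W)).restrict
    (p := fixedSpace cs (para cs L)) (q := fixedSpace cs (para cs L))
    (fixedSpace_comap cs (para cs L) w w.2).ge)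

/-- The character `Φ̃_L` of `N_W(W_L)` extending `Φ_L`: the character of `N_W(W_L)` on
`e_L ℂW_L`, acting by right multiplication. As `e_L ℂW_L` is stable under `N_W(W_L)`, it is the
`N_W(W_L)`-module `e_L ℂN_W(W_L)` generated by `e_L`. -/
def phiTilde (cs : CoxeterSystem M W) (L : Finset B) (w : paraNormalizer cs L) : ℂ :=
  descentChar cs.simple L (paraNormalizer cs L) w

/-- The character `Ψ̃_L` of `N_W(W_L)` extending `Ψ_L`: the character of `N_W(W_L)` on the
component `A_X` of the Orlik-Solomon algebra of `W`, where `X = Fix(W_L)`. -/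
def psiTilde (cs : CoxeterSystem M W) (L : Finset B) (w : paraNormalizer cs L) : ℂ :=
  osChar cs.simple (reflRep cs) (fixedSpace cs (para cs L)) w
    (fixedSpace_comap cs (para cs L) w w.2)

/-- The linear characters `φ̃_{w_C}`, `ψ̃_{w_C}` of the centralizers `C_W(w_C)` (which are
contained in `N_W(W_L)`), for `C` a cuspidal class of `W_L` with representative `w_C`, satisfy
(i)-(iii) of the conjecture for `L ⊆ S`: `Φ̃_L = ∑_C Ind φ̃_{w_C}`, `Ψ̃_L = ∑_C Ind ψ̃_{w_C}`, with
induction from `C_W(w_C)` to `N_W(W_L)`, and `ψ̃_{w_C} = φ̃_{w_C} ε α_L`. -/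
structure SatisfiesC (cs : CoxeterSystem M W) (L : Finset B)
    (w : CuspidalClass (paraRep cs L) → para cs L)
    (φ ψ : ∀ C : CuspidalClass (paraRep cs L), Subgroup.centralizer {(w C : W)} →* ℂˣ) :
    Prop where
  centralizer_le : ∀ C, Subgroup.centralizer {(w C : W)} ≤ paraNormalizer cs L
  phi_eq : ∀ g : paraNormalizer cs L, phiTilde cs L g =
    ∑ᶠ C, indChar (Subgroup.centralizer {(w C : W)}) (paraNormalizer cs L)
      (fun c => (φ C c : ℂ)) g
  psi_eq : ∀ g : paraNormalizer cs L, psiTilde cs L g =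
    ∑ᶠ C, indChar (Subgroup.centralizer {(w C : W)}) (paraNormalizer cs L)
      (fun c => (ψ C c : ℂ)) g
  psi_eq_phi : ∀ C, ∀ c : Subgroup.centralizer {(w C : W)},
    (ψ C c : ℂ) = φ C c * sgn cs.simple (c : W) * (alpha cs L ⟨c, centralizer_le C c.2⟩ : ℂ)

/-- Conjecture C for `L ⊆ S`, with representatives `w_C` of the cuspidal classes of `W_L`. -/
def ConjectureC (cs : CoxeterSystem M W) (L : Finset B)
    (w : CuspidalClass (paraRep cs L) → para cs L) : Prop :=
  ∃ φ ψ : ∀ C : CuspidalClass (paraRep cs L), Subgroup.centralizer {(w C : W)} →* ℂˣ,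
    SatisfiesC cs L w φ ψ

/-- `C_W(w)` is the internal direct product of `C_{W_L}(w)` and `N_L`, and `φ̃ = φ × 1_{N_L}`. -/
structure IsTimesTrivial (cs : CoxeterSystem M W) (L : Finset B) (w : para cs L)
    (φ : Subgroup.centralizer {w} →* ℂˣ) (φ' : Subgroup.centralizer {(w : W)} →* ℂˣ) :
    Prop where
  mul_mem : ∀ u : Subgroup.centralizer {w}, ∀ n ∈ normalizerComplement cs.simple L,
    ((u : para cs L) : W) * n ∈ Subgroup.centralizer {(w : W)}
  commute : ∀ u : Subgroup.centralizer {w}, ∀ n ∈ normalizerComplement cs.simple L,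
    Commute ((u : para cs L) : W) n
  existsUnique : ∀ c ∈ Subgroup.centralizer {(w : W)},
    ∃! p : Subgroup.centralizer {w} × normalizerComplement cs.simple L,
      c = ((p.1 : para cs L) : W) * p.2
  apply_mul : ∀ (u : Subgroup.centralizer {w}) (n : W)
    (hn : n ∈ normalizerComplement cs.simple L),
    φ' ⟨((u : para cs L) : W) * n, mul_mem u n hn⟩ = φ u

end Reflection

end CoxArr

end

/-!
Bulkiness makes the whole problem a direct product. An element of `N_L` maps each simple root in
`L` to a positive root with the same reflection, so it fixes every simple root in `L`, and hence
`V_L`, pointwise. Thus `N_W(W_L) = W_L × N_L`. A cuspidal element `w` of `W_L` satisfies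
`Fix(w) = Fix(W_L)`, so its centralizer stabilizes `Fix(W_L)`; since a reflection fixing `Fix(W_L)`
pointwise lies in `W_L`, the centralizer normalizes `W_L` (`centralizer_le_normalizer`), and it
follows that `C_W(w) = C_{W_L}(w) × N_L`. Induction of `φ × 1` from `C_{W_L}(w) × N_L` to
`W_L × N_L` is induction of `φ` on the first factor (`indChar_centralizerProj`). The conjecture for
`L` thereby reduces to that for `W_L` once three functions on `W_L × N_L` are seen to depend on the
`W_L`-component only and to restrict to the right functions on `W_L`.

*The sign.* The sign character is the determinant of the reflection representation. As `n ∈ N_L`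
is trivial on `V_L`, which is a complement of `Fix(W_L)`, and `W_L` is trivial on `Fix(W_L)`, the
product `ε α_L` is `ε` on `W_L` and `ε(n)² = 1` on `N_L` (`sgn_mul_alpha`).

*The Orlik-Solomon algebra.* The inclusion of the generators gives a homomorphism from `A(W_L)` to
`A(W)`. It has a left inverse, which kills the generators `a_t` with `t ∉ W_L`; this respects the
relations, because if exactly one of several dependent hyperplanes does not contain `Fix(W_L)`,
the others are dependent. So the inclusion is injective, and it carries the top component onto the
component of `Fix(W_L)`, compatibly with the actions (`psiTilde_mul`).

*The descent algebra.* The matrix inverse to `m` is triangular, and `x_K = x_L x_K^L` for `K ⊆ L`,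
where `x_K^L` is the analogue of `x_K` for `W_L`; hence `e_L = x_L f` with `f` in the descent
algebra of `W_L`. In general `f` is not proportional to the element `e` of `ℂW_L` defined by the
matrix `m` of `W_L`, but both are left annihilators of all `x_J^L` with `J` a proper subset of `L`
(`sum_smul_xElt_mul_xElt`). Indeed, the coefficients of both satisfy the linear equations given by
a matrix `m` in which the elements of `X_K ∩ X_J^♯` are counted with positive weights, and Solomon's
formula for `x_K x_J` lets one write every solution as a multiple of a product of factors `1 - ℓ_r`,
each of which moves the span of the `x_J^L` with `|J| ≤ r` to that of the `x_J^L` with `|J| < r`.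
It follows that `f e = c' f` and `e f = c e` with nonzero scalars `c` and `c'`, so that left
multiplication by `f` is an isomorphism of right modules from `e ℂW_L` to `f ℂW_L`. Left
multiplication by `x_L` is injective on `ℂW_L`, and `x_L n = x_L` for `n ∈ N_L`, which also commutes
with `f`; so `e_L ℂN_W(W_L) = x_L f ℂW_L` is `e ℂW_L`, with trivial action of `N_L`
(`descentChar_mul`).

All this rests on the fact that every root is positive or negative (`reflRep_nonneg_or_nonpos`) and,
for finite `W`, on the positive definiteness of the form (`form_self_pos`).
-/

set_option linter.unusedSectionVars false

namespace CoxArr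

open Module

/-! ### Positivity of roots -/

section Geometry

variable {B W : Type*} [Fintype B] [DecidableEq B] [Group W] {M : CoxeterMatrix B}

/-- Nonnegative coefficients of the roots of a dihedral group: they are `sin (kθ) / sin θ` with
`θ = π / m` if `m` is finite, and `k` otherwise. -/
theorem exists_dihedral_coeff (m : ℕ) (hm : m ≠ 1) :
    ∃ c : ℕ → ℝ, c 0 = 0 ∧ c 1 = 1 ∧
      (∀ k, c (k + 2) = 2 * Real.cos (Real.pi / m) * c (k + 1) - c k) ∧
      ∀ k, (m = 0 ∨ k ≤ m) → 0 ≤ c k := by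
  obtain rfl | h0 := eq_or_ne m 0
  · refine ⟨fun k => k, by simp, by simp, fun k => ?_, fun k _ => Nat.cast_nonneg k⟩
    simp; ring
  have hm2 : (2 : ℝ) ≤ m := by exact_mod_cast (show 2 ≤ m by lia)
  have hmpos : (0 : ℝ) < m := by linarith
  have hpi := Real.pi_pos
  have hθ : 0 < Real.pi / m := by positivity
  have hθ' : Real.pi / m < Real.pi := by
    rw [div_lt_iff₀ hmpos]; nlinarith
  have hsin : 0 < Real.sin (Real.pi / m) := Real.sin_pos_of_pos_of_lt_pi hθ hθ'
  refine ⟨fun k => Real.sin (k * (Real.pi / m)) / Real.sin (Real.pi / m), by simp,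
    by simp [hsin.ne'], fun k => ?_, fun k hk => ?_⟩
  · have h1 : Real.sin (((k + 2 : ℕ) : ℝ) * (Real.pi / m)) =
        2 * Real.cos (Real.pi / m) * Real.sin (((k + 1 : ℕ) : ℝ) * (Real.pi / m)) -
          Real.sin ((k : ℝ) * (Real.pi / m)) := by
      have e1 : ((k + 2 : ℕ) : ℝ) * (Real.pi / m) =
          ((k + 1 : ℕ) : ℝ) * (Real.pi / m) + Real.pi / m := by push_cast; ring
      have e2 : (k : ℝ) * (Real.pi / m) =
          ((k + 1 : ℕ) : ℝ) * (Real.pi / m) - Real.pi / m := by push_cast; ring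
      rw [e1, e2, Real.sin_add, Real.sin_sub]; ring
    simp only [h1]
    field_simp
  · have hk' : (k : ℝ) ≤ m := by exact_mod_cast hk.resolve_left h0
    refine div_nonneg (Real.sin_nonneg_of_nonneg_of_le_pi (by positivity) ?_) hsin.le
    rw [← mul_div_assoc, div_le_iff₀ hmpos]
    nlinarith

theorem reflRep_simple_simpleRoot (cs : CoxeterSystem M W) (i j : B) :
    reflRep cs (cs.simple i) (simpleRoot j) =
      simpleRoot j + (2 * Real.cos (Real.pi / M i j)) • simpleRoot i := by
  rw [reflRep_simple, form_simpleRoot]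
  module

theorem reflRep_simple_self (cs : CoxeterSystem M W) (i : B) :
    reflRep cs (cs.simple i) (simpleRoot i) = -simpleRoot i := by
  rw [reflRep_simple_simpleRoot]
  simp
  module

/-- The images of `α_i` under the elements `⋯ s_i s_j` of the dihedral group of `s_i` and `s_j`. -/
theorem reflRep_alternatingWord (cs : CoxeterSystem M W) (i j : B) {c : ℕ → ℝ} (h0 : c 0 = 0)
    (h1 : c 1 = 1)
    (hc : ∀ k, c (k + 2) = 2 * Real.cos (Real.pi / M i j) * c (k + 1) - c k) (k : ℕ) :
    reflRep cs (cs.wordProd (CoxeterSystem.alternatingWord i j k)) (simpleRoot i) =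
      if Even k then c (k + 1) • simpleRoot i + c k • simpleRoot j
      else c k • simpleRoot i + c (k + 1) • simpleRoot j := by
  induction k with
  | zero => simp [CoxeterSystem.alternatingWord, h0, h1]
  | succ k ih =>
    rw [CoxeterSystem.alternatingWord_succ', CoxeterSystem.wordProd_cons, map_mul,
      Module.End.mul_apply, ih]
    by_cases hk : Even k
    · have : ¬ Even (k + 1) := by simpa [Nat.even_add_one] using hk
      simp only [hk, this, if_true, if_false, map_add, map_smul, reflRep_simple_self,
        reflRep_simple_simpleRoot, hc, M.symmetric j i]
      module
    · have : Even (k + 1) := by simpa [Nat.even_add_one] using hk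
      simp only [hk, this, if_true, if_false, map_add, map_smul, reflRep_simple_self,
        reflRep_simple_simpleRoot, hc]
      module

theorem simpleRoot_nonneg {B : Type*} [DecidableEq B] (i : B) : 0 ≤ simpleRoot i := by
  intro b
  by_cases h : b = i
  · subst h; simp [simpleRoot]
  · simp [simpleRoot, h]

theorem reflRep_nonneg_of_smul_add_smul (cs : CoxeterSystem M W) {v : W} {i j : B}
    (hi : 0 ≤ reflRep cs v (simpleRoot i)) (hj : 0 ≤ reflRep cs v (simpleRoot j)) {a b : ℝ}
    (ha : 0 ≤ a) (hb : 0 ≤ b) : 0 ≤ reflRep cs v (a • simpleRoot i + b • simpleRoot j) := by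
  rw [map_add, map_smul, map_smul]
  exact add_nonneg (smul_nonneg ha hi) (smul_nonneg hb hj)

/-- If `ℓ(w s_i) > ℓ(w)`, then `w α_i` is a positive root. The proof strips off `w` on the right
the longest possible alternating word in `s_i` and a right descent `s_j` of `w`; what is left is
shorter than `w` and has neither `s_i` nor `s_j` as a right descent. -/
theorem reflRep_nonneg_of_length_lt (cs : CoxeterSystem M W) (w : W) (i : B)
    (h : cs.length w < cs.length (w * cs.simple i)) : 0 ≤ reflRep cs w (simpleRoot i) := by
  induction hn : cs.length w using Nat.strong_induction_on generalizing w i with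
  | _ n ih =>
  subst hn
  obtain rfl | hw := eq_or_ne w 1
  · simpa using simpleRoot_nonneg i
  obtain ⟨j, hj⟩ := cs.exists_rightDescent_of_ne_one hw
  have hij : i ≠ j := by
    rintro rfl
    exact absurd hj (not_lt.mpr h.le)
  let p : ℕ → Prop := fun k => ∃ v, w = v * cs.wordProd (CoxeterSystem.alternatingWord i j k) ∧
    cs.length v + k = cs.length w
  have hp1 : p 1 := by
    refine ⟨w * cs.simple j, by simp [CoxeterSystem.alternatingWord], ?_⟩
    exact cs.isRightDescent_iff.mp hj
  have hbd : ∀ k, p k → k ≤ cs.length w := by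
    rintro k ⟨v, -, hv⟩
    lia
  classical
  set k := Nat.findGreatest p (cs.length w)
  have hpk : p k := Nat.findGreatest_spec (hbd 1 hp1) hp1
  have hk1 : 1 ≤ k := Nat.le_findGreatest (hbd 1 hp1) hp1
  have hmax : ¬ p (k + 1) := fun hp => by
    have := Nat.le_findGreatest (hbd _ hp) hp
    lia
  clear_value k
  obtain ⟨v, hv, hvl⟩ := hpk
  have hlenalt : ∀ a b : B, ∀ m,
      cs.length (cs.wordProd (CoxeterSystem.alternatingWord a b m)) ≤ m := fun a b m =>
    (cs.length_wordProd_le _).trans (CoxeterSystem.length_alternatingWord a b m).le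
  -- the next letter of the alternating word is not a descent of `v`
  have hnext : cs.length v < cs.length (v * cs.simple (if Even k then j else i)) := by
    by_contra hcon
    refine hmax ⟨v * cs.simple (if Even k then j else i), ?_, ?_⟩
    · rw [CoxeterSystem.alternatingWord_succ', CoxeterSystem.wordProd_cons, ← mul_assoc,
        cs.simple_mul_simple_cancel_right, hv]
    · have := cs.length_mul_simple v (if Even k then j else i)
      lia
  -- nor is its first letter
  have hfirst : cs.length v < cs.length (v * cs.simple (if Even k then i else j)) := by
    by_contra hcon
    have h1 := cs.length_mul_simple v (if Even k then i else j)
    obtain ⟨l, rfl⟩ : ∃ l, k = l + 1 := ⟨k - 1, by lia⟩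
    have h2 : w = (v * cs.simple (if Even l then j else i)) *
        cs.wordProd (CoxeterSystem.alternatingWord i j l) := by
      rw [hv, CoxeterSystem.alternatingWord_succ', CoxeterSystem.wordProd_cons, ← mul_assoc]
    have h3 : (if Even (l + 1) then i else j) = if Even l then j else i := by
      by_cases hl : Even l <;> simp [hl, Nat.even_add_one]
    rw [h3] at h1 hcon
    have h4 := cs.length_mul_le (v * cs.simple (if Even l then j else i))
      (cs.wordProd (CoxeterSystem.alternatingWord i j l))
    rw [← h2] at h4
    have := hlenalt i j l
    lia
  have hlt : cs.length v < cs.length w := by lia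
  have hvi : 0 ≤ reflRep cs v (simpleRoot i) := by
    refine ih _ hlt v i ?_ rfl
    by_cases hl : Even k <;> simp only [hl, if_true, if_false] at hfirst hnext <;> assumption
  have hvj : 0 ≤ reflRep cs v (simpleRoot j) := by
    refine ih _ hlt v j ?_ rfl
    by_cases hl : Even k <;> simp only [hl, if_true, if_false] at hfirst hnext <;> assumption
  -- the alternating word is too short to be rewritten by a braid relation
  have hkm : M i j = 0 ∨ k < M i j := by
    by_contra! hcon
    obtain ⟨hm0, hkm⟩ := hcon
    have hbraid : cs.wordProd (CoxeterSystem.alternatingWord i j (M i j)) =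
        cs.wordProd (CoxeterSystem.alternatingWord j i (M i j)) := by
      have := cs.wordProd_braidWord_eq i j
      rw [CoxeterSystem.braidWord, CoxeterSystem.braidWord, M.symmetric j i] at this
      exact this
    have hsplit : ∀ r, ∃ u : W, cs.length u ≤ r ∧
        cs.wordProd (CoxeterSystem.alternatingWord i j (M i j + r)) =
          u * cs.wordProd (CoxeterSystem.alternatingWord i j (M i j)) := by
      intro r
      induction r with
      | zero => exact ⟨1, by simp, by simp⟩
      | succ r ihr =>
        obtain ⟨u, hu, he⟩ := ihr
        refine ⟨cs.simple (if Even (M i j + r) then j else i) * u, ?_, ?_⟩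
        · have := cs.length_mul_le (cs.simple (if Even (M i j + r) then j else i)) u
          rw [cs.length_simple] at this
          lia
        · rw [← add_assoc, CoxeterSystem.alternatingWord_succ', CoxeterSystem.wordProd_cons, he,
            mul_assoc]
    obtain ⟨u, hu, he⟩ := hsplit (k - M i j)
    rw [Nat.add_sub_cancel' hkm] at he
    obtain ⟨m', hm'⟩ : ∃ m', M i j = m' + 1 := ⟨M i j - 1, by lia⟩
    have h5 : w * cs.simple i = v * (u * cs.wordProd (CoxeterSystem.alternatingWord i j m')) := by
      rw [hv, he, hbraid, hm', CoxeterSystem.alternatingWord_succ, CoxeterSystem.wordProd_concat]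
      simp [mul_assoc]
    have h6 := cs.length_mul_le v (u * cs.wordProd (CoxeterSystem.alternatingWord i j m'))
    have h7 := cs.length_mul_le u (cs.wordProd (CoxeterSystem.alternatingWord i j m'))
    have h8 := hlenalt i j m'
    rw [← h5] at h6
    lia
  obtain ⟨c, hc0, hc1, hc, hcpos⟩ := exists_dihedral_coeff (M i j) (M.off_diagonal i j hij)
  have hck : 0 ≤ c k := hcpos k (by lia)
  have hck1 : 0 ≤ c (k + 1) := hcpos (k + 1) (by lia)
  rw [hv, map_mul, Module.End.mul_apply, reflRep_alternatingWord cs i j hc0 hc1 hc]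
  split_ifs
  · exact reflRep_nonneg_of_smul_add_smul cs hvi hvj hck1 hck
  · exact reflRep_nonneg_of_smul_add_smul cs hvi hvj hck hck1

theorem reflRep_nonpos_of_length_lt (cs : CoxeterSystem M W) (w : W) (i : B)
    (h : cs.length (w * cs.simple i) < cs.length w) : reflRep cs w (simpleRoot i) ≤ 0 := by
  have h1 := reflRep_nonneg_of_length_lt cs (w * cs.simple i) i (by simpa using h)
  rw [map_mul, Module.End.mul_apply, reflRep_simple_self, map_neg] at h1
  exact neg_nonneg.mp h1

theorem reflRep_nonneg_or_nonpos (cs : CoxeterSystem M W) (w : W) (i : B) :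
    0 ≤ reflRep cs w (simpleRoot i) ∨ reflRep cs w (simpleRoot i) ≤ 0 :=
  (cs.length_mul_simple_ne w i).symm.lt_or_gt.imp (reflRep_nonneg_of_length_lt cs w i)
    (reflRep_nonpos_of_length_lt cs w i)

/-- A nontrivial element has a right descent `s_i`, and maps `α_i` to a negative root. -/
theorem reflRep_faithful (cs : CoxeterSystem M W) (w : W) (h : ∀ v, reflRep cs w v = v) :
    w = 1 := by
  by_contra hw
  obtain ⟨i, hi⟩ := cs.exists_rightDescent_of_ne_one hw
  have := reflRep_nonpos_of_length_lt cs w i hi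
  rw [h] at this
  have := this i
  simp [simpleRoot] at this
  linarith

/-! ### Positive definiteness of the form -/

/-- For finite `W` the form is positive definite: rescaling the simple roots to unit vectors for
an invariant inner product turns the Gram matrix of the form into that of the inner product. -/
theorem form_self_pos [Finite W] (cs : CoxeterSystem M W) (v : B → ℝ) (hv : v ≠ 0) :
    0 < form M v v := by
  cases nonempty_fintype W
  -- an invariant inner product, and the norms of the simple roots
  let q : (B → ℝ) → (B → ℝ) → ℝ := fun x y => ∑ w : W, reflRep cs w x ⬝ᵥ reflRep cs w y
  have qadd : ∀ x y z, q x (y + z) = q x y + q x z := fun x y z => by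
    simp only [q, map_add, dotProduct_add, Finset.sum_add_distrib]
  have qsmul : ∀ (a : ℝ) x y, q x (a • y) = a * q x y := fun a x y => by
    simp only [q, map_smul, dotProduct_smul, smul_eq_mul, Finset.mul_sum]
  have qsymm : ∀ x y, q x y = q y x := fun x y => by
    simp only [q, dotProduct_comm]
  have qinv : ∀ g x y, q (reflRep cs g x) (reflRep cs g y) = q x y := fun g x y => by
    simp only [q, ← Module.End.mul_apply, ← map_mul]
    exact Fintype.sum_equiv (Equiv.mulRight g) _ _ fun w => rfl
  have qnonneg : ∀ x, 0 ≤ q x x := fun x =>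
    Finset.sum_nonneg fun w _ => Finset.sum_nonneg fun i _ => mul_self_nonneg _
  have qpos : ∀ x, x ≠ 0 → 0 < q x x := fun x hx => by
    refine lt_of_lt_of_le ?_ (Finset.single_le_sum
      (f := fun w : W => reflRep cs w x ⬝ᵥ reflRep cs w x)
      (fun w _ => Finset.sum_nonneg fun i _ => mul_self_nonneg _) (Finset.mem_univ 1))
    have h0 : 0 ≤ x ⬝ᵥ x := Finset.sum_nonneg fun i _ => mul_self_nonneg _
    simpa using lt_of_le_of_ne h0 (by simpa [eq_comm] using hx)
  have hroot : ∀ i : B, simpleRoot i ≠ 0 := fun i h => by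
    have := congrFun h i
    simp [simpleRoot] at this
  set c : B → ℝ := fun i => q (simpleRoot i) (simpleRoot i) with hc
  have cpos : ∀ i, 0 < c i := fun i => qpos _ (hroot i)
  have hform : ∀ i x, c i * form M (simpleRoot i) x = q (simpleRoot i) x := fun i x => by
    have h1 := qinv (cs.simple i) (simpleRoot i) x
    have h2 : q (-simpleRoot i) (x - (2 * form M (simpleRoot i) x) • simpleRoot i) =
        -q (simpleRoot i) x + 2 * form M (simpleRoot i) x * c i := by
      rw [qsymm, ← neg_one_smul ℝ (simpleRoot i), qsmul, qsymm, sub_eq_add_neg, qadd,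
        ← neg_smul, qsmul]
      simp only [hc]; ring
    rw [reflRep_simple_self, reflRep_simple, h2] at h1
    linarith
  have hsum : ∀ x : B → ℝ, x = ∑ i, x i • simpleRoot i := fun x => by
    ext b
    simp [simpleRoot, Finset.sum_apply, Pi.single_apply]
  have qsum : ∀ (x : B → ℝ) (t : Finset B) (a : B → ℝ),
      q x (∑ i ∈ t, a i • simpleRoot i) = ∑ i ∈ t, a i * q x (simpleRoot i) := fun x t a => by
    classical
    induction t using Finset.induction_on with
    | empty => simp [q]
    | insert i t hi ih => rw [Finset.sum_insert hi, Finset.sum_insert hi, qadd, qsmul, ih]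
  set y : B → ℝ := ∑ i, (v i / √(c i)) • simpleRoot i with hy
  have hyv : form M v v = q y y := by
    have h1 : form M v v = ∑ i, v i * ∑ j, v j * form M (simpleRoot i) (simpleRoot j) := by
      conv_lhs => rw [hsum v]
      simp only [map_sum, map_smul, LinearMap.sum_apply, LinearMap.smul_apply, smul_eq_mul,
        Finset.mul_sum]
      rw [Finset.sum_comm]
      refine Finset.sum_congr rfl fun i _ => Finset.sum_congr rfl fun j _ => ?_
      rw [form_symm]; ring
    rw [h1, hy, qsum]
    refine Finset.sum_congr rfl fun i _ => ?_
    rw [qsymm, qsum, Finset.mul_sum, Finset.mul_sum]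
    refine Finset.sum_congr rfl fun j _ => ?_
    have e1 := hform i (simpleRoot j)
    have e2 := hform j (simpleRoot i)
    rw [form_symm, qsymm] at e2
    have hi := Real.sqrt_pos.mpr (cpos i)
    have hj := Real.sqrt_pos.mpr (cpos j)
    by_cases h0 : form M (simpleRoot i) (simpleRoot j) = 0
    · rw [h0] at e1 ⊢
      rw [← e1]; simp
    · have hcc : c i = c j := mul_right_cancel₀ h0 (e1.trans e2.symm)
      rw [← e1, ← hcc]
      have := Real.mul_self_sqrt (cpos i).le
      field_simp
      rw [Real.sq_sqrt (cpos i).le]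
  rw [hyv]
  refine qpos y fun h => hv ?_
  ext b
  have := congrFun h b
  simp only [hy, Finset.sum_apply, simpleRoot, Pi.smul_apply, Pi.single_apply, smul_eq_mul,
    mul_ite, mul_one, mul_zero, Finset.sum_ite_eq, Finset.mem_univ, if_true, Pi.zero_apply,
    div_eq_zero_iff] at this
  exact this.resolve_right (Real.sqrt_pos.mpr (cpos b)).ne'

end Geometry

/-! ### Groups generated by reflections with positive and negative roots -/

/-- The vector of `ℝ^ι` representing the simple root `α_i`. -/
noncomputable def rootVec {B ι : Type*} [DecidableEq ι] (e : B → ι) (i : B) : ι → ℝ :=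
  Pi.single (e i) 1

/-- A group `G` generated by reflections `s_i` of `ℝ^ι`, with simple roots `α_i` among the
standard basis vectors and an invariant form `f`, such that every root `g α_i` has coordinates of
one sign. Coxeter groups and their parabolic subgroups are of this kind; the latter act on the space
of the whole group, which is why the index set `ι` of the basis may be larger than `B`. -/
structure RootData {G B ι : Type*} [Group G] [DecidableEq ι] (s : B → G) (e : B → ι)
    (ρ : Representation ℝ G (ι → ℝ)) (f : LinearMap.BilinForm ℝ (ι → ℝ)) : Prop where
  inj : Function.Injective e
  gen : Subgroup.closure (Set.range s) = ⊤
  refl : ∀ i v, ρ (s i) v = v - (2 * f (rootVec e i) v) • rootVec e i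
  inv : ∀ g x y, f (ρ g x) (ρ g y) = f x y
  one : ∀ i, f (rootVec e i) (rootVec e i) = 1
  faithful : ∀ g, (∀ v, ρ g v = v) → g = 1
  pos : ∀ g i, 0 ≤ ρ g (rootVec e i) ∨ ρ g (rootVec e i) ≤ 0

section Words

variable {G B : Type*} [Group G] {s : B → G}

theorem exists_word_of_mem_parabolic (hs : ∀ i, s i * s i = 1) {J : Finset B} {g : G}
    (hg : g ∈ parabolic s J) : ∃ ω : List B, (∀ i ∈ ω, i ∈ J) ∧ (ω.map s).prod = g := by
  refine Subgroup.closure_induction (p := fun g _ => ∃ ω : List B, (∀ i ∈ ω, i ∈ J) ∧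
    (ω.map s).prod = g) ?_ ⟨[], by simp, by simp⟩ ?_ ?_ hg
  · rintro _ ⟨i, hi, rfl⟩
    exact ⟨[i], by simpa using hi, by simp⟩
  · rintro _ _ _ _ ⟨ω, h, rfl⟩ ⟨ω', h', rfl⟩
    refine ⟨ω ++ ω', fun i hi => ?_, by simp⟩
    exact (List.mem_append.mp hi).elim (h i) (h' i)
  · rintro _ _ ⟨ω, h, rfl⟩
    refine ⟨ω.reverse, fun i hi => h i (by simpa using hi), ?_⟩
    rw [List.prod_inv_reverse, List.map_map, List.map_reverse]
    congr 2
    exact List.map_congr_left fun i _ => eq_inv_of_mul_eq_one_left (hs i)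

theorem simple_mem_parabolic {J : Finset B} {i : B} (h : i ∈ J) : s i ∈ parabolic s J :=
  Subgroup.subset_closure ⟨i, h, rfl⟩

theorem wordLength_prod_le (ω : List B) : wordLength s (ω.map s).prod ≤ ω.length :=
  Nat.sInf_le ⟨ω, rfl, rfl⟩

end Words

namespace RootData

section

variable {G ι : Type*} [Group G]

theorem rho_mul (ρ : Representation ℝ G (ι → ℝ)) (g h : G) (v : ι → ℝ) :
    ρ (g * h) v = ρ g (ρ h v) := by
  rw [map_mul, Module.End.mul_apply]

theorem rho_inv_rho (ρ : Representation ℝ G (ι → ℝ)) (g : G) (v : ι → ℝ) :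
    ρ g⁻¹ (ρ g v) = v := by
  rw [← rho_mul]; simp

theorem rho_rho_inv (ρ : Representation ℝ G (ι → ℝ)) (g : G) (v : ι → ℝ) :
    ρ g (ρ g⁻¹ v) = v := by
  rw [← rho_mul]; simp

theorem rho_injective (ρ : Representation ℝ G (ι → ℝ)) (g : G) : Function.Injective (ρ g) :=
  fun x y h => by rw [← rho_inv_rho ρ g x, h, rho_inv_rho]

end

variable {G B ι : Type*} [Group G] [DecidableEq ι] {s : B → G} {e : B → ι}
  {ρ : Representation ℝ G (ι → ℝ)} {f : LinearMap.BilinForm ℝ (ι → ℝ)}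

theorem eq_of_rho (D : RootData s e ρ f) {g h : G} (H : ∀ v, ρ g v = ρ h v) : g = h := by
  have := D.faithful (g * h⁻¹) fun v => by rw [rho_mul, H, rho_rho_inv]
  exact mul_inv_eq_one.mp this

theorem refl_self (D : RootData s e ρ f) (i : B) : ρ (s i) (rootVec e i) = -rootVec e i := by
  rw [D.refl, D.one]; module

theorem simple_mul_self (D : RootData s e ρ f) (i : B) : s i * s i = 1 :=
  D.faithful _ fun v => by
    rw [rho_mul, D.refl i v, map_sub, map_smul, D.refl_self, D.refl]; module

theorem simple_inv (D : RootData s e ρ f) (i : B) : (s i)⁻¹ = s i :=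
  (eq_inv_of_mul_eq_one_left (D.simple_mul_self i)).symm

theorem rootVec_nonneg (e : B → ι) (i : B) : 0 ≤ rootVec e i := by
  intro b
  by_cases h : b = e i
  · subst h; simp [rootVec]
  · simp [rootVec, h]

theorem rootVec_ne_zero (e : B → ι) (i : B) : rootVec e i ≠ 0 := fun h => by
  have := congrFun h (e i)
  simp [rootVec] at this

theorem rho_rootVec_ne_zero (ρ : Representation ℝ G (ι → ℝ)) (g : G) (i : B) :
    ρ g (rootVec e i) ≠ 0 := fun h =>
  rootVec_ne_zero e i (rho_injective ρ g (by rw [h, map_zero]))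

theorem not_nonneg_iff (D : RootData s e ρ f) (g : G) (i : B) :
    ¬ 0 ≤ ρ g (rootVec e i) ↔ ρ g (rootVec e i) ≤ 0 := by
  constructor
  · intro h
    exact (D.pos g i).resolve_left h
  · intro h h'
    exact rho_rootVec_ne_zero ρ g i (le_antisymm h h')

theorem conj_refl (D : RootData s e ρ f) (g : G) (k : B) (v : ι → ℝ) :
    ρ (g * s k * g⁻¹) v = v - (2 * f (ρ g (rootVec e k)) v) • ρ g (rootVec e k) := by
  rw [rho_mul, rho_mul, D.refl, map_sub, map_smul, rho_rho_inv]
  congr 3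
  rw [← D.inv g, rho_rho_inv]

theorem conj_eq_of_rho_eq (D : RootData s e ρ f) {g : G} {k i : B}
    (h : ρ g (rootVec e k) = rootVec e i) : g * s k * g⁻¹ = s i :=
  D.eq_of_rho fun v => by rw [D.conj_refl, h, D.refl]

/-- A positive root whose reflection is a simple reflection is a simple root. -/
theorem rho_eq_of_conj_eq (D : RootData s e ρ f) {g : G} {k i : B} (h : g * s k * g⁻¹ = s i)
    (hpos : 0 ≤ ρ g (rootVec e k)) : ρ g (rootVec e k) = rootVec e i := by
  set β := ρ g (rootVec e k) with hβ
  have h1 := D.conj_refl g k (rootVec e i)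
  rw [h, D.refl_self, ← hβ] at h1
  -- comparing the two reflections on `α_i` shows that `α_i` is a multiple of `β`
  have h2 : rootVec e i = (f β (rootVec e i)) • β := by
    have h3 : (2 : ℝ) • rootVec e i = (2 : ℝ) • ((f β (rootVec e i)) • β) := by
      have : (2 * f β (rootVec e i)) • β = rootVec e i - (-rootVec e i) := by
        rw [h1]; module
      rw [smul_smul, this]; module
    exact smul_right_injective _ two_ne_zero h3
  have h4 : f β β = 1 := by rw [hβ, D.inv, D.one]
  set c := f β (rootVec e i) with hc
  have h5 : c * c = 1 := by
    have := D.one i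
    rw [h2] at this
    simpa [h4] using this
  have h6 : 0 < c := by
    by_contra hcon
    have h7 : rootVec e i ≤ 0 := by
      rw [h2]; exact smul_nonpos_of_nonpos_of_nonneg (not_lt.mp hcon) hpos
    exact rootVec_ne_zero e i (le_antisymm h7 (rootVec_nonneg e i))
  have h8 : c = 1 := by nlinarith
  rw [h2, h8, one_smul]

theorem rho_eq_of_smul (D : RootData s e ρ f) {g : G} {k i : B} {c : ℝ}
    (h : ρ g (rootVec e k) = c • rootVec e i) (hpos : 0 ≤ ρ g (rootVec e k)) :
    ρ g (rootVec e k) = rootVec e i := by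
  have h1 : c * c = 1 := by
    have := D.inv g (rootVec e k) (rootVec e k)
    rw [h, D.one] at this
    simpa [D.one] using this
  have h2 : 0 ≤ c := by
    have := hpos (e i)
    rw [h] at this
    simpa [rootVec] using this
  have h3 : c = 1 := by nlinarith
  rw [h, h3, one_smul]

/-- A simple reflection changes the sign of no positive root but its own. -/
theorem rho_eq_of_sign_change (D : RootData s e ρ f) {g : G} {k i : B}
    (h : 0 ≤ ρ g (rootVec e k)) (h' : ¬ 0 ≤ ρ (s i) (ρ g (rootVec e k))) :
    ρ g (rootVec e k) = rootVec e i := by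
  refine D.rho_eq_of_smul (c := ρ g (rootVec e k) (e i)) ?_ h
  rw [← rho_mul, D.not_nonneg_iff, rho_mul, D.refl] at h'
  ext b
  by_cases hb : b = e i
  · subst hb; simp [rootVec]
  · have h1 := h' b
    have h2 := h b
    simp [rootVec, hb] at h1 h2 ⊢
    exact le_antisymm h1 h2

/-- The exchange condition, for the reflection in an arbitrary positive root. -/
theorem exchange_root (D : RootData s e ρ f) (k : B) (ω : List B) (g : G)
    (h : 0 ≤ ρ g (rootVec e k)) (h' : ¬ 0 ≤ ρ (ω.map s).prod⁻¹ (ρ g (rootVec e k))) :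
    ∃ r < ω.length, g * s k * g⁻¹ * (ω.map s).prod = ((ω.eraseIdx r).map s).prod := by
  induction ω generalizing g with
  | nil => simp at h'; exact absurd h h'
  | cons i ω ih =>
    by_cases hi : 0 ≤ ρ (s i) (ρ g (rootVec e k))
    · obtain ⟨r, hr, he⟩ := ih (s i * g) (by rwa [rho_mul]) (by
        rw [rho_mul]
        simpa [rho_mul, D.simple_inv] using h')
      refine ⟨r + 1, by simpa using hr, ?_⟩
      have he' : g * s k * g⁻¹ * s i * (ω.map s).prod =
          s i * ((ω.eraseIdx r).map s).prod := by
        rw [← he]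
        simp only [mul_inv_rev, D.simple_inv, ← mul_assoc, D.simple_mul_self, one_mul]
      simpa [mul_assoc] using he'
    · have h1 := D.conj_eq_of_rho_eq (D.rho_eq_of_sign_change h hi)
      refine ⟨0, by simp, ?_⟩
      rw [h1]
      simp [← mul_assoc, D.simple_mul_self]

theorem exchange (D : RootData s e ρ f) (k : B) (ω : List B)
    (h : ¬ 0 ≤ ρ (ω.map s).prod⁻¹ (rootVec e k)) :
    ∃ r < ω.length, s k * (ω.map s).prod = ((ω.eraseIdx r).map s).prod := by
  simpa using D.exchange_root k ω 1 (by simpa using rootVec_nonneg e k) (by simpa using h)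

theorem exists_word (D : RootData s e ρ f) (g : G) :
    ∃ ω : List B, ω.length = wordLength s g ∧ (ω.map s).prod = g := by
  have hne : {n | ∃ ω : List B, ω.length = n ∧ (ω.map s).prod = g}.Nonempty := by
    have : g ∈ Subgroup.closure (Set.range s) := by rw [D.gen]; trivial
    refine Subgroup.closure_induction (p := fun g _ =>
      {n | ∃ ω : List B, ω.length = n ∧ (ω.map s).prod = g}.Nonempty) ?_ ⟨0, [], by simp⟩ ?_ ?_ this
    · rintro _ ⟨i, rfl⟩
      exact ⟨1, [i], by simp⟩
    · rintro _ _ _ _ ⟨_, ω, -, rfl⟩ ⟨_, ω', -, rfl⟩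
      exact ⟨_, ω ++ ω', rfl, by simp⟩
    · rintro _ _ ⟨_, ω, -, rfl⟩
      refine ⟨_, ω.reverse, rfl, ?_⟩
      rw [List.prod_inv_reverse, List.map_map, List.map_reverse]
      congr 2
      exact List.map_congr_left fun i _ => (D.simple_inv i).symm
  exact Nat.sInf_mem hne

theorem wordLength_lt_of_neg (D : RootData s e ρ f) {g : G} {k : B}
    (h : ¬ 0 ≤ ρ g⁻¹ (rootVec e k)) : wordLength s (s k * g) < wordLength s g := by
  obtain ⟨ω, hω, rfl⟩ := D.exists_word g
  obtain ⟨r, hr, he⟩ := D.exchange k ω h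
  rw [he, ← hω]
  refine (wordLength_prod_le _).trans_lt ?_
  rw [List.length_eraseIdx_of_lt hr]
  lia

/-- `s_k` is not a left descent of `g` if and only if `g⁻¹ α_k` is a positive root. -/
theorem wordLength_lt_iff (D : RootData s e ρ f) {g : G} {k : B} :
    wordLength s g < wordLength s (s k * g) ↔ 0 ≤ ρ g⁻¹ (rootVec e k) := by
  constructor
  · intro h
    by_contra hcon
    exact absurd (D.wordLength_lt_of_neg hcon) (not_lt.mpr h.le)
  · intro h
    have h1 : ¬ 0 ≤ ρ (s k * g)⁻¹ (rootVec e k) := by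
      rw [D.not_nonneg_iff, mul_inv_rev, D.simple_inv, rho_mul, D.refl_self, map_neg]
      exact neg_nonpos.mpr h
    simpa [← mul_assoc, D.simple_mul_self] using D.wordLength_lt_of_neg h1

theorem mem_transversal_iff (D : RootData s e ρ f) {J : Finset B} {g : G} :
    g ∈ transversal s J ↔ ∀ k ∈ J, 0 ≤ ρ g⁻¹ (rootVec e k) :=
  forall₂_congr fun _ _ => D.wordLength_lt_iff

theorem transversal_anti (s : B → G) {J K : Finset B} (h : J ⊆ K) :
    transversal s K ⊆ transversal s J := fun _ hg j hj => hg j (h hj)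

theorem one_mem_transversal (D : RootData s e ρ f) (J : Finset B) : 1 ∈ transversal s J :=
  D.mem_transversal_iff.mpr fun k _ => by simpa using rootVec_nonneg e k

/-! ### Decomposition along a parabolic subgroup -/

theorem rho_apply_of_mem_parabolic (D : RootData s e ρ f) {J : Finset B} {u : G}
    (hu : u ∈ parabolic s J) (v : ι → ℝ) {b : ι} (hb : b ∉ e '' (J : Set B)) :
    ρ u v b = v b := by
  refine Subgroup.closure_induction (p := fun u _ => ∀ v : ι → ℝ, ρ u v b = v b)
    ?_ ?_ ?_ ?_ hu v
  · rintro _ ⟨i, hi, rfl⟩ v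
    have : b ≠ e i := fun h => hb ⟨i, hi, h.symm⟩
    simp [D.refl, rootVec, this]
  · simp
  · intro x y _ _ hx hy v
    rw [rho_mul, hx, hy]
  · intro x _ hx v
    rw [← hx (ρ x⁻¹ v), rho_rho_inv]

theorem eq_sum_rootVec {J : Finset B} (he : Function.Injective e) {v : ι → ℝ}
    (hv : ∀ b ∉ e '' (J : Set B), v b = 0) : v = ∑ j ∈ J, v (e j) • rootVec e j := by
  classical
  ext b
  rw [Finset.sum_apply]
  by_cases hb : b ∈ e '' (J : Set B)
  · obtain ⟨j, hj, rfl⟩ := hb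
    rw [Finset.sum_eq_single_of_mem j hj]
    · simp [rootVec]
    · intro k _ hk
      simp [rootVec, he.ne hk.symm]
  · rw [hv b hb, Finset.sum_eq_zero]
    intro k hk
    have : b ≠ e k := fun h => hb ⟨k, hk, h.symm⟩
    simp [rootVec, this]

theorem rho_inv_nonneg_of_mem_transversal (D : RootData s e ρ f) {J : Finset B} {y : G}
    (hy : y ∈ transversal s J) {v : ι → ℝ} (h0 : 0 ≤ v)
    (hv : ∀ b ∉ e '' (J : Set B), v b = 0) : 0 ≤ ρ y⁻¹ v := by
  rw [eq_sum_rootVec D.inj hv, map_sum]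
  refine Finset.sum_nonneg fun j hj => ?_
  rw [map_smul]
  exact smul_nonneg (h0 _) (D.mem_transversal_iff.mp hy j hj)

theorem rho_rootVec_apply_eq_zero (D : RootData s e ρ f) {J : Finset B} {u : G}
    (hu : u ∈ parabolic s J) {k : B} (hk : k ∈ J) {b : ι} (hb : b ∉ e '' (J : Set B)) :
    ρ u (rootVec e k) b = 0 := by
  have : b ≠ e k := fun h => hb ⟨k, hk, h.symm⟩
  rw [D.rho_apply_of_mem_parabolic hu _ hb]
  simp [rootVec, this]

/-- `W_J ∩ X_J = {1}`: the first letter of a shortest word in `J` would be a left descent in `J`. -/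
theorem eq_one_of_mem_transversal (D : RootData s e ρ f) {J : Finset B} {u : G}
    (hu : u ∈ parabolic s J) (ht : u ∈ transversal s J) : u = 1 := by
  classical
  have hex : ∃ n, ∃ ω : List B, ω.length = n ∧ (∀ i ∈ ω, i ∈ J) ∧ (ω.map s).prod = u := by
    obtain ⟨ω, h1, h2⟩ := exists_word_of_mem_parabolic D.simple_mul_self hu
    exact ⟨_, ω, rfl, h1, h2⟩
  obtain ⟨ω, hn, hω, rfl⟩ := Nat.find_spec hex
  cases ω with
  | nil => simp
  | cons k ω =>
    exfalso
    have hk : k ∈ J := hω k (by simp)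
    have h1 := D.mem_transversal_iff.mp ht k hk
    have h2 : ¬ 0 ≤ ρ (ω.map s).prod⁻¹ (rootVec e k) := by
      rw [D.not_nonneg_iff]
      simp only [List.map_cons, List.prod_cons, mul_inv_rev, D.simple_inv, rho_mul,
        D.refl_self, map_neg] at h1
      exact neg_nonneg.mp h1
    obtain ⟨r, hr, he⟩ := D.exchange k ω h2
    have h3 := Nat.find_min' hex (m := (ω.eraseIdx r).length)
      ⟨ω.eraseIdx r, rfl, fun i hi => hω i (List.mem_cons_of_mem _ (List.mem_of_mem_eraseIdx hi)),
        by rw [← he]; simp⟩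
    rw [List.length_eraseIdx_of_lt hr] at h3
    rw [List.length_cons] at hn
    lia

theorem exists_mul_transversal (D : RootData s e ρ f) (J : Finset B) (g : G) :
    ∃ v ∈ parabolic s J, ∃ y ∈ transversal s J, g = v * y := by
  classical
  have hex : ∃ n, ∃ v ∈ parabolic s J, wordLength s (v * g) = n := ⟨_, 1, one_mem _, rfl⟩
  obtain ⟨v, hv, hn⟩ := Nat.find_spec hex
  refine ⟨v⁻¹, inv_mem hv, v * g, fun j hj => ?_, by simp⟩
  rw [D.wordLength_lt_iff]
  by_contra hcon
  have h1 := D.wordLength_lt_of_neg hcon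
  have h2 := Nat.find_min' hex ⟨s j * v, mul_mem (simple_mem_parabolic hj) hv, rfl⟩
  rw [mul_assoc] at h2
  lia

/-- Inverses of elements of `X_J` preserve the signs of the roots in the span of `J`. -/
theorem inv_nonneg_mul_iff (D : RootData s e ρ f) {J : Finset B} {v y : G}
    (hv : v ∈ parabolic s J) (hy : y ∈ transversal s J) {k : B} (hk : k ∈ J) :
    0 ≤ ρ (v * y)⁻¹ (rootVec e k) ↔ 0 ≤ ρ v⁻¹ (rootVec e k) := by
  rw [mul_inv_rev, rho_mul]
  have hz : ∀ b ∉ e '' (J : Set B), ρ v⁻¹ (rootVec e k) b = 0 := fun b hb =>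
    D.rho_rootVec_apply_eq_zero (inv_mem hv) hk hb
  constructor
  · intro h
    by_contra hcon
    rw [D.not_nonneg_iff] at hcon
    have h1 := D.rho_inv_nonneg_of_mem_transversal hy (v := -ρ v⁻¹ (rootVec e k))
      (neg_nonneg.mpr hcon) (fun b hb => by simp [hz b hb])
    rw [map_neg] at h1
    rw [← rho_mul] at h h1
    exact rho_rootVec_ne_zero ρ _ k (le_antisymm (neg_nonneg.mp h1) h)
  · intro h
    exact D.rho_inv_nonneg_of_mem_transversal hy h hz

theorem mul_transversal_injective (D : RootData s e ρ f) {J : Finset B} {v v' y y' : G}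
    (hv : v ∈ parabolic s J) (hv' : v' ∈ parabolic s J) (hy : y ∈ transversal s J)
    (hy' : y' ∈ transversal s J) (h : v * y = v' * y') : v = v' ∧ y = y' := by
  have h1 : y' = (v'⁻¹ * v) * y := by rw [mul_assoc, h]; simp
  have hu : v'⁻¹ * v ∈ parabolic s J := mul_mem (inv_mem hv') hv
  have h2 : v'⁻¹ * v = 1 := by
    refine D.eq_one_of_mem_transversal hu (D.mem_transversal_iff.mpr fun k hk => ?_)
    rw [← D.inv_nonneg_mul_iff hu hy hk, ← h1]
    exact D.mem_transversal_iff.mp hy' k hk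
  refine ⟨(inv_mul_eq_one.mp h2).symm, ?_⟩
  rw [h1, h2, one_mul]

/-- `X_K = X_K^J X_J` for `K ⊆ J`, where `X_K^J = W_J ∩ X_K`. -/
theorem mul_mem_transversal_iff (D : RootData s e ρ f) {J K : Finset B} (hKJ : K ⊆ J) {v y : G}
    (hv : v ∈ parabolic s J) (hy : y ∈ transversal s J) :
    v * y ∈ transversal s K ↔ v ∈ transversal s K := by
  rw [D.mem_transversal_iff, D.mem_transversal_iff]
  exact forall₂_congr fun k hk => D.inv_nonneg_mul_iff hv hy (hKJ hk)

/-- A positive root sent by the inverse of a coset representative to a simple root, and which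
lies in the span of `J`, is itself a simple root in `J`. -/
theorem exists_eq_rootVec_of_transversal (D : RootData s e ρ f) {J : Finset B} {d β : G} {k j : B}
    (hd : d ∈ transversal s J) (h0 : 0 ≤ ρ β (rootVec e k))
    (hz : ∀ b ∉ e '' (J : Set B), ρ β (rootVec e k) b = 0)
    (h : ρ d⁻¹ (ρ β (rootVec e k)) = rootVec e j) :
    ∃ i ∈ J, ρ β (rootVec e k) = rootVec e i := by
  set v := ρ β (rootVec e k) with hv
  have hne : v ≠ 0 := rho_rootVec_ne_zero ρ β k
  have hsum := eq_sum_rootVec D.inj hz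
  -- some coefficient of `v` is positive
  obtain ⟨i, hi, hpos⟩ : ∃ i ∈ J, v (e i) ≠ 0 := by
    by_contra! hcon
    refine hne ?_
    rw [hsum]
    exact Finset.sum_eq_zero fun i hi => by rw [hcon i hi, zero_smul]
  have hpos' : 0 < v (e i) := lt_of_le_of_ne (h0 _) hpos.symm
  -- its image is a multiple of `α_j`, because the images of all the terms are nonnegative
  have hle : v (e i) • ρ d⁻¹ (rootVec e i) ≤ rootVec e j := by
    rw [← h]
    conv_rhs => rw [hsum, map_sum]
    simp only [map_smul]
    exact Finset.single_le_sum (f := fun i => v (e i) • ρ d⁻¹ (rootVec e i))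
      (fun k hk => smul_nonneg (h0 _) (D.mem_transversal_iff.mp hd k hk)) hi
  have hge := D.mem_transversal_iff.mp hd i hi
  have hmul : ρ d⁻¹ (rootVec e i) = (ρ d⁻¹ (rootVec e i) (e j)) • rootVec e j := by
    ext b
    by_cases hb : b = e j
    · subst hb; simp [rootVec]
    · have h1 := hle b
      have h2 := hge b
      simp [rootVec, hb] at h1 h2 ⊢
      nlinarith
  have h3 := D.rho_eq_of_smul hmul hge
  refine ⟨i, hi, rho_injective ρ d⁻¹ ?_⟩
  rw [h, h3]

end RootData

namespace RootData

/-! ### Solomon's product formula -/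

open Classical in
/-- The set `K^d ∩ J`, as a set of indices of simple reflections. -/
noncomputable def interSet {G B : Type*} [Group G] (s : B → G) (K : Finset B) (d : G)
    (J : Finset B) : Finset B :=
  J.filter fun j => ∃ k ∈ K, d * s j * d⁻¹ = s k

variable {G B ι : Type*} [Group G] {s : B → G} {e : B → ι}
  {ρ : Representation ℝ G (ι → ℝ)} {f : LinearMap.BilinForm ℝ (ι → ℝ)}

theorem mem_interSet {K J : Finset B} {d : G} {j : B} :
    j ∈ interSet s K d J ↔ j ∈ J ∧ ∃ k ∈ K, d * s j * d⁻¹ = s k := by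
  classical
  exact Finset.mem_filter

variable [DecidableEq ι]

/-- For `d` a minimal representative of a double coset `W_K d W_J`, `v ∈ W_K` and `y ∈ X_K`, the
element `d⁻¹ v y` of `W_J d⁻¹ W_K y` lies in `X_{K^d ∩ J}` if and only if `d⁻¹ v` lies in `X_J`. -/
theorem mul_mem_transversal_interSet_iff (D : RootData s e ρ f) {J K : Finset B} {d v y : G}
    (hd : d ∈ transversal s K) (hd' : d⁻¹ ∈ transversal s J) (hv : v ∈ parabolic s K)
    (hy : y ∈ transversal s K) :
    d⁻¹ * v * y ∈ transversal s (interSet s K d J) ↔ d⁻¹ * v ∈ transversal s J := by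
  have hd'' : ∀ j ∈ J, 0 ≤ ρ d (rootVec e j) := by
    simpa using D.mem_transversal_iff.mp hd'
  have key : ∀ j ∈ interSet s K d J,
      (0 ≤ ρ (d⁻¹ * v * y)⁻¹ (rootVec e j) ↔ 0 ≤ ρ (d⁻¹ * v)⁻¹ (rootVec e j)) := by
    intro j hj
    obtain ⟨hjJ, k, hk, hjk⟩ := mem_interSet.mp hj
    have h1 := D.rho_eq_of_conj_eq hjk (hd'' j hjJ)
    have h2 := D.inv_nonneg_mul_iff hv hy hk
    rw [← h1, ← rho_mul, ← rho_mul] at h2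
    simpa [mul_assoc] using h2
  rw [D.mem_transversal_iff, D.mem_transversal_iff]
  constructor
  · intro h j hj
    by_cases hjI : j ∈ interSet s K d J
    · exact (key j hjI).mp (h j hjI)
    · -- `d α_j` is not in the span of `K`, and `v` does not affect its other coordinates
      by_contra hcon
      rw [D.not_nonneg_iff, mul_inv_rev, inv_inv, rho_mul] at hcon
      have hsupp : ∀ b ∉ e '' (K : Set B), ρ d (rootVec e j) b = 0 := by
        intro b hb
        have h1 := hcon b
        rw [D.rho_apply_of_mem_parabolic (inv_mem hv) _ hb] at h1
        exact le_antisymm h1 (hd'' j hj b)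
      obtain ⟨i, hi, he⟩ := D.exists_eq_rootVec_of_transversal (j := j) hd (hd'' j hj) hsupp
        (rho_inv_rho ρ d _)
      exact hjI (mem_interSet.mpr ⟨hj, i, hi, D.conj_eq_of_rho_eq he⟩)
  · intro h j hj
    exact (key j hj).mpr (h j (mem_interSet.mp hj).1)

/-- If a coset `d⁻¹ W_K`, with `d ∈ X_K`, meets `X_J`, then `d⁻¹ ∈ X_J`. -/
theorem inv_mem_transversal_of_mul (D : RootData s e ρ f) {J K : Finset B} {d v : G}
    (hd : d ∈ transversal s K) (hv : v ∈ parabolic s K) (h : d⁻¹ * v ∈ transversal s J) :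
    d⁻¹ ∈ transversal s J := by
  rw [D.mem_transversal_iff] at h ⊢
  intro j hj
  rw [inv_inv]
  by_contra hcon
  rw [D.not_nonneg_iff] at hcon
  have h1 := h j hj
  rw [mul_inv_rev, inv_inv, rho_mul] at h1
  have hsupp : ∀ b ∉ e '' (K : Set B), (-ρ d (rootVec e j)) b = 0 := by
    intro b hb
    have h2 := h1 b
    rw [D.rho_apply_of_mem_parabolic (inv_mem hv) _ hb] at h2
    simpa using le_antisymm (hcon b) h2
  have h3 := D.rho_inv_nonneg_of_mem_transversal hd (neg_nonneg.mpr hcon) hsupp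
  rw [map_neg, rho_inv_rho] at h3
  exact rootVec_ne_zero e j (le_antisymm (neg_nonneg.mp h3) (rootVec_nonneg e j))

open Classical in
theorem xElt_eq_sum [Fintype G] (s : B → G) (J : Finset B) :
    xElt s J = ∑ x : G with x ∈ transversal s J, MonoidAlgebra.single x⁻¹ (1 : ℂ) := by
  rw [xElt, finsum_mem_eq_finite_toFinset_sum _ (Set.toFinite _)]
  refine Finset.sum_congr ?_ fun _ _ => rfl
  ext; simp

open Classical in
/-- Solomon's product formula `x_K x_J = ∑_d x_{K^d ∩ J}`, the sum being over the minimal length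
representatives `d` of the double cosets `W_K \ G / W_J`. -/
theorem xElt_mul_xElt [Fintype G] (D : RootData s e ρ f) (K J : Finset B) :
    xElt s K * xElt s J =
      ∑ d : G with d ∈ transversal s K ∧ d⁻¹ ∈ transversal s J, xElt s (interSet s K d J) := by
  choose p hp r hr hpr using D.exists_mul_transversal K
  have huniq : ∀ {v y : G}, v ∈ parabolic s K → y ∈ transversal s K →
      p (v * y) = v ∧ r (v * y) = y := fun {v y} hv hy => by
    have := D.mul_transversal_injective hv (hp (v * y)) hy (hr (v * y)) (hpr (v * y))
    exact ⟨this.1.symm, this.2.symm⟩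
  simp only [xElt_eq_sum, Finset.sum_mul_sum, MonoidAlgebra.single_mul_single, mul_one,
    ← mul_inv_rev]
  rw [Finset.sum_sigma', Finset.sum_sigma']
  have hdecomp : ∀ x : G, x = (r x⁻¹)⁻¹ * (p x⁻¹)⁻¹ := fun x => by
    rw [← mul_inv_rev, ← hpr, inv_inv]
  refine Finset.sum_bij' (fun a _ => ⟨r a.2⁻¹, a.2 * a.1⟩)
    (fun a _ => ⟨r (a.1 * a.2), a.1⁻¹ * p (a.1 * a.2)⟩) ?_ ?_ ?_ ?_ ?_
  · rintro ⟨y, x⟩ h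
    simp only [Finset.mem_sigma, Finset.mem_filter, Finset.mem_univ, true_and] at h ⊢
    obtain ⟨hy, hx⟩ := h
    have hx' := hx
    rw [hdecomp x] at hx'
    have h1 := D.inv_mem_transversal_of_mul (hr _) (inv_mem (hp _)) hx'
    refine ⟨⟨hr _, h1⟩, ?_⟩
    have h2 := (D.mul_mem_transversal_interSet_iff (hr _) h1 (inv_mem (hp _)) hy).mpr hx'
    rwa [← hdecomp x] at h2
  · rintro ⟨d, z⟩ h
    simp only [Finset.mem_sigma, Finset.mem_filter, Finset.mem_univ, true_and] at h ⊢
    obtain ⟨⟨hd, hd'⟩, hz⟩ := h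
    refine ⟨hr _, (D.mul_mem_transversal_interSet_iff hd hd' (hp _) (hr (d * z))).mp ?_⟩
    rw [mul_assoc, ← hpr]
    simpa using hz
  · rintro ⟨y, x⟩ h
    simp only [Finset.mem_sigma, Finset.mem_filter, Finset.mem_univ, true_and] at h
    have h1 : r x⁻¹ * (x * y) = (p x⁻¹)⁻¹ * y := by
      have h4 : r x⁻¹ * x = (p x⁻¹)⁻¹ := by
        rw [eq_inv_mul_iff_mul_eq.mpr (hpr x⁻¹).symm]
        simp
      rw [← mul_assoc, h4]
    obtain ⟨h2, h3⟩ := huniq (inv_mem (hp x⁻¹)) h.1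
    simp only [h1, h2, h3, ← hdecomp x]
  · rintro ⟨d, z⟩ h
    simp only [Finset.mem_sigma, Finset.mem_filter, Finset.mem_univ, true_and] at h
    have h1 : (d⁻¹ * p (d * z))⁻¹ = (p (d * z))⁻¹ * d := by simp
    obtain ⟨h2, h3⟩ := huniq (inv_mem (hp (d * z))) h.1.1
    have h4 : d⁻¹ * p (d * z) * r (d * z) = z := by
      rw [mul_assoc, ← hpr]; simp
    simp only [h1, h3, h4]
  · rintro ⟨y, x⟩ _
    rfl

theorem rootVec_injective (he : Function.Injective e) : Function.Injective (rootVec e) := by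
  intro i j h
  by_contra hij
  have := congrFun h (e i)
  simp [rootVec, he.ne hij] at this

theorem card_interSet_le (D : RootData s e ρ f) (K J : Finset B) (d : G) :
    (interSet s K d J).card ≤ K.card := by
  have h : ∀ j ∈ interSet s K d J, ∃ k ∈ K, d * s j * d⁻¹ = s k := fun j hj =>
    (mem_interSet.mp hj).2
  choose! g hg hg' using h
  refine Finset.card_le_card_of_injOn g hg fun i hi j hj hij => ?_
  have h1 : s i = s j := by
    have := (hg' i hi).trans ((congrArg s hij).trans (hg' j hj).symm)
    simpa using this
  have h2 := D.rho_eq_of_conj_eq (g := 1) (k := i) (i := j) (by simpa using h1)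
    (by simpa using rootVec_nonneg e i)
  exact rootVec_injective D.inj (by simpa using h2)

/-! ### Arrows between sets of simple roots -/

open Classical in
/-- The elements carrying the simple roots in `J` to simple roots in `K`; it is used for sets
`J` and `K` of the same size. -/
noncomputable def arrows [Fintype G] (ρ : Representation ℝ G (ι → ℝ)) (e : B → ι)
    (J K : Finset B) : Finset G :=
  Finset.univ.filter fun d => ∀ j ∈ J, ∃ k ∈ K, ρ d (rootVec e j) = rootVec e k

section Arrows

variable [Fintype G]

theorem mem_arrows {J K : Finset B} {d : G} :
    d ∈ arrows ρ e J K ↔ ∀ j ∈ J, ∃ k ∈ K, ρ d (rootVec e j) = rootVec e k := by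
  simp [arrows]

theorem inv_mem_arrows (D : RootData s e ρ f) {J K : Finset B} (hJK : J.card = K.card) {d : G}
    (hd : d ∈ arrows ρ e J K) : d⁻¹ ∈ arrows ρ e K J := by
  rw [mem_arrows] at hd ⊢
  choose! g hg hg' using hd
  have hinj : Set.InjOn g J := fun i hi j hj h => by
    refine rootVec_injective D.inj (rho_injective ρ d ?_)
    rw [hg' i hi, hg' j hj, h]
  intro k hk
  obtain ⟨j, hj, rfl⟩ := Finset.surj_on_of_inj_on_of_card_le (s := J) (t := K) (fun a _ => g a)
    hg (fun a b ha hb h => hinj ha hb h) hJK.ge k hk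
  exact ⟨j, hj, by rw [← hg' j hj, rho_inv_rho]⟩

theorem mul_mem_arrows {J K L : Finset B} {d d' : G} (hd : d ∈ arrows ρ e J K)
    (hd' : d' ∈ arrows ρ e K L) : d' * d ∈ arrows ρ e J L := by
  rw [mem_arrows] at *
  intro j hj
  obtain ⟨k, hk, h⟩ := hd j hj
  obtain ⟨l, hl, h'⟩ := hd' k hk
  exact ⟨l, hl, by rw [rho_mul, h, h']⟩

theorem card_arrows_eq (D : RootData s e ρ f) {J K : Finset B} (hJK : J.card = K.card) {d : G}
    (hd : d ∈ arrows ρ e J K) (L : Finset B) :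
    (arrows ρ e K L).card = (arrows ρ e J L).card := by
  refine Finset.card_bij' (fun c _ => c * d) (fun c _ => c * d⁻¹) ?_ ?_ ?_ ?_
  · intro c hc
    exact mul_mem_arrows hd hc
  · intro c hc
    exact mul_mem_arrows (D.inv_mem_arrows hJK hd) hc
  · simp
  · simp

theorem mem_transversal_of_mem_arrows (D : RootData s e ρ f) {J K : Finset B} {d : G}
    (hd : d ∈ arrows ρ e J K) : d⁻¹ ∈ transversal s J := by
  rw [D.mem_transversal_iff, inv_inv]
  intro j hj
  obtain ⟨k, -, h⟩ := mem_arrows.mp hd j hj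
  rw [h]
  exact rootVec_nonneg e k

/-- For `J'` of the size of `J`, the terms `x_J` in Solomon's formula for `x_{J'} x_K` correspond to
the elements carrying `J` to `J'`: conjugation embeds `J` in `J'`, and the sizes agree. -/
theorem interSet_eq_iff (D : RootData s e ρ f) {J K J' : Finset B} (hJ : J'.card = J.card)
    {d : G} : (d ∈ transversal s J' ∧ d⁻¹ ∈ transversal s K ∧ interSet s J' d K = J) ↔
      J ⊆ K ∧ d ∈ arrows ρ e J J' ∧ d⁻¹ ∈ transversal s K := by
  constructor
  · rintro ⟨hd, hd', rfl⟩
    refine ⟨fun j hj => (mem_interSet.mp hj).1, mem_arrows.mpr fun j hj => ?_, hd'⟩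
    obtain ⟨hjK, k, hk, hjk⟩ := mem_interSet.mp hj
    refine ⟨k, hk, D.rho_eq_of_conj_eq hjk ?_⟩
    simpa using D.mem_transversal_iff.mp hd' j hjK
  · rintro ⟨hJK, hd, hd'⟩
    have h1 := D.inv_mem_arrows hJ.symm hd
    have h2 : d ∈ transversal s J' := by simpa using D.mem_transversal_of_mem_arrows h1
    refine ⟨h2, hd', ?_⟩
    ext j
    constructor
    · intro hj
      obtain ⟨hjK, k, hk, hjk⟩ := mem_interSet.mp hj
      have h3 : ρ d (rootVec e j) = rootVec e k := by
        refine D.rho_eq_of_conj_eq hjk ?_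
        simpa using D.mem_transversal_iff.mp hd' j hjK
      obtain ⟨j', hj', h4⟩ := mem_arrows.mp h1 k hk
      rw [← h3, rho_inv_rho] at h4
      rwa [rootVec_injective D.inj h4]
    · intro hj
      obtain ⟨k, hk, h⟩ := mem_arrows.mp hd j hj
      exact mem_interSet.mpr ⟨hJK hj, k, hk, D.conj_eq_of_rho_eq h⟩

end Arrows

end RootData

/-! ### Elements of the descent algebra annihilating its proper part -/

section Triangular

variable {B A : Type*} [Fintype B] [DecidableEq B] [Ring A] [Algebra ℂ A]

theorem mulVec_eq_zero_of_card_lt {P : Matrix (Finset B) (Finset B) ℂ} {r : ℕ}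
    (hP : ∀ L J, P L J ≠ 0 → L ⊆ J ∧ L.card ≤ r) (v : Finset B → ℂ) {J : Finset B}
    (hJ : r < J.card) : P.mulVec v J = 0 := by
  refine Finset.sum_eq_zero fun K _ => ?_
  by_cases h : P J K = 0
  · simp [h]
  · exact absurd (hP J K h).2 (by lia)

theorem mulVec_apply_of_forall_ssuperset {P : Matrix (Finset B) (Finset B) ℂ} {r : ℕ}
    (hP : ∀ L J, P L J ≠ 0 → L ⊆ J ∧ L.card ≤ r) {v : Finset B → ℂ} {J : Finset B}
    (hv : ∀ K, J ⊂ K → v K = 0) : P.mulVec v J = P J J * v J := by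
  refine Finset.sum_eq_single J (fun K _ hK => ?_) (by simp)
  by_cases h : P J K = 0
  · simp [h]
  · rw [hv K ((hP J K h).1.ssubset_of_ne hK.symm), mul_zero]

/-- Suppose that left multiplication by `ℓ_r` acts on the elements `x_J` through a matrix `P_r`
which is triangular for inclusion, has rows only for `J` with `|J| ≤ r`, and diagonal entries `1`
for `|J| = r`. Then the product `(1 - ℓ_m) (1 - ℓ_{m+1}) ⋯ (1 - ℓ_{n-1})` acts through an operator
`T` which shortens all `x_J` with `J` proper, and whose image is killed by the rows of size `r` of
`P_r`, for `m ≤ r < n`. -/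
theorem exists_annihilator (x : Finset B → A) (P : ℕ → Matrix (Finset B) (Finset B) ℂ)
    (ell : ℕ → A) (hmul : ∀ r v, ell r * ∑ K, v K • x K = ∑ K, (P r).mulVec v K • x K)
    (hP : ∀ r L J, P r L J ≠ 0 → L ⊆ J ∧ L.card ≤ r)
    (hdiag : ∀ J, P J.card J J = 1) {m : ℕ} (hm : m ≤ Fintype.card B) :
    ∃ (q : A) (T : (Finset B → ℂ) → Finset B → ℂ),
      (∀ v, q * ∑ K, v K • x K = ∑ K, T v K • x K) ∧
      (∀ v, T v Finset.univ = v Finset.univ) ∧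
      (∀ v, v Finset.univ = 0 → ∀ J, m ≤ J.card → T v J = 0) ∧
      (∀ v J, m ≤ J.card → J ≠ Finset.univ → (P J.card).mulVec (T v) J = 0) := by
  induction hm using Nat.decreasingInduction with
  | self =>
    refine ⟨1, id, by simp, by simp, fun v hv J hJ => ?_, fun v J hJ hJ' => ?_⟩
    · rwa [(Finset.card_eq_iff_eq_univ J).mp (le_antisymm (Finset.card_le_univ J) hJ)]
    · exact absurd ((Finset.card_eq_iff_eq_univ J).mp (le_antisymm (Finset.card_le_univ J) hJ)) hJ'
  | of_succ r hr ih =>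
    obtain ⟨q, T, h1, h2, h3, h4⟩ := ih
    refine ⟨(1 - ell r) * q, fun v => T v - (P r).mulVec (T v), fun v => ?_, fun v => ?_,
      fun v hv J hJ => ?_, fun v J hJ hJ' => ?_⟩
    · rw [mul_assoc, h1, sub_mul, one_mul, hmul, ← Finset.sum_sub_distrib]
      simp only [Pi.sub_apply, sub_smul]
    · beta_reduce
      rw [Pi.sub_apply, mulVec_eq_zero_of_card_lt (hP r) _ (by simpa using hr), sub_zero, h2]
    · beta_reduce
      rw [Pi.sub_apply]
      obtain hlt | rfl := hJ.lt_or_eq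
      · rw [h3 v hv J hlt, mulVec_eq_zero_of_card_lt (hP r) _ hlt, sub_zero]
      · rw [mulVec_apply_of_forall_ssuperset (hP _), hdiag, one_mul, sub_self]
        intro K hK
        exact h3 v hv K (Finset.card_lt_card hK)
    · rw [Matrix.mulVec_sub, Pi.sub_apply]
      obtain hlt | rfl := hJ.lt_or_eq
      · rw [h4 v J hlt hJ', mulVec_apply_of_forall_ssuperset (hP _),
          mulVec_eq_zero_of_card_lt (hP r) _ hlt, mul_zero, sub_zero]
        intro K hK
        exact mulVec_eq_zero_of_card_lt (hP r) _ (hlt.trans (Finset.card_lt_card hK))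
      · have h5 : ∀ K, J ⊂ K → (P J.card).mulVec (T v) K = 0 := fun K hK =>
          mulVec_eq_zero_of_card_lt (hP _) _ (Finset.card_lt_card hK)
        rw [mulVec_apply_of_forall_ssuperset (hP _) h5, hdiag, one_mul, sub_self]

/-- In the situation of `exists_annihilator`, an element `∑_K f_K x_K` whose coefficients are
killed by the rows of size `r` of all the `P_r` annihilates every `x_J` with `J` proper: by
triangularity it is determined up to a scalar, so it is a multiple of
`(1 - ℓ_0) (1 - ℓ_1) ⋯ (1 - ℓ_{n-1})`. -/
theorem sum_smul_mul_eq_zero (x : Finset B → A) (hx : x Finset.univ = 1)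
    (P : ℕ → Matrix (Finset B) (Finset B) ℂ)
    (ell : ℕ → A) (hmul : ∀ r v, ell r * ∑ K, v K • x K = ∑ K, (P r).mulVec v K • x K)
    (hP : ∀ r L J, P r L J ≠ 0 → L ⊆ J ∧ L.card ≤ r)
    (hdiag : ∀ J, P J.card J J = 1) (f : Finset B → ℂ)
    (hf : ∀ J, J ≠ Finset.univ → (P J.card).mulVec f J = 0) {J : Finset B}
    (hJ : J ≠ Finset.univ) : (∑ K, f K • x K) * x J = 0 := by
  obtain ⟨q, T, h1, h2, h3, h4⟩ := exists_annihilator x P ell hmul hP hdiag (Nat.zero_le _)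
  have hsingle : ∀ J, ∑ K, (Pi.single J 1 : Finset B → ℂ) K • x K = x J := fun J => by
    simp [Pi.single_apply, ite_smul]
  have hu := h2 (Pi.single Finset.univ 1)
  rw [Pi.single_eq_same] at hu
  have hfeq : ∀ n, ∀ K : Finset B, Fintype.card B ≤ K.card + n →
      f K = f Finset.univ * T (Pi.single Finset.univ 1) K := by
    intro n
    induction n with
    | zero =>
      intro K hK
      rw [(Finset.card_eq_iff_eq_univ K).mp (le_antisymm (Finset.card_le_univ K) hK), hu, mul_one]
    | succ n ih =>
      intro K hK
      obtain rfl | hKu := eq_or_ne K Finset.univ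
      · rw [hu, mul_one]
      have h5 : (P K.card).mulVec (f - f Finset.univ • T (Pi.single Finset.univ 1)) K = 0 := by
        rw [Matrix.mulVec_sub, Matrix.mulVec_smul, Pi.sub_apply, Pi.smul_apply, hf K hKu,
          h4 _ K (Nat.zero_le _) hKu, smul_zero, sub_zero]
      rw [mulVec_apply_of_forall_ssuperset (hP _), hdiag, one_mul] at h5
      · simpa [sub_eq_zero] using h5
      · intro L hL
        have := ih L (by have := Finset.card_lt_card hL; lia)
        simp [this]
  have hsum : ∑ K, f K • x K = f Finset.univ • q := by
    rw [← mul_one q, ← hx, ← hsingle Finset.univ, h1, Finset.smul_sum]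
    exact Finset.sum_congr rfl fun K _ => by
      rw [hfeq (Fintype.card B) K (by lia), smul_smul]
  have h6 := h1 (Pi.single J 1)
  rw [hsingle, Finset.sum_eq_zero fun K _ => by
    rw [h3 _ (Pi.single_eq_of_ne (Ne.symm hJ) 1) K (Nat.zero_le _), zero_smul]] at h6
  rw [hsum, smul_mul_assoc, h6, smul_zero]

end Triangular

namespace RootData

variable {G B ι : Type*} [Group G] {s : B → G} {e : B → ι}
  {ρ : Representation ℝ G (ι → ℝ)} {f : LinearMap.BilinForm ℝ (ι → ℝ)} [DecidableEq ι]

theorem simple_injective (D : RootData s e ρ f) : Function.Injective s := fun i j h =>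
  rootVec_injective D.inj (by
    have h2 := D.rho_eq_of_conj_eq (g := 1) (k := i) (i := j) (by simpa using h)
      (by simpa using rootVec_nonneg e i)
    simpa using h2)

variable [Fintype B] [Fintype G]

/-- For `u ∈ X_J`: `J^u` consists of simple reflections and equals `J'` if and only if `u⁻¹` carries
the simple roots in `J` to those in `J'`. -/
theorem mem_transversalSharp_iff (D : RootData s e ρ f) {J J' : Finset B} {u : G}
    (hu : u ∈ transversal s J) :
    (u ∈ transversalSharp s J ∧ interSet s J u Finset.univ = J') ↔
      u⁻¹ ∈ arrows ρ e J J' ∧ J'.card = J.card := by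
  rw [D.mem_transversal_iff] at hu
  constructor
  · rintro ⟨⟨-, hr⟩, rfl⟩
    have h1 : ∀ j ∈ J, ∃ i ∈ interSet s J u Finset.univ, ρ u⁻¹ (rootVec e j) = rootVec e i := by
      intro j hj
      obtain ⟨i, hi⟩ := hr j hj
      refine ⟨i, mem_interSet.mpr ⟨Finset.mem_univ i, j, hj, by rw [hi]; simp [mul_assoc]⟩, ?_⟩
      exact D.rho_eq_of_conj_eq (by rw [hi, inv_inv]) (hu j hj)
    refine ⟨mem_arrows.mpr h1, le_antisymm (D.card_interSet_le _ _ _) ?_⟩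
    choose! g hg hg' using h1
    refine Finset.card_le_card_of_injOn g hg fun i hi j hj hij => ?_
    refine rootVec_injective D.inj (rho_injective ρ u⁻¹ ?_)
    rw [hg' i hi, hg' j hj, hij]
  · rintro ⟨h1, hcard⟩
    refine ⟨⟨D.mem_transversal_iff.mpr hu, fun j hj => ?_⟩, ?_⟩
    · obtain ⟨i, -, hi⟩ := mem_arrows.mp h1 j hj
      exact ⟨i, by rw [← D.conj_eq_of_rho_eq hi, inv_inv]⟩
    · ext i
      rw [mem_interSet]
      constructor
      · rintro ⟨-, j, hj, hij⟩
        obtain ⟨i', hi', he⟩ := mem_arrows.mp h1 j hj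
        have h2 := D.conj_eq_of_rho_eq he
        rw [← hij] at h2
        have h3 : s i = s i' := by rw [← h2]; simp [mul_assoc]
        rwa [D.simple_injective h3]
      · intro hi
        obtain ⟨j, hj, he⟩ := mem_arrows.mp (D.inv_mem_arrows hcard.symm h1) i hi
        have h2 := D.conj_eq_of_rho_eq he
        exact ⟨Finset.mem_univ i, j, hj, by simpa using h2⟩

open Classical in
/-- The weighted form of the matrix `m_{KJ}`: each `u ∈ X_K ∩ X_J^♯` is counted with the weight
attached to the subset `J^u`. -/
noncomputable def weightMat (s : B → G) (a : Finset B → ℕ) : Matrix (Finset B) (Finset B) ℂ :=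
  fun K J => if J ⊆ K then ∑ u : G with u ∈ transversal s K ∩ transversalSharp s J,
    (a (interSet s J u Finset.univ) : ℂ) else 0

open Classical in
/-- The matrix of left multiplication by `x_K` on the elements `x_J`. -/
noncomputable def mulMat (s : B → G) (K : Finset B) : Matrix (Finset B) (Finset B) ℂ :=
  fun L J => ((Finset.univ.filter fun d : G =>
    d ∈ transversal s K ∧ d⁻¹ ∈ transversal s J ∧ interSet s K d J = L).card : ℂ)

/-- The weighted number of elements carrying the simple roots in `J` to some set of simple
roots. -/
noncomputable def weight [DecidableEq B] (ρ : Representation ℝ G (ι → ℝ)) (e : B → ι)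
    (a : Finset B → ℕ) (J : Finset B) : ℕ :=
  ∑ K with K.card = J.card, a K * (arrows ρ e J K).card

theorem xElt_mul_sum (D : RootData s e ρ f) (K : Finset B) (v : Finset B → ℂ) :
    xElt s K * ∑ J, v J • xElt s J = ∑ L, (mulMat s K).mulVec v L • xElt s L := by
  classical
  simp only [Finset.mul_sum, mul_smul_comm, D.xElt_mul_xElt]
  have h : ∀ J, (∑ d : G with d ∈ transversal s K ∧ d⁻¹ ∈ transversal s J,
      xElt s (interSet s K d J)) = ∑ L, mulMat s K L J • xElt s L := by
    intro J
    rw [← Finset.sum_fiberwise' _ (fun d => interSet s K d J) (fun L => xElt s L)]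
    refine Finset.sum_congr rfl fun L _ => ?_
    rw [Finset.sum_const, mulMat, Finset.filter_filter, ← Nat.cast_smul_eq_nsmul ℂ]
    simp only [and_assoc]
  simp only [h, Finset.smul_sum, smul_smul, Matrix.mulVec, dotProduct, Finset.sum_smul]
  rw [Finset.sum_comm]
  exact Finset.sum_congr rfl fun L _ => Finset.sum_congr rfl fun J _ => by rw [mul_comm]

theorem mulMat_ne_zero (D : RootData s e ρ f) {K L J : Finset B} (h : mulMat s K L J ≠ 0) :
    L ⊆ J ∧ L.card ≤ K.card := by
  classical
  rw [mulMat, Nat.cast_ne_zero, Finset.card_ne_zero] at h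
  obtain ⟨d, hd⟩ := h
  obtain ⟨-, -, -, rfl⟩ := Finset.mem_filter.mp hd
  exact ⟨fun j hj => (mem_interSet.mp hj).1, D.card_interSet_le _ _ _⟩

open Classical in
/-- In the rows `J` of the size of `J'`, the matrix of multiplication by `x_{J'}` counts elements
carrying `J` to `J'`. -/
theorem mulMat_apply (D : RootData s e ρ f) {J J' K : Finset B} (h : J'.card = J.card) :
    mulMat s J' J K = if J ⊆ K then
      (((arrows ρ e J J').filter fun d => d⁻¹ ∈ transversal s K).card : ℂ) else 0 := by
  rw [mulMat]
  simp only [D.interSet_eq_iff h]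
  split_ifs with hJ
  · congr 2
    ext d
    simp [hJ]
  · simp [hJ]

open Classical in
/-- The matrix `m` and the matrices of left multiplication by the `x_{J'}` count the same
elements. -/
theorem weightMat_eq (D : RootData s e ρ f) (a : Finset B → ℕ) (K J : Finset B) :
    weightMat s a K J = ∑ J' with J'.card = J.card, (a J' : ℂ) * mulMat s J' J K := by
  rw [weightMat]
  split_ifs with hJ
  · rw [← Finset.sum_fiberwise' _ (fun u => interSet s J u Finset.univ) (fun J' => (a J' : ℂ)),
      Finset.sum_filter]
    refine Finset.sum_congr rfl fun J' _ => ?_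
    rw [Finset.sum_const, nsmul_eq_mul, mul_comm]
    split_ifs with hc
    · rw [D.mulMat_apply hc, if_pos hJ]
      congr 2
      refine Finset.card_bij' (fun u _ => u⁻¹) (fun d _ => d⁻¹) ?_ ?_ (by simp) (by simp)
      · intro u hu
        simp only [Finset.mem_filter, Finset.mem_univ, true_and, Set.mem_inter_iff] at hu ⊢
        refine ⟨((D.mem_transversalSharp_iff (transversal_anti s hJ hu.1.1)).mp
          ⟨hu.1.2, hu.2⟩).1, by simpa using hu.1.1⟩
      · intro d hd
        simp only [Finset.mem_filter, Finset.mem_univ, true_and, Set.mem_inter_iff] at hd ⊢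
        have := (D.mem_transversalSharp_iff (J' := J') (transversal_anti s hJ hd.2)).mpr
          ⟨by simpa using hd.1, hc⟩
        exact ⟨⟨hd.2, this.1⟩, this.2⟩
    · rw [mul_eq_zero]
      right
      rw [Nat.cast_eq_zero, Finset.card_eq_zero, Finset.filter_eq_empty_iff]
      intro u hu
      simp only [Finset.mem_filter, Finset.mem_univ, true_and, Set.mem_inter_iff] at hu
      exact fun h => hc ((D.mem_transversalSharp_iff (transversal_anti s hJ hu.1)).mp
        ⟨hu.2, h⟩).2
  · refine (Finset.sum_eq_zero fun J' hJ' => ?_).symm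
    rw [D.mulMat_apply (by simpa using hJ'), if_neg hJ, mul_zero]

variable [DecidableEq B]

theorem weightMat_self (D : RootData s e ρ f) (a : Finset B → ℕ) (J : Finset B) :
    weightMat s a J J = weight ρ e a J := by
  classical
  rw [D.weightMat_eq, weight, Nat.cast_sum]
  refine Finset.sum_congr (by ext; simp) fun J' hJ' => ?_
  rw [D.mulMat_apply (by simpa using hJ'), if_pos subset_rfl, Nat.cast_mul]
  congr 3
  refine Finset.filter_true_of_mem fun d hd => D.mem_transversal_of_mem_arrows hd

theorem weight_pos {a : Finset B → ℕ} (ha : ∀ J, 0 < a J) (J : Finset B) :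
    0 < weight ρ e a J := by
  refine Finset.sum_pos' (fun _ _ => Nat.zero_le _) ⟨J, by simp, Nat.mul_pos (ha J) ?_⟩
  refine Finset.card_pos.mpr ⟨1, mem_arrows.mpr fun j hj => ⟨j, hj, by simp⟩⟩

theorem weight_eq_of_mem_arrows (D : RootData s e ρ f) (a : Finset B → ℕ) {J J' : Finset B}
    (h : J'.card = J.card) {d : G} (hd : d ∈ arrows ρ e J J') :
    weight ρ e a J' = weight ρ e a J := by
  rw [weight, weight, h]
  exact Finset.sum_congr rfl fun K _ => by rw [D.card_arrows_eq h.symm hd]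

theorem xElt_univ (D : RootData s e ρ f) : xElt s Finset.univ = (1 : MonoidAlgebra ℂ G) := by
  classical
  rw [xElt_eq_sum, Finset.sum_eq_single (1 : G)]
  · simp [MonoidAlgebra.one_def]
  · intro g hg hg1
    refine absurd (D.eq_one_of_mem_transversal (J := Finset.univ) ?_ (by simpa using hg)) hg1
    rw [parabolic, Finset.coe_univ, Set.image_univ, D.gen]
    trivial
  · intro h
    exact absurd (D.one_mem_transversal _) (by simpa using h)

/-- An element `∑_K h_K x_K` of the descent algebra with `∑_K h_K m^a_{KJ} = 0` for all proper
subsets `J`, where `m^a` is the matrix `m` with arbitrary positive weights `a`, is a left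
annihilator of the span of the `x_J` with `J` proper. -/
theorem sum_smul_xElt_mul_xElt (D : RootData s e ρ f) {a : Finset B → ℕ} (ha : ∀ J, 0 < a J)
    {h : Finset B → ℂ} (hh : ∀ J, J ≠ Finset.univ → ∑ K, h K * weightMat s a K J = 0)
    {J : Finset B} (hJ : J ≠ Finset.univ) : (∑ K, h K • xElt s K) * xElt s J = 0 := by
  classical
  set P : ℕ → Matrix (Finset B) (Finset B) ℂ := fun r =>
    ∑ J' with J'.card = r, ((a J' : ℂ) / weight ρ e a J') • mulMat s J' with hPdef
  -- in its rows of size `r`, the matrix `P r` is a rescaling of the transpose of `m^a`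
  have hrow : ∀ J K, P J.card J K = weightMat s a K J / weight ρ e a J := by
    intro J K
    rw [D.weightMat_eq, Finset.sum_div, hPdef]
    simp only [Matrix.sum_apply, Matrix.smul_apply, smul_eq_mul]
    refine Finset.sum_congr rfl fun J' hJ' => ?_
    have hc : J'.card = J.card := by simpa using hJ'
    by_cases h0 : mulMat s J' J K = 0
    · simp [h0]
    · rw [D.mulMat_apply hc] at h0
      split_ifs at h0 with h1
      · obtain ⟨d, hd⟩ := Finset.card_ne_zero.mp (Nat.cast_ne_zero.mp h0)
        rw [D.weight_eq_of_mem_arrows a hc (Finset.mem_filter.mp hd).1]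
        ring
      · exact absurd rfl h0
  have hw : ∀ J, (weight ρ e a J : ℂ) ≠ 0 := fun J =>
    Nat.cast_ne_zero.mpr (weight_pos ha J).ne'
  refine sum_smul_mul_eq_zero (xElt s) D.xElt_univ P
    (fun r => ∑ J' with J'.card = r, ((a J' : ℂ) / weight ρ e a J') • xElt s J') ?_ ?_ ?_ h ?_ hJ
  · intro r v
    rw [Finset.sum_mul]
    simp only [smul_mul_assoc, D.xElt_mul_sum, hPdef, Matrix.sum_mulVec, Matrix.smul_mulVec,
      Finset.sum_apply, Pi.smul_apply, Finset.sum_smul, Finset.smul_sum, smul_assoc]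
    rw [Finset.sum_comm]
  · intro r L K hne
    simp only [hPdef, Matrix.sum_apply, Matrix.smul_apply] at hne
    obtain ⟨J', hJ', h1⟩ := Finset.exists_ne_zero_of_sum_ne_zero hne
    have h2 := D.mulMat_ne_zero (right_ne_zero_of_smul h1)
    exact ⟨h2.1, h2.2.trans ((Finset.mem_filter.mp hJ').2.le)⟩
  · intro J
    rw [hrow, D.weightMat_self, div_self (hw J)]
  · intro J hJ
    simp only [Matrix.mulVec, dotProduct, hrow]
    have := hh J hJ
    calc _ = (∑ K, h K * weightMat s a K J) / weight ρ e a J := by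
          rw [Finset.sum_div]
          exact Finset.sum_congr rfl fun K _ => by ring
      _ = 0 := by rw [this, zero_div]

end RootData

/-! ### The matrix `m` and its inverse -/

section UnitriangularMatrix

variable {B : Type*} [Fintype B] [DecidableEq B]

/-- Back substitution for a triangular matrix, on a family of sets closed under passing to larger
sets. -/
theorem eq_zero_of_vecMul_eq_zero {m : Matrix (Finset B) (Finset B) ℂ}
    (hm : ∀ K J, m K J ≠ 0 → J ⊆ K) (hd : ∀ J, m J J ≠ 0) {v : Finset B → ℂ}
    {U : Set (Finset B)} (hU : ∀ J ∈ U, ∀ K, J ⊆ K → K ∈ U)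
    (hv : ∀ J ∈ U, Matrix.vecMul v m J = 0) {J : Finset B} (hJ : J ∈ U) : v J = 0 := by
  have key : ∀ n, ∀ J ∈ U, Fintype.card B < J.card + n → v J = 0 := by
    intro n
    induction n with
    | zero => intro J _ h; exact absurd (Finset.card_le_univ J) (by lia)
    | succ n ih =>
      intro J hJ h
      have h1 := hv J hJ
      rw [Matrix.vecMul, dotProduct, Finset.sum_eq_single J ?_ (by simp)] at h1
      · exact (mul_eq_zero.mp h1).resolve_right (hd J)
      · intro K _ hK
        by_cases h0 : m K J = 0
        · rw [h0, mul_zero]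
        · have hJK := hm K J h0
          have := Finset.card_lt_card (hJK.ssubset_of_ne hK.symm)
          rw [ih K (hU J hJ K hJK) (by lia), zero_mul]
  exact key (Fintype.card B + 1) J hJ (by lia)

theorem inv_mul_of_triangular {m : Matrix (Finset B) (Finset B) ℂ}
    (hm : ∀ K J, m K J ≠ 0 → J ⊆ K) (hd : ∀ J, m J J ≠ 0) : m⁻¹ * m = 1 := by
  refine Matrix.nonsing_inv_mul m ((Matrix.isUnit_iff_isUnit_det m).mp
    (Matrix.vecMul_injective_iff_isUnit.mp fun v v' h => ?_))
  ext J
  rw [← sub_eq_zero, ← Pi.sub_apply]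
  refine eq_zero_of_vecMul_eq_zero hm hd (U := Set.univ) (by simp) (fun J _ => ?_) trivial
  rw [Matrix.sub_vecMul]
  simpa [sub_eq_zero] using congrFun h J

theorem inv_apply_eq_zero {m : Matrix (Finset B) (Finset B) ℂ}
    (hm : ∀ K J, m K J ≠ 0 → J ⊆ K) (hd : ∀ J, m J J ≠ 0) {L K : Finset B} (h : ¬ K ⊆ L) :
    m⁻¹ L K = 0 := by
  refine eq_zero_of_vecMul_eq_zero hm hd (v := m⁻¹ L) (U := {K | ¬ K ⊆ L})
    (fun J hJ K hJK hK => hJ (hJK.trans hK)) (fun J hJ => ?_) h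
  have := congrFun (congrFun (inv_mul_of_triangular hm hd) L) J
  rw [Matrix.one_apply_ne (fun h => hJ h.symm.subset)] at this
  exact this

theorem inv_apply_self_ne_zero {m : Matrix (Finset B) (Finset B) ℂ}
    (hm : ∀ K J, m K J ≠ 0 → J ⊆ K) (hd : ∀ J, m J J ≠ 0) (L : Finset B) : m⁻¹ L L ≠ 0 := by
  intro h0
  have := congrFun (congrFun (inv_mul_of_triangular hm hd) L) L
  rw [Matrix.one_apply_eq, Matrix.mul_apply, Finset.sum_eq_zero] at this
  · exact zero_ne_one this
  · intro K _
    by_cases hK : K ⊆ L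
    · by_cases h1 : m K L = 0
      · rw [h1, mul_zero]
      · rw [(hK.antisymm (hm K L h1)), h0, zero_mul]
    · rw [inv_apply_eq_zero hm hd hK, zero_mul]

end UnitriangularMatrix

/-! ### Restriction to a parabolic subgroup -/

/-- The generators `s_i`, `i ∈ L`, as elements of `⟨L⟩`. -/
def subSimple {G B : Type*} [Group G] (s : B → G) (L : Finset B) (i : L) : parabolic s L :=
  ⟨s i, Subgroup.subset_closure ⟨i, i.2, rfl⟩⟩

/-- A subset of `L`, as a subset of the full index set. -/
abbrev inclSet {B : Type*} (L : Finset B) (K : Finset L) : Finset B :=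
  K.map (Function.Embedding.subtype (· ∈ L))

theorem inclSet_subset {B : Type*} (L : Finset B) (K : Finset L) : inclSet L K ⊆ L := by
  intro i hi
  obtain ⟨j, -, rfl⟩ := Finset.mem_map.mp hi
  exact j.2

theorem coe_mem_inclSet {B : Type*} {L : Finset B} {K : Finset L} {i : L} :
    (i : B) ∈ inclSet L K ↔ i ∈ K := by
  simp [inclSet]

theorem forall_mem_inclSet {B : Type*} {L : Finset B} {K : Finset L} {p : B → Prop} :
    (∀ i ∈ inclSet L K, p i) ↔ ∀ i ∈ K, p i := by
  simp [inclSet]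

theorem inclSet_univ {B : Type*} (L : Finset B) : inclSet L Finset.univ = L :=
  Finset.attach_map_val

theorem inclSet_subset_inclSet {B : Type*} {L : Finset B} {J K : Finset L} :
    inclSet L J ⊆ inclSet L K ↔ J ⊆ K := Finset.map_subset_map

theorem sum_inclSet {B A : Type*} [Fintype B] [DecidableEq B] [AddCommMonoid A] (L : Finset B)
    {g : Finset B → A} (hg : ∀ K, ¬ K ⊆ L → g K = 0) : ∑ K, g (inclSet L K) = ∑ K, g K := by
  refine Finset.sum_of_injOn (inclSet L) (Finset.map_injective _).injOn (by simp) ?_ (by simp)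
  intro K _ hK
  refine hg K fun hKL => hK ⟨K.subtype (· ∈ L), by simp, ?_⟩
  exact Finset.subtype_map_of_mem hKL

namespace RootData

variable {G B ι : Type*} [Group G] {s : B → G} {e : B → ι}
  {ρ : Representation ℝ G (ι → ℝ)} {f : LinearMap.BilinForm ℝ (ι → ℝ)} [DecidableEq ι]

theorem restrict (D : RootData s e ρ f) (L : Finset B) :
    RootData (subSimple s L) (fun i => e i) (ρ.comp (parabolic s L).subtype) f where
  inj := D.inj.comp Subtype.val_injective
  gen := by
    refine Subgroup.map_injective (Subgroup.subtype_injective _) ?_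
    rw [MonoidHom.map_closure, ← MonoidHom.range_eq_map, Subgroup.range_subtype]
    change _ = Subgroup.closure (s '' (L : Set B))
    congr 1
    ext g
    constructor
    · rintro ⟨_, ⟨i, rfl⟩, rfl⟩
      exact ⟨i, i.2, rfl⟩
    · rintro ⟨i, hi, rfl⟩
      exact ⟨_, ⟨⟨i, hi⟩, rfl⟩, rfl⟩
  refl i v := D.refl i v
  inv g x y := D.inv g x y
  one i := D.one i
  faithful g h := Subtype.ext (D.faithful g h)
  pos g i := D.pos g i

theorem mem_transversal_subSimple_iff (D : RootData s e ρ f) {L : Finset B} {K : Finset L}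
    {u : parabolic s L} :
    u ∈ transversal (subSimple s L) K ↔ (u : G) ∈ transversal s (inclSet L K) := by
  rw [(D.restrict L).mem_transversal_iff, D.mem_transversal_iff, forall_mem_inclSet]
  rfl

theorem commute_of_rho_eq (D : RootData s e ρ f) {L : Finset B} {n : G}
    (hn : ∀ j ∈ L, ρ n (rootVec e j) = rootVec e j) :
    ∀ u ∈ parabolic s L, n * u = u * n := by
  intro u hu
  refine Subgroup.closure_induction (p := fun u _ => n * u = u * n) ?_ (by simp) ?_ ?_ hu
  · rintro _ ⟨j, hj, rfl⟩
    have := D.conj_eq_of_rho_eq (hn j hj)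
    exact mul_inv_eq_iff_eq_mul.mp this
  · intro x y _ _ hx hy
    rw [← mul_assoc, hx, mul_assoc, hy, mul_assoc]
  · intro x _ hx
    exact (Commute.inv_right (show Commute n x from hx))

variable [Fintype B] [Fintype G]

/-- The inclusion of group algebras induced by that of a subgroup. -/
noncomputable def algIncl (H : Subgroup G) : MonoidAlgebra ℂ H →ₐ[ℂ] MonoidAlgebra ℂ G :=
  MonoidAlgebra.mapDomainAlgHom ℂ ℂ H.subtype

theorem algIncl_single (H : Subgroup G) (h : H) (c : ℂ) :
    algIncl H (MonoidAlgebra.single h c) = MonoidAlgebra.single (h : G) c := by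
  simp [algIncl]

/-- `x_K = x_L x_K^L` for `K ⊆ L`, where `x_K^L` is formed in `W_L`. -/
theorem xElt_inclSet (D : RootData s e ρ f) {L : Finset B} (K : Finset L) :
    xElt s (inclSet L K) = xElt s L * algIncl _ (xElt (subSimple s L) K) := by
  classical
  simp only [xElt_eq_sum, map_sum, algIncl_single, Finset.sum_mul_sum,
    MonoidAlgebra.single_mul_single, mul_one, Subgroup.coe_inv, ← mul_inv_rev]
  rw [Finset.sum_comm, ← Finset.sum_product']
  symm
  refine Finset.sum_bij (fun a _ => (a.1 : G) * a.2) ?_ ?_ ?_ ?_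
  · rintro ⟨u, y⟩ h
    simp only [Finset.mem_product, Finset.mem_filter, Finset.mem_univ, true_and] at h ⊢
    exact (D.mul_mem_transversal_iff (inclSet_subset L K) u.2 h.2).mpr
      (D.mem_transversal_subSimple_iff.mp h.1)
  · rintro ⟨u, y⟩ h ⟨u', y'⟩ h' heq
    simp only [Finset.mem_product, Finset.mem_filter, Finset.mem_univ, true_and] at h h'
    obtain ⟨h1, h2⟩ := D.mul_transversal_injective u.2 u'.2 h.2 h'.2 heq
    exact Prod.ext (Subtype.ext h1) h2
  · intro x hx
    simp only [Finset.mem_filter, Finset.mem_univ, true_and] at hx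
    obtain ⟨u, hu, y, hy, rfl⟩ := D.exists_mul_transversal L x
    refine ⟨(⟨u, hu⟩, y), ?_, rfl⟩
    simp only [Finset.mem_product, Finset.mem_filter, Finset.mem_univ, true_and]
    exact ⟨D.mem_transversal_subSimple_iff.mpr
      ((D.mul_mem_transversal_iff (inclSet_subset L K) hu hy).mp hx), hy⟩
  · rintro ⟨u, y⟩ _
    rfl

/-- Left multiplication by `x_L` is injective on `ℂW_L`. -/
theorem xElt_mul_algIncl_injective (D : RootData s e ρ f) (L : Finset B) :
    Function.Injective fun b => xElt s L * algIncl (parabolic s L) b := by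
  classical
  set H := parabolic s L with hH
  have hinj : Function.Injective H.subtype := H.subtype_injective
  refine Function.LeftInverse.injective
    (g := MonoidAlgebra.comapDomainAddMonoidHom H.subtype hinj) fun b => ?_
  induction b using MonoidAlgebra.induction_linear with
  | zero => simp
  | add x y hx hy => rw [map_add, mul_add, map_add, hx, hy]
  | single u c =>
    rw [algIncl_single, xElt_eq_sum, Finset.sum_mul, map_sum, Finset.sum_eq_single (1 : G)]
    · rw [MonoidAlgebra.single_mul_single, inv_one, one_mul, one_mul]
      exact MonoidAlgebra.comapDomain_single_map H.subtype hinj u c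
    · intro x hx hx1
      rw [MonoidAlgebra.single_mul_single]
      refine MonoidAlgebra.comapDomain_single_of_not_mem_range ?_ hinj
      rintro ⟨v, hv⟩
      refine hx1 (D.eq_one_of_mem_transversal (J := L) ?_ (by simpa using hx))
      have h1 : x = u * (v : G)⁻¹ := by
        have : (v : G) = x⁻¹ * u := hv
        rw [this]; simp
      rw [h1]
      exact mul_mem u.2 (inv_mem v.2)
    · intro h
      exact absurd (D.one_mem_transversal L) (by simpa using h)

open Classical in
theorem mMatrix_eq_weightMat_one : mMatrix s = weightMat s fun _ => 1 := by
  ext K J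
  rw [mMatrix, weightMat]
  split_ifs
  · rw [Set.ncard_eq_toFinset_card', Nat.cast_one, Finset.sum_const, nsmul_eq_mul, mul_one]
    congr 2
    ext; simp
  · rfl

theorem mMatrix_triangular (K J : Finset B) (h : mMatrix s K J ≠ 0) : J ⊆ K := by
  by_contra hcon
  exact h (if_neg hcon)

theorem one_mem_transversalSharp (D : RootData s e ρ f) (J : Finset B) :
    1 ∈ transversalSharp s J :=
  ⟨D.one_mem_transversal J, fun j _ => ⟨j, by simp⟩⟩

theorem mMatrix_self_ne_zero (D : RootData s e ρ f) (J : Finset B) : mMatrix s J J ≠ 0 := by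
  classical
  rw [mMatrix, if_pos subset_rfl, Nat.cast_ne_zero]
  exact Set.ncard_ne_zero_of_mem ⟨D.one_mem_transversal J, D.one_mem_transversalSharp J⟩
    (Set.toFinite _)

/-- The weights for which the matrix `m` of `G` restricts to the weighted matrix of `W_L`. -/
noncomputable def sharpCount (s : B → G) (L : Finset B) (J : Finset L) : ℕ :=
  (transversal s L ∩ transversalSharp s (inclSet L J)).ncard

theorem sharpCount_pos (D : RootData s e ρ f) (L : Finset B) (J : Finset L) :
    0 < sharpCount s L J :=
  Nat.pos_of_ne_zero (Set.ncard_ne_zero_of_mem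
    ⟨D.one_mem_transversal L, D.one_mem_transversalSharp _⟩ (Set.toFinite _))

/-- For `u ∈ W_L` and `y ∈ X_L`, the product `u y` carries `J` into `S` if and only if `u` carries
`J` into `L` and `y` carries `J^u` into `S`. -/
theorem mul_mem_transversalSharp_iff (D : RootData s e ρ f) {L : Finset B} {J K : Finset L}
    (hJK : J ⊆ K) {u : parabolic s L} {y : G} (hy : y ∈ transversal s L) :
    (u : G) * y ∈ transversal s (inclSet L K) ∩ transversalSharp s (inclSet L J) ↔
      u ∈ transversal (subSimple s L) K ∩ transversalSharp (subSimple s L) J ∧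
        y ∈ transversalSharp s (inclSet L (interSet (subSimple s L) J u Finset.univ)) := by
  have hK := (D.mul_mem_transversal_iff (inclSet_subset L K) u.2 hy).trans
    D.mem_transversal_subSimple_iff.symm
  have hconj : ∀ x g : G, (u * y : G)⁻¹ * g * (u * y) = y⁻¹ * ((u : G)⁻¹ * g * u) * y := by
    intro x g; group
  constructor
  · rintro ⟨h1, -, h2⟩
    have hu := hK.mp h1
    have huJ : u ∈ transversal (subSimple s L) J := transversal_anti _ hJK hu
    refine ⟨⟨hu, huJ, fun j hj => ?_⟩, transversal_anti s (inclSet_subset _ _) hy, ?_⟩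
    · obtain ⟨i, hi⟩ := h2 j (coe_mem_inclSet.mpr hj)
      have h3 : 0 ≤ ρ (u : G)⁻¹ (rootVec e j) :=
        (D.restrict L).mem_transversal_iff.mp huJ j hj
      have h4 : ρ ((u : G) * y)⁻¹ (rootVec e j) = rootVec e i := by
        refine D.rho_eq_of_conj_eq (by rw [hi, inv_inv]) ?_
        rw [mul_inv_rev, rho_mul]
        exact D.rho_inv_nonneg_of_mem_transversal hy h3 fun b hb =>
          D.rho_rootVec_apply_eq_zero (inv_mem u.2) j.2 hb
      rw [mul_inv_rev, rho_mul] at h4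
      obtain ⟨l, hl, h5⟩ := D.exists_eq_rootVec_of_transversal hy h3
        (fun b hb => D.rho_rootVec_apply_eq_zero (inv_mem u.2) j.2 hb) h4
      refine ⟨⟨l, hl⟩, Subtype.ext ?_⟩
      have := D.conj_eq_of_rho_eq h5
      rw [inv_inv] at this
      exact this.symm
    · rw [forall_mem_inclSet]
      intro l hl
      obtain ⟨-, j, hj, hlj⟩ := mem_interSet.mp hl
      have h3 := h2 j (coe_mem_inclSet.mpr hj)
      rw [hconj 1] at h3
      have h4 : (u : G) * s l * (u : G)⁻¹ = s j := congrArg Subtype.val hlj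
      rw [← h4] at h3
      simpa [mul_assoc] using h3
  · rintro ⟨⟨hu, huJ, h2⟩, -, h3⟩
    have h1 := hK.mpr hu
    refine ⟨h1, transversal_anti s (inclSet_subset_inclSet.mpr hJK) h1, ?_⟩
    rw [forall_mem_inclSet]
    intro j hj
    obtain ⟨l, hl⟩ := h2 j hj
    have hl' : s l = (u : G)⁻¹ * s j * u := congrArg Subtype.val hl
    rw [hconj 1, ← hl']
    refine h3 l (coe_mem_inclSet.mpr (mem_interSet.mpr ⟨Finset.mem_univ _, j, hj, ?_⟩))
    rw [hl]
    simp [mul_assoc]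

open Classical in
/-- The block of the matrix `m` of `G` indexed by subsets of `L` is the matrix `m` of `W_L`, with
the weight `sharpCount` attached to `J^u`. -/
theorem mMatrix_inclSet (D : RootData s e ρ f) (L : Finset B) (K J : Finset L) :
    mMatrix s (inclSet L K) (inclSet L J) = weightMat (subSimple s L) (sharpCount s L) K J := by
  rw [mMatrix, weightMat]
  simp only [inclSet_subset_inclSet]
  split_ifs with hJK
  · have hcount : ∀ J, sharpCount s L J = (Finset.univ.filter fun y : G =>
        y ∈ transversal s L ∩ transversalSharp s (inclSet L J)).card := fun J => by
      rw [sharpCount, Set.ncard_eq_toFinset_card']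
      congr 1
      ext; simp
    simp only [hcount]
    rw [← Nat.cast_sum, ← Finset.card_sigma, Set.ncard_eq_toFinset_card']
    congr 1
    symm
    refine Finset.card_bij (fun a _ => (a.1 : G) * a.2) ?_ ?_ ?_
    · rintro ⟨u, y⟩ h
      simp only [Finset.mem_sigma, Finset.mem_filter, Finset.mem_univ, true_and,
        Set.mem_toFinset] at h ⊢
      exact (D.mul_mem_transversalSharp_iff hJK h.2.1).mpr ⟨h.1, h.2.2⟩
    · rintro ⟨u, y⟩ h ⟨u', y'⟩ h' heq
      simp only [Finset.mem_sigma, Finset.mem_filter, Finset.mem_univ, true_and] at h h'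
      obtain ⟨h1, h2⟩ := D.mul_transversal_injective u.2 u'.2 h.2.1 h'.2.1 heq
      obtain rfl := Subtype.ext h1
      rw [show y = y' from h2]
    · intro x hx
      obtain ⟨u, hu, y, hy, rfl⟩ := D.exists_mul_transversal L x
      have h := (D.mul_mem_transversalSharp_iff (u := ⟨u, hu⟩) hJK hy).mp
        (Set.mem_toFinset.mp hx)
      refine ⟨⟨⟨u, hu⟩, y⟩, ?_, rfl⟩
      simp only [Finset.mem_sigma, Finset.mem_filter, Finset.mem_univ, true_and]
      exact ⟨h.1, hy, h.2⟩
  · rfl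

variable [DecidableEq B]

/-- The component of `e_L` in `ℂW_L`, so that `e_L = x_L f_L`. In general it is not a multiple of
the element `e_L` of `ℂW_L` itself. -/
noncomputable def parabolicPart (s : B → G) (L : Finset B) :
    MonoidAlgebra ℂ (parabolic s L) :=
  ∑ K : Finset L, (mMatrix s)⁻¹ L (inclSet L K) • xElt (subSimple s L) K

theorem eElt_eq_mul (D : RootData s e ρ f) (L : Finset B) :
    eElt s L = xElt s L * algIncl _ (parabolicPart s L) := by
  rw [eElt, parabolicPart, map_sum, Finset.mul_sum]
  simp only [map_smul, mul_smul_comm, ← D.xElt_inclSet]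
  exact (sum_inclSet L (g := fun K => (mMatrix s)⁻¹ L K • xElt s K) fun K hK => by
    rw [inv_apply_eq_zero mMatrix_triangular D.mMatrix_self_ne_zero hK, zero_smul]).symm

/-- If `a` annihilates the `x_J` with `J` proper, then `a` times any element of the descent algebra
is a multiple of `a`. -/
theorem mul_sum_smul_xElt (D : RootData s e ρ f) {a : MonoidAlgebra ℂ G}
    (ha : ∀ J, J ≠ Finset.univ → a * xElt s J = 0) (h : Finset B → ℂ) :
    a * ∑ K, h K • xElt s K = h Finset.univ • a := by
  rw [Finset.mul_sum, Finset.sum_eq_single Finset.univ (fun K _ hK => by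
    rw [mul_smul_comm, ha K hK, smul_zero]) (by simp), mul_smul_comm, D.xElt_univ, mul_one]

theorem eElt_univ_mul_xElt (D : RootData s e ρ f) {J : Finset B} (hJ : J ≠ Finset.univ) :
    eElt s Finset.univ * xElt s J = 0 := by
  refine D.sum_smul_xElt_mul_xElt (a := fun _ => 1) (fun _ => one_pos) (fun J hJ => ?_) hJ
  have := congrFun (congrFun (inv_mul_of_triangular (mMatrix_triangular (s := s))
    D.mMatrix_self_ne_zero) Finset.univ) J
  rw [Matrix.one_apply_ne hJ.symm, Matrix.mul_apply] at this
  rwa [mMatrix_eq_weightMat_one (s := s)] at this ⊢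

theorem parabolicPart_mul_xElt (D : RootData s e ρ f) (L : Finset B) {J : Finset L}
    (hJ : J ≠ Finset.univ) : parabolicPart s L * xElt (subSimple s L) J = 0 := by
  classical
  refine (D.restrict L).sum_smul_xElt_mul_xElt (D.sharpCount_pos L) (fun J hJ => ?_) hJ
  have hJL : L ≠ inclSet L J := by
    intro h
    exact hJ (Finset.map_injective _ (h.symm.trans (inclSet_univ L).symm))
  have := congrFun (congrFun (inv_mul_of_triangular (mMatrix_triangular (s := s))
    D.mMatrix_self_ne_zero) L) (inclSet L J)
  rw [Matrix.one_apply_ne hJL, Matrix.mul_apply, ← sum_inclSet L fun K hK => by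
    rw [inv_apply_eq_zero mMatrix_triangular D.mMatrix_self_ne_zero hK, zero_mul]] at this
  simpa only [D.mMatrix_inclSet] using this

/-! ### The character of the normalizer on the descent module -/

/-- An isomorphism of invariant subspaces intertwining two endomorphisms preserves the trace. -/
theorem trace_restrict_eq {V V' : Type*} [AddCommGroup V] [Module ℂ V] [AddCommGroup V']
    [Module ℂ V'] (F : V →ₗ[ℂ] V') {M : Submodule ℂ V} {M' : Submodule ℂ V'}
    (hmap : M.map F = M') (hinj : ∀ a ∈ M, F a = 0 → a = 0) {R : V →ₗ[ℂ] V}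
    (hR : ∀ a ∈ M, R a ∈ M) {R' : V' →ₗ[ℂ] V'} (hR' : ∀ a ∈ M', R' a ∈ M')
    (hF : ∀ a ∈ M, F (R a) = R' (F a)) :
    LinearMap.trace ℂ M (R.restrict hR) = LinearMap.trace ℂ M' (R'.restrict hR') := by
  subst hmap
  let E : M ≃ₗ[ℂ] M.map F := LinearEquiv.ofBijective
    (F.restrict (p := M) (q := M.map F) fun a ha => Submodule.mem_map_of_mem ha)
    ⟨fun a b hab => by
      have h1 : F (a - b : V) = 0 := by
        rw [map_sub, sub_eq_zero]
        exact congrArg Subtype.val hab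
      exact Subtype.ext (sub_eq_zero.mp (hinj _ (M.sub_mem a.2 b.2) h1)),
    fun ⟨_, a, ha, h⟩ => ⟨⟨a, ha⟩, Subtype.ext h⟩⟩
  rw [← LinearMap.trace_conj' (R.restrict hR) E]
  congr 1
  ext ⟨_, a, ha, rfl⟩
  have h1 : E.symm ⟨F a, a, ha, rfl⟩ = ⟨a, ha⟩ := by
    rw [LinearEquiv.symm_apply_eq]; rfl
  rw [LinearEquiv.conj_apply_apply, h1]
  exact hF a ha

theorem xElt_mul_single (D : RootData s e ρ f) {L : Finset B} {n : G}
    (hn : ∀ j ∈ L, ρ n (rootVec e j) = rootVec e j) :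
    xElt s L * MonoidAlgebra.single n 1 = xElt s L := by
  classical
  have hn' : ∀ j ∈ L, ρ n⁻¹ (rootVec e j) = rootVec e j := fun j hj => by
    conv_lhs => rw [← hn j hj, rho_inv_rho]
  rw [xElt_eq_sum, Finset.sum_mul]
  refine Finset.sum_bij' (fun x _ => n⁻¹ * x) (fun x _ => n * x) ?_ ?_ (by simp) (by simp) ?_
  · intro x hx
    simp only [Finset.mem_filter, Finset.mem_univ, true_and, D.mem_transversal_iff] at hx ⊢
    intro j hj
    rw [mul_inv_rev, inv_inv, rho_mul, hn j hj]
    exact hx j hj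
  · intro x hx
    simp only [Finset.mem_filter, Finset.mem_univ, true_and, D.mem_transversal_iff] at hx ⊢
    intro j hj
    rw [mul_inv_rev, rho_mul, hn' j hj]
    exact hx j hj
  · intro x _
    rw [MonoidAlgebra.single_mul_single]
    simp

theorem single_mul_algIncl {H : Subgroup G} {n : G} (hn : ∀ u ∈ H, n * u = u * n)
    (b : MonoidAlgebra ℂ H) :
    MonoidAlgebra.single n 1 * algIncl H b = algIncl H b * MonoidAlgebra.single n 1 := by
  induction b using MonoidAlgebra.induction_linear with
  | zero => simp
  | add x y hx hy => rw [map_add, mul_add, add_mul, hx, hy]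
  | single u c =>
    rw [algIncl_single, MonoidAlgebra.single_mul_single, MonoidAlgebra.single_mul_single,
      hn u u.2, one_mul, mul_one]

/-- `e_S` is idempotent up to a scalar, and so acts as this scalar on `e_S ℂH`. -/
theorem eElt_univ_mul_of_mem (D : RootData s e ρ f) {H : Subgroup G} {x : MonoidAlgebra ℂ G}
    (hx : x ∈ descentModule s Finset.univ H) :
    eElt s Finset.univ * x = (mMatrix s)⁻¹ Finset.univ Finset.univ • x := by
  refine Submodule.span_induction (p := fun x _ =>
    eElt s Finset.univ * x = (mMatrix s)⁻¹ Finset.univ Finset.univ • x) ?_ (by simp) ?_ ?_ hx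
  · rintro _ ⟨h, rfl⟩
    have hbb : eElt s Finset.univ * eElt s Finset.univ =
        (mMatrix s)⁻¹ Finset.univ Finset.univ • eElt s Finset.univ :=
      D.mul_sum_smul_xElt (fun J hJ => D.eElt_univ_mul_xElt hJ) _
    beta_reduce
    rw [← mul_assoc, hbb, smul_mul_assoc]
  · intro x y _ _ hx hy
    rw [mul_add, hx, hy, smul_add]
  · intro r x _ hx
    rw [mul_smul_comm, hx, smul_comm]

/-- If every element of `N` is a product of an element of `W_L` and one fixing the simple roots in
`L`, then the second factor acts trivially on `e_L ℂN`, and `e_L ℂN` is isomorphic as a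
`W_L`-module to the top component of `ℂW_L`. -/
theorem descentChar_mul (D : RootData s e ρ f) {L : Finset B} {N : Subgroup G}
    (hLN : parabolic s L ≤ N)
    (hN : ∀ g ∈ N, ∃ u ∈ parabolic s L, ∃ n, (∀ j ∈ L, ρ n (rootVec e j) = rootVec e j) ∧
      g = u * n) (u : parabolic s L) {n : G}
    (hn : ∀ j ∈ L, ρ n (rootVec e j) = rootVec e j) (hun : (u : G) * n ∈ N) :
    descentChar s L N ⟨u * n, hun⟩ = topPhi (subSimple s L) u := by
  classical
  set c := (mMatrix s)⁻¹ L L with hc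
  set c' := (mMatrix (subSimple s L))⁻¹ Finset.univ Finset.univ with hc'
  have hc0 : c ≠ 0 := inv_apply_self_ne_zero mMatrix_triangular D.mMatrix_self_ne_zero L
  have hc0' : c' ≠ 0 :=
    inv_apply_self_ne_zero mMatrix_triangular (D.restrict L).mMatrix_self_ne_zero _
  set a := parabolicPart s L with ha
  set b := eElt (subSimple s L) Finset.univ with hb
  have hab : a * b = c' • a :=
    (D.restrict L).mul_sum_smul_xElt (fun J hJ => D.parabolicPart_mul_xElt L hJ) _
  have hba : b * a = c • b := by
    have := (D.restrict L).mul_sum_smul_xElt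
      (fun J hJ => (D.restrict L).eElt_univ_mul_xElt hJ)
      (fun K => (mMatrix s)⁻¹ L (inclSet L K))
    rwa [inclSet_univ] at this
  -- the isomorphism is left multiplication by `x_L a = e_L`
  let F : MonoidAlgebra ℂ (parabolic s L) →ₗ[ℂ] MonoidAlgebra ℂ G :=
    LinearMap.mulLeft ℂ (xElt s L) ∘ₗ (algIncl (parabolic s L)).toLinearMap ∘ₗ LinearMap.mulLeft ℂ a
  have hF : ∀ x, F x = xElt s L * algIncl (parabolic s L) (a * x) := fun _ => rfl
  have hright : ∀ x : MonoidAlgebra ℂ (parabolic s L), ∀ u : parabolic s L, ∀ n,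
      (∀ j ∈ L, ρ n (rootVec e j) = rootVec e j) →
      F x * MonoidAlgebra.single ((u : G) * n) 1 = F (x * MonoidAlgebra.single u 1) := by
    intro x u n hn
    have h1 : (MonoidAlgebra.single ((u : G) * n) 1 : MonoidAlgebra ℂ G) =
        MonoidAlgebra.single n 1 * algIncl (parabolic s L) (MonoidAlgebra.single u 1) := by
      rw [algIncl_single, MonoidAlgebra.single_mul_single, D.commute_of_rho_eq hn u u.2, mul_one]
    have h2 := single_mul_algIncl (H := parabolic s L) (D.commute_of_rho_eq hn) (a * x)
    rw [h1, hF, hF, ← mul_assoc (a : MonoidAlgebra ℂ (parabolic s L)),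
      map_mul (algIncl (parabolic s L)) (a * x), mul_assoc,
      ← mul_assoc (algIncl (parabolic s L) (a * x)), ← h2, ← mul_assoc, ← mul_assoc,
      D.xElt_mul_single hn, mul_assoc]
  have hFb : F b = c' • eElt s L := by
    rw [hF, hab, map_smul, mul_smul_comm, ← D.eElt_eq_mul]
  symm
  refine trace_restrict_eq F ?_ ?_ _ _ ?_
  · refine le_antisymm ?_ ?_
    · rw [descentModule, Submodule.map_span, Submodule.span_le]
      rintro _ ⟨_, ⟨h, rfl⟩, rfl⟩
      have h1 := hright b h 1 (by simp)
      rw [hFb, mul_one] at h1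
      beta_reduce
      rw [← h1, smul_mul_assoc]
      exact Submodule.smul_mem _ _ (Submodule.subset_span
        ⟨⟨(h : parabolic s L), hLN (h : parabolic s L).2⟩, rfl⟩)
    · rw [descentModule, Submodule.span_le]
      rintro _ ⟨g, rfl⟩
      obtain ⟨v, hv, m, hm, hg⟩ := hN g g.2
      have h1 := hright b ⟨v, hv⟩ m hm
      rw [hFb, smul_mul_assoc] at h1
      refine ⟨c'⁻¹ • (b * MonoidAlgebra.single ⟨v, hv⟩ 1), Submodule.smul_mem _ _
        (Submodule.subset_span ⟨⟨⟨v, hv⟩, trivial⟩, rfl⟩), ?_⟩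
      beta_reduce
      rw [map_smul, ← h1, smul_smul, inv_mul_cancel₀ hc0', one_smul, hg]
  · intro x hx h0
    have h1 : a * x = 0 := D.xElt_mul_algIncl_injective L (by
      beta_reduce
      rw [← hF, h0, map_zero, mul_zero])
    have h2 : c • (b * x) = 0 := by rw [← smul_mul_assoc, ← hba, mul_assoc, h1, mul_zero]
    rw [(D.restrict L).eElt_univ_mul_of_mem hx, smul_smul] at h2
    rw [← inv_smul_smul₀ (mul_ne_zero hc0 hc0') x, h2, smul_zero]
  · intro x _
    rw [LinearMap.mulRight_apply, LinearMap.mulRight_apply]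
    exact (hright x u n hn).symm

end RootData

namespace RootData

variable {G B ι : Type*} [Group G] {s : B → G} {e : B → ι}
  {ρ : Representation ℝ G (ι → ℝ)} {f : LinearMap.BilinForm ℝ (ι → ℝ)} [DecidableEq ι]

/-! ### The sign character as a determinant -/

theorem det_simple [Fintype ι] (D : RootData s e ρ f) (i : B) :
    LinearMap.det (ρ (s i)) = -1 := by
  have h : ρ (s i) = LinearMap.transvection ((-2 : ℝ) • f (rootVec e i)) (rootVec e i) := by
    refine LinearMap.ext fun v => ?_
    rw [LinearMap.transvection.apply, LinearMap.smul_apply, smul_eq_mul, D.refl]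
    module
  rw [h, LinearMap.transvection.det, LinearMap.smul_apply, D.one]
  norm_num

theorem sgn_eq_det [Fintype ι] (D : RootData s e ρ f) (g : G) :
    sgn s g = ((LinearMap.det (ρ g) : ℝ) : ℂ) := by
  obtain ⟨ω, hω, rfl⟩ := D.exists_word g
  rw [sgn, ← hω]
  clear hω
  induction ω with
  | nil => simp
  | cons i ω ih =>
    rw [List.map_cons, List.prod_cons, map_mul, map_mul, D.det_simple, List.length_cons, pow_succ,
      ih]
    push_cast
    ring

/-! ### Normalizers of parabolic subgroups -/

/-- The elements fixing all simple roots in `L`. -/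
def fixingSubgroup (ρ : Representation ℝ G (ι → ℝ)) (e : B → ι) (L : Finset B) : Subgroup G where
  carrier := {n | ∀ j ∈ L, ρ n (rootVec e j) = rootVec e j}
  mul_mem' := fun {a b} ha hb j hj => by rw [rho_mul, hb j hj, ha j hj]
  one_mem' := by simp
  inv_mem' := fun {a} ha j hj => by
    conv_lhs => rw [← ha j hj, rho_inv_rho]

/-- If `W_L` is bulky, its normalizer complement `N_L` fixes the simple roots in `L`. -/
theorem mem_normalizerComplement_iff (D : RootData s e ρ f) {L : Finset B} (hL : IsBulky s L)
    {n : G} : n ∈ normalizerComplement s L ↔ n ∈ fixingSubgroup ρ e L := by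
  constructor
  · intro hn
    refine (inv_mem_iff (H := fixingSubgroup ρ e L)).mp fun j hj => ?_
    refine D.rho_eq_of_conj_eq ?_ (D.mem_transversal_iff.mp hn.1 j hj)
    have := hL n hn (s j) (simple_mem_parabolic hj)
    rw [inv_inv, mul_assoc, ← this]
    simp
  · intro hn
    have hn' := inv_mem hn
    refine ⟨D.mem_transversal_iff.mpr fun j hj => ?_, ?_⟩
    · rw [hn' j hj]
      exact rootVec_nonneg e j
    · have h : ∀ j ∈ L, n⁻¹ * s j * n = s j := fun j hj => by
        simpa using D.conj_eq_of_rho_eq (hn' j hj)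
      rw [Set.image_image]
      exact Set.image_congr fun j hj => h j hj

/-- The root of a reflection in `W_L` lies in the span of the simple roots in `L`. -/
theorem support_of_conj_mem (D : RootData s e ρ f) {L : Finset B} {g : G} {k : B}
    (h : g * s k * g⁻¹ ∈ CoxArr.parabolic s L) :
    ∀ b ∉ e '' (L : Set B), ρ g (rootVec e k) b = 0 := by
  intro b hb
  have h1 := D.rho_apply_of_mem_parabolic h (ρ g (rootVec e k)) hb
  rw [D.conj_refl, D.inv, D.one] at h1
  simp only [Pi.sub_apply, Pi.smul_apply, smul_eq_mul] at h1
  linarith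

/-- An element of `X_L` normalizing `W_L` permutes the simple roots in `L`. -/
theorem mem_normalizerComplement_of_normalizer [Fintype G] (D : RootData s e ρ f) {L : Finset B}
    {y : G} (hy : y ∈ transversal s L)
    (hN : y ∈ Subgroup.normalizer (CoxArr.parabolic s L : Set G)) :
    y ∈ normalizerComplement s L := by
  -- `y⁻¹`, and so its power `y`, preserves the cone spanned by the simple roots in `L`
  have hcone : ∀ v : ι → ℝ, 0 ≤ v → (∀ b ∉ e '' (L : Set B), v b = 0) →
      0 ≤ ρ y⁻¹ v ∧ ∀ b ∉ e '' (L : Set B), ρ y⁻¹ v b = 0 := by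
    intro v h0 hv
    refine ⟨D.rho_inv_nonneg_of_mem_transversal hy h0 hv, fun b hb => ?_⟩
    rw [eq_sum_rootVec D.inj hv, map_sum, Finset.sum_apply]
    refine Finset.sum_eq_zero fun j hj => ?_
    rw [map_smul, Pi.smul_apply, D.support_of_conj_mem ?_ b hb, smul_zero]
    exact (Subgroup.mem_normalizer_iff.mp (inv_mem hN) _).mp (simple_mem_parabolic hj)
  have hpow : ∀ m : ℕ, ∀ v : ι → ℝ, 0 ≤ v → (∀ b ∉ e '' (L : Set B), v b = 0) →
      0 ≤ ρ (y⁻¹ ^ m) v ∧ ∀ b ∉ e '' (L : Set B), ρ (y⁻¹ ^ m) v b = 0 := by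
    intro m
    induction m with
    | zero =>
      intro v h0 hv
      rw [pow_zero, map_one]
      exact ⟨h0, hv⟩
    | succ m ih =>
      intro v h0 hv
      rw [pow_succ', rho_mul]
      exact hcone _ (ih v h0 hv).1 (ih v h0 hv).2
  have hyarr : y ∈ arrows ρ e L L := by
    rw [mem_arrows]
    intro j hj
    have hyeq : y⁻¹ ^ (orderOf y⁻¹ - 1) = y := by
      have h1 := pow_orderOf_eq_one y⁻¹
      rw [← Nat.sub_add_cancel (orderOf_pos y⁻¹), pow_succ] at h1
      simpa using eq_inv_of_mul_eq_one_left h1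
    have h2 := hpow (orderOf y⁻¹ - 1) (rootVec e j) (rootVec_nonneg e j) fun b hb => by
      have : b ≠ e j := fun h => hb ⟨j, hj, h.symm⟩
      simp [rootVec, this]
    rw [hyeq] at h2
    exact D.exists_eq_rootVec_of_transversal hy h2.1 h2.2 (rho_inv_rho ρ y _)
  have hyarr' := D.inv_mem_arrows rfl hyarr
  refine ⟨hy, Set.Subset.antisymm ?_ ?_⟩
  · rintro _ ⟨_, ⟨j, hj, rfl⟩, rfl⟩
    obtain ⟨i, hi, h⟩ := mem_arrows.mp hyarr' j hj
    exact ⟨i, hi, by simpa using (D.conj_eq_of_rho_eq h).symm⟩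
  · rintro _ ⟨j, hj, rfl⟩
    obtain ⟨i, hi, h⟩ := mem_arrows.mp hyarr j hj
    refine ⟨s i, ⟨i, hi, rfl⟩, ?_⟩
    beta_reduce
    rw [← D.conj_eq_of_rho_eq h]
    simp [mul_assoc]

/-- The normalizer of a bulky parabolic subgroup `W_L` is the product of `W_L` and the pointwise
stabilizer of the simple roots in `L`. -/
theorem exists_mul_of_mem_normalizer [Fintype G] (D : RootData s e ρ f) {L : Finset B}
    (hL : IsBulky s L) {g : G}
    (hg : g ∈ Subgroup.normalizer (CoxArr.parabolic s L : Set G)) :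
    ∃ u ∈ CoxArr.parabolic s L, ∃ n ∈ fixingSubgroup ρ e L, g = u * n := by
  obtain ⟨u, hu, y, hy, rfl⟩ := D.exists_mul_transversal L g
  refine ⟨u, hu, y, (D.mem_normalizerComplement_iff hL).mp
    (D.mem_normalizerComplement_of_normalizer hy ?_), rfl⟩
  exact (Subgroup.mul_mem_cancel_left _ (Subgroup.le_normalizer hu)).mp hg

theorem mul_fixing_injective (D : RootData s e ρ f) {L : Finset B} {u u' n n' : G}
    (hu : u ∈ CoxArr.parabolic s L) (hu' : u' ∈ CoxArr.parabolic s L)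
    (hn : n ∈ fixingSubgroup ρ e L) (hn' : n' ∈ fixingSubgroup ρ e L) (h : u * n = u' * n') :
    u = u' ∧ n = n' := by
  have key : ∀ n ∈ fixingSubgroup ρ e L, n ∈ transversal s L := fun n hn =>
    D.mem_transversal_iff.mpr fun j hj => by
      rw [inv_mem hn j hj]
      exact rootVec_nonneg e j
  exact D.mul_transversal_injective hu hu' (key n hn) (key n' hn') h

theorem fixingSubgroup_le_normalizer (D : RootData s e ρ f) (L : Finset B) :
    fixingSubgroup ρ e L ≤ Subgroup.normalizer (CoxArr.parabolic s L : Set G) := by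
  have key : ∀ n ∈ fixingSubgroup ρ e L, ∀ u ∈ CoxArr.parabolic s L, n * u * n⁻¹ = u :=
    fun n hn u hu => by rw [D.commute_of_rho_eq hn u hu]; simp
  intro n hn
  rw [Subgroup.mem_normalizer_iff]
  intro u
  constructor
  · intro hu
    rw [key n hn u hu]
    exact hu
  · intro hu
    have h1 := key n⁻¹ (inv_mem hn) _ hu
    have h2 : n⁻¹ * (n * u * n⁻¹) * n⁻¹⁻¹ = u := by group
    rw [h2] at h1
    rw [h1]
    exact hu

/-! ### Roots in the span of a set of simple roots -/

/-- A positive root in the span of the simple roots in `L` is conjugate under `W_L` to one of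
them: take a conjugate with minimal coordinate sum. -/
theorem exists_rho_eq_of_nonneg_of_support [Fintype ι] [Fintype G] (D : RootData s e ρ f)
    {L : Finset B} {g : G} {k : B} (h0 : 0 ≤ ρ g (rootVec e k))
    (h : ∀ b ∉ e '' (L : Set B), ρ g (rootVec e k) b = 0) :
    ∃ u ∈ CoxArr.parabolic s L, ∃ j ∈ L, ρ g (rootVec e k) = ρ u (rootVec e j) := by
  classical
  let P : Finset G := Finset.univ.filter fun u =>
    u ∈ CoxArr.parabolic s L ∧ 0 ≤ ρ (u * g) (rootVec e k)
  obtain ⟨u, hu, hmin⟩ := P.exists_min_image (fun u => ∑ b, ρ (u * g) (rootVec e k) b)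
    ⟨1, by simpa [P, one_mem] using h0⟩
  simp only [P, Finset.mem_filter, Finset.mem_univ, true_and] at hu hmin
  obtain ⟨huL, hu0⟩ := hu
  set γ := ρ (u * g) (rootVec e k) with hγ
  have hsupp : ∀ b ∉ e '' (L : Set B), γ b = 0 := fun b hb => by
    rw [hγ, rho_mul, D.rho_apply_of_mem_parabolic huL _ hb, h b hb]
  have hself : f γ γ = 1 := by rw [hγ, D.inv, D.one]
  -- a simple root in `L` having positive product with `γ`
  obtain ⟨j, hj, hpos⟩ : ∃ j ∈ L, 0 < f (rootVec e j) γ := by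
    by_contra! hcon
    have h1 : f γ γ ≤ 0 := by
      have h2 : f γ γ = f (∑ j ∈ L, γ (e j) • rootVec e j) γ := by
        rw [← eq_sum_rootVec D.inj hsupp]
      rw [h2, map_sum, LinearMap.sum_apply]
      refine Finset.sum_nonpos fun j hj => ?_
      rw [map_smul, LinearMap.smul_apply, smul_eq_mul]
      exact mul_nonpos_of_nonneg_of_nonpos (hu0 _) (hcon j hj)
    linarith
  have hneg : ¬ 0 ≤ ρ (s j) γ := by
    intro hcon
    rw [hγ, ← rho_mul, ← mul_assoc] at hcon
    have h1 := hmin (s j * u) ⟨mul_mem (simple_mem_parabolic hj) huL, hcon⟩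
    rw [mul_assoc, rho_mul, ← hγ, D.refl] at h1
    simp only [Pi.sub_apply, Pi.smul_apply, smul_eq_mul, Finset.sum_sub_distrib,
      ← Finset.mul_sum] at h1
    have h2 : ∑ b, rootVec e j b = 1 := by simp [rootVec]
    rw [h2] at h1
    linarith
  have h3 := D.rho_eq_of_sign_change (g := u * g) hu0 hneg
  refine ⟨u⁻¹, inv_mem huL, j, hj, ?_⟩
  rw [← h3, ← rho_mul]
  simp

/-- A reflection whose root lies in the span of the simple roots in `L` is conjugate under `W_L`
to a simple reflection in `L`. -/
theorem exists_conj_of_support [Fintype ι] [Fintype G] (D : RootData s e ρ f)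
    {L : Finset B} {g : G} {k : B} (h : ∀ b ∉ e '' (L : Set B), ρ g (rootVec e k) b = 0) :
    ∃ u ∈ CoxArr.parabolic s L, ∃ j ∈ L, g * s k * g⁻¹ = u * s j * u⁻¹ := by
  have key : ∀ g : G, 0 ≤ ρ g (rootVec e k) → (∀ b ∉ e '' (L : Set B), ρ g (rootVec e k) b = 0) →
      ∃ u ∈ CoxArr.parabolic s L, ∃ j ∈ L, g * s k * g⁻¹ = u * s j * u⁻¹ := by
    intro g h0 h
    obtain ⟨u, hu, j, hj, he⟩ := D.exists_rho_eq_of_nonneg_of_support h0 h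
    exact ⟨u, hu, j, hj, D.eq_of_rho fun v => by rw [D.conj_refl, D.conj_refl, he]⟩
  by_cases h0 : 0 ≤ ρ g (rootVec e k)
  · exact key g h0 h
  · have h1 : ρ (g * s k) (rootVec e k) = -ρ g (rootVec e k) := by
      rw [rho_mul, D.refl_self, map_neg]
    obtain ⟨u, hu, j, hj, he⟩ := key (g * s k)
      (by rw [h1]; exact neg_nonneg.mpr ((D.not_nonneg_iff g k).mp h0))
      (fun b hb => by rw [h1, Pi.neg_apply, h b hb, neg_zero])
    refine ⟨u, hu, j, hj, ?_⟩
    rw [← he, mul_inv_rev, D.simple_inv]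
    simp only [mul_assoc, D.simple_mul_self, mul_one]

end RootData

/-! ### Fixed spaces of parabolic subgroups -/

section FixedSpaces

variable {B W : Type*} [Fintype B] [DecidableEq B] [Group W] {M : CoxeterMatrix B}

theorem rootData (cs : CoxeterSystem M W) : RootData cs.simple id (reflRep cs) (form M) where
  inj := Function.injective_id
  gen := cs.subgroup_closure_range_simple
  refl := reflRep_simple cs
  inv := form_reflRep cs
  one i := by
    change form M (simpleRoot i) (simpleRoot i) = 1
    simp [form_simpleRoot]
  faithful := reflRep_faithful cs
  pos := reflRep_nonneg_or_nonpos cs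

theorem rootData_para (cs : CoxeterSystem M W) (L : Finset B) :
    RootData (paraSimple cs L) (fun i : L => (i : B))
      ((reflRep cs).comp (para cs L).subtype) (form M) :=
  (rootData cs).restrict L

theorem mem_fixedSpace_para_iff (cs : CoxeterSystem M W) {L : Finset B} {v : B → ℝ} :
    v ∈ fixedSpace cs (para cs L) ↔ ∀ j ∈ L, form M (simpleRoot j) v = 0 := by
  constructor
  · intro h j hj
    have h1 := h _ (simple_mem_parabolic hj)
    rw [reflRep_simple] at h1
    have := congrFun h1 j
    simpa [simpleRoot] using this
  · intro h u hu
    refine Subgroup.closure_induction (p := fun u _ => reflRep cs u v = v) ?_ (by simp) ?_ ?_ hu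
    · rintro _ ⟨j, hj, rfl⟩
      rw [reflRep_simple, h j hj]; simp
    · intro x y _ _ hx hy
      rw [RootData.rho_mul, hy, hx]
    · intro x _ hx
      conv_lhs => rw [← hx, RootData.rho_inv_rho]

theorem form_isRefl (M : CoxeterMatrix B) : (form M).IsRefl := fun x y h => by
  rw [form_symm]; exact h

/-- The span of the simple roots in `L`. -/
def rootSpace (L : Finset B) : Submodule ℝ (B → ℝ) where
  carrier := {v | ∀ b ∉ L, v b = 0}
  add_mem' := fun {x y} hx hy b hb => by simp [hx b hb, hy b hb]
  zero_mem' := by simp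
  smul_mem' := fun c x hx b hb => by simp [hx b hb]

theorem eq_sum_simpleRoot {L : Finset B} {v : B → ℝ} (hv : v ∈ rootSpace L) :
    v = ∑ j ∈ L, v j • simpleRoot j :=
  RootData.eq_sum_rootVec (e := id) Function.injective_id fun b hb => hv b (by simpa using hb)

theorem simpleRoot_mem_rootSpace {L : Finset B} {j : B} (hj : j ∈ L) :
    simpleRoot j ∈ rootSpace L := fun b hb => by
  have : b ≠ j := fun h => hb (h ▸ hj)
  simp [simpleRoot, this]

theorem orthogonal_rootSpace (cs : CoxeterSystem M W) (L : Finset B) :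
    (form M).orthogonal (rootSpace L) = fixedSpace cs (para cs L) := by
  ext v
  rw [mem_fixedSpace_para_iff]
  constructor
  · intro h j hj
    exact h _ (simpleRoot_mem_rootSpace hj)
  · intro h x hx
    change form M x v = 0
    rw [eq_sum_simpleRoot hx, map_sum, LinearMap.sum_apply]
    exact Finset.sum_eq_zero fun j hj => by
      rw [map_smul, LinearMap.smul_apply, h j hj, smul_zero]

variable [Finite W]

theorem isCompl_rootSpace (cs : CoxeterSystem M W) (L : Finset B) :
    IsCompl (rootSpace L) (fixedSpace cs (para cs L)) := by
  rw [← orthogonal_rootSpace, LinearMap.BilinForm.isCompl_orthogonal_iff_disjoint (form_isRefl M),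
    Submodule.disjoint_def]
  intro v hv hv'
  by_contra h0
  exact (form_self_pos cs v h0).ne' (hv' v hv)

theorem paraSpace_eq (cs : CoxeterSystem M W) (L : Finset B) : paraSpace cs L = rootSpace L := by
  refine le_antisymm (fun v hv => ?_) fun v hv x hx => ?_
  · have htop : v ∈ rootSpace L ⊔ fixedSpace cs (para cs L) := by
      rw [(isCompl_rootSpace cs L).sup_eq_top]; trivial
    obtain ⟨u, hu, x, hx, rfl⟩ := Submodule.mem_sup.mp htop
    have h1 : form M x (u + x) = 0 := hv x hx
    have h2 : form M x u = 0 := by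
      rw [form_symm]
      rw [← orthogonal_rootSpace] at hx
      exact hx u hu
    rw [map_add, h2, zero_add] at h1
    have h3 : x = 0 := by
      by_contra h0
      exact (form_self_pos cs x h0).ne' h1
    rwa [h3, add_zero]
  · rw [← orthogonal_rootSpace] at hx
    change form M x v = 0
    rw [form_symm]
    exact hx v hv

theorem isCompl_paraSpace (cs : CoxeterSystem M W) (L : Finset B) :
    IsCompl (paraSpace cs L) (fixedSpace cs (para cs L)) := by
  rw [paraSpace_eq cs]
  exact isCompl_rootSpace cs L

/-- A reflection fixing `Fix(W_L)` pointwise is conjugate under `W_L` to a simple reflection in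
`L`. -/
theorem exists_conj_of_fixes (cs : CoxeterSystem M W) {L : Finset B} {g : W} {k : B}
    (h : ∀ v ∈ fixedSpace cs (para cs L), reflRep cs (g * cs.simple k * g⁻¹) v = v) :
    ∃ u ∈ para cs L, ∃ j ∈ L, g * cs.simple k * g⁻¹ = u * cs.simple j * u⁻¹ := by
  cases nonempty_fintype W
  refine (rootData cs).exists_conj_of_support fun b hb => ?_
  have hmem : reflRep cs g (simpleRoot k) ∈ paraSpace cs L := by
    intro v hv
    have h1 := h v hv
    rw [(rootData cs).conj_refl, sub_eq_self, smul_eq_zero] at h1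
    change form M v _ = 0
    rw [form_symm]
    have h2 := h1.resolve_right (RootData.rho_rootVec_ne_zero (reflRep cs) g k)
    exact (mul_eq_zero.mp h2).resolve_left two_ne_zero
  rw [paraSpace_eq cs] at hmem
  exact hmem b (by simpa using hb)

/-- A cuspidal element of `W_L` has no fixed vectors outside `Fix(W_L)`. -/
theorem mem_fixedSpace_of_cuspidal (cs : CoxeterSystem M W) {L : Finset B} {w : para cs L}
    (hw : IsCuspidal (paraRep cs L) w) {v : B → ℝ} (hv : reflRep cs (w : W) v = v) :
    v ∈ fixedSpace cs (para cs L) := by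
  have htop : v ∈ paraSpace cs L ⊔ fixedSpace cs (para cs L) := by
    rw [(isCompl_paraSpace cs L).sup_eq_top]; trivial
  obtain ⟨a, ha, x, hx, rfl⟩ := Submodule.mem_sup.mp htop
  rw [map_add, hx w w.2] at hv
  have h1 := hw ⟨a, ha⟩ (Subtype.ext (add_right_cancel hv))
  have h2 : a = 0 := congrArg Subtype.val h1
  rwa [h2, zero_add]

/-- For `w` cuspidal in `W_L`, an element commuting with `w` stabilizes `Fix(w) = Fix(W_L)`, and so
normalizes the group `W_L` generated by the reflections that fix this space pointwise. -/
theorem centralizer_le_normalizer (cs : CoxeterSystem M W) {L : Finset B} {w : para cs L}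
    (hw : IsCuspidal (paraRep cs L) w) :
    Subgroup.centralizer {(w : W)} ≤ paraNormalizer cs L := by
  have key : ∀ c ∈ Subgroup.centralizer {(w : W)}, ∀ u ∈ para cs L, c * u * c⁻¹ ∈ para cs L := by
    intro c hc u hu
    have hcomm : ∀ v, reflRep cs (w : W) (reflRep cs c⁻¹ v) =
        reflRep cs c⁻¹ (reflRep cs (w : W) v) := fun v => by
      rw [← RootData.rho_mul, ← RootData.rho_mul,
        Subgroup.mem_centralizer_singleton_iff.mp (inv_mem hc)]
    refine Subgroup.closure_induction (p := fun u _ => c * u * c⁻¹ ∈ para cs L) ?_ (by simp)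
      ?_ ?_ hu
    · rintro _ ⟨j, hj, rfl⟩
      have hj' : j ∈ L := hj
      obtain ⟨u, hu, i, hi, he⟩ := exists_conj_of_fixes cs (L := L) (g := c) (k := j) fun v hv => by
        have h1 : reflRep cs c⁻¹ v ∈ fixedSpace cs (para cs L) :=
          mem_fixedSpace_of_cuspidal cs hw (by rw [hcomm, hv w w.2])
        rw [RootData.rho_mul, RootData.rho_mul, h1 _ (simple_mem_parabolic hj'),
          RootData.rho_rho_inv]
      rw [he]
      exact mul_mem (mul_mem hu (simple_mem_parabolic hi)) (inv_mem hu)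
    · intro x y _ _ hx hy
      have : c * (x * y) * c⁻¹ = (c * x * c⁻¹) * (c * y * c⁻¹) := by group
      rw [this]
      exact mul_mem hx hy
    · intro x _ hx
      have : c * x⁻¹ * c⁻¹ = (c * x * c⁻¹)⁻¹ := by group
      rw [this]
      exact inv_mem hx
  intro c hc
  rw [Subgroup.mem_normalizer_iff]
  refine fun u => ⟨key c hc u, fun h => ?_⟩
  have h1 := key c⁻¹ (inv_mem hc) _ h
  have h2 : c⁻¹ * (c * u * c⁻¹) * c⁻¹⁻¹ = u := by group
  rwa [h2] at h1

/-! ### The sign character and the determinant on the fixed space -/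

/-- `ε(n) = α_L(u n)` for `u ∈ W_L` and `n` fixing the simple roots in `L`. -/
theorem det_reflRep_eq_alpha (cs : CoxeterSystem M W) {L : Finset B} {n : W}
    (hn : n ∈ RootData.fixingSubgroup (reflRep cs) id L) (u : para cs L)
    (hg : (u : W) * n ∈ paraNormalizer cs L) :
    LinearMap.det (reflRep cs n) = alpha cs L ⟨u * n, hg⟩ := by
  have hnN : n ∈ paraNormalizer cs L := (rootData cs).fixingSubgroup_le_normalizer L hn
  have hle := (fixedSpace_comap cs (para cs L) n hnN).ge
  rw [LinearMap.det_eq_det_mul_det (fixedSpace cs (para cs L)) (reflRep cs n) hle]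
  -- `n` acts as the identity on `V_L`, so on the quotient by `Fix(W_L)`
  have hquot : (fixedSpace cs (para cs L)).mapQ _ (reflRep cs n) hle = LinearMap.id := by
    refine LinearMap.ext fun q => ?_
    obtain ⟨v, rfl⟩ := Submodule.mkQ_surjective _ q
    have htop : v ∈ rootSpace L ⊔ fixedSpace cs (para cs L) := by
      rw [(isCompl_rootSpace cs L).sup_eq_top]; trivial
    obtain ⟨a, ha, x, hx, rfl⟩ := Submodule.mem_sup.mp htop
    have hna : reflRep cs n a = a := by
      rw [eq_sum_simpleRoot ha, map_sum]
      exact Finset.sum_congr rfl fun j hj => by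
        rw [map_smul]
        exact congrArg _ (hn j hj)
    rw [Submodule.mkQ_apply, Submodule.mapQ_apply, LinearMap.id_apply, Submodule.Quotient.eq,
      map_add, hna, add_sub_add_left_eq_sub]
    exact Submodule.sub_mem _ (hle hx) hx
  rw [hquot, LinearMap.det_id, mul_one, alpha]
  congr 1
  refine LinearMap.ext fun x => Subtype.ext ?_
  change reflRep cs n x = reflRep cs (u * n) x
  rw [RootData.rho_mul]
  exact ((hle x.2 : reflRep cs n x ∈ fixedSpace cs (para cs L)) u u.2).symm

/-- The character `ε α_L` of the normalizer depends only on the component in `W_L`, where it is the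
sign character. -/
theorem sgn_mul_alpha (cs : CoxeterSystem M W) {L : Finset B} {n : W}
    (hn : n ∈ RootData.fixingSubgroup (reflRep cs) id L) (u : para cs L)
    (hg : (u : W) * n ∈ paraNormalizer cs L) :
    sgn cs.simple ((u : W) * n) * (alpha cs L ⟨u * n, hg⟩ : ℂ) = sgn (paraSimple cs L) u := by
  rw [(rootData cs).sgn_eq_det, (rootData_para cs L).sgn_eq_det, ← det_reflRep_eq_alpha cs hn u hg,
    map_mul, map_mul]
  have h1 := (rootData cs).sgn_eq_det n
  have h2 : sgn cs.simple n * sgn cs.simple n = 1 := by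
    rw [sgn, ← mul_pow]; simp
  rw [h1] at h2
  push_cast
  rw [mul_assoc, h2, mul_one]
  rfl

end FixedSpaces

/-! ### The Orlik-Solomon algebra of a parabolic subgroup -/

section OrlikSolomon

variable {G B V : Type*} [Group G] {s : B → G} [AddCommGroup V] [Module ℝ V]
  {ρ : Representation ℝ G V}

theorem mem_hyperplane {t : G} {v : V} : v ∈ hyperplane ρ t ↔ ρ t v = v := by
  simp [hyperplane, sub_eq_zero]

theorem mem_meet {l : List (reflections s)} {v : V} :
    v ∈ meet s ρ l ↔ ∀ t ∈ l, ρ (t : G) v = v := by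
  simp [meet, mem_hyperplane]

theorem osGen_mul_comm (t t' : reflections s) :
    osGen s ρ t * osGen s ρ t' = -(osGen s ρ t' * osGen s ρ t) := by
  have := RingQuot.mkAlgHom_rel ℂ (OSRel.anticomm (ρ := ρ) t t')
  simpa [osGen] using this

theorem osGen_mul_self (t : reflections s) : osGen s ρ t * osGen s ρ t = 0 := by
  have h : (2 : ℂ) • (osGen s ρ t * osGen s ρ t) = 0 := by
    rw [two_smul]
    exact eq_neg_iff_add_eq_zero.mp (osGen_mul_comm t t)
  rw [← inv_smul_smul₀ (two_ne_zero (α := ℂ)) (osGen s ρ t * osGen s ρ t), h, smul_zero]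

theorem sum_eraseIdx_eq_zero {l : List (reflections s)} (hl : Dependent s ρ l) :
    ∑ i ∈ Finset.range l.length,
      (-1 : ℂ) ^ (i + 1) • ((l.eraseIdx i).map (osGen s ρ)).prod = 0 := by
  have := RingQuot.mkAlgHom_rel ℂ (OSRel.dependent l hl)
  simp only [map_sum, map_smul, map_list_prod, List.map_map, map_zero] at this
  exact this

/-- Monomials in dependent generators vanish. -/
theorem prod_osGen_eq_zero {l : List (reflections s)} (hl : Dependent s ρ l) :
    (l.map (osGen s ρ)).prod = 0 := by
  cases l with
  | nil =>
    -- the empty family is independent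
    have h : meet s ρ [] = ⊤ := eq_top_iff.mpr fun v _ => mem_meet.mpr (by simp)
    rw [Dependent, h, finrank_top] at hl
    exact absurd hl (by simp)
  | cons t l =>
    -- multiplied by `a_t`, the relation loses all terms in which `t` has not been omitted
    have h := congrArg (osGen s ρ t * ·) (sum_eraseIdx_eq_zero hl)
    simp only [mul_zero, Finset.mul_sum, List.length_cons] at h
    rw [Finset.sum_range_succ', Finset.sum_eq_zero] at h
    · simpa using h
    · intro i _
      rw [List.eraseIdx_cons_succ, List.map_cons, List.prod_cons, mul_smul_comm, ← mul_assoc,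
        osGen_mul_self, zero_mul, smul_zero]

theorem osAlgebra_hom_ext {A : Type*} [Semiring A] [Algebra ℂ A]
    {F F' : OSAlgebra s ρ →ₐ[ℂ] A} (h : ∀ t, F (osGen s ρ t) = F' (osGen s ρ t)) : F = F' := by
  exact RingQuot.ringQuot_ext' ℂ F F' (FreeAlgebra.hom_ext (funext h))

/-- The algebra homomorphism on the Orlik-Solomon algebra with given values on the generators. -/
noncomputable def osLift {A : Type*} [Ring A] [Algebra ℂ A] (F : reflections s → A)
    (h1 : ∀ t t', F t * F t' = -(F t' * F t))
    (h2 : ∀ l, Dependent s ρ l → ∑ i ∈ Finset.range l.length,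
      (-1 : ℂ) ^ (i + 1) • ((l.eraseIdx i).map F).prod = 0) : OSAlgebra s ρ →ₐ[ℂ] A :=
  RingQuot.liftAlgHom ℂ ⟨FreeAlgebra.lift ℂ F, by
    intro x y hxy
    induction hxy with
    | anticomm t t' => simpa using h1 t t'
    | dependent l hl =>
      simp only [map_sum, map_smul, map_list_prod, List.map_map, map_zero]
      rw [← h2 l hl]
      refine Finset.sum_congr rfl fun i _ => ?_
      congr 3
      funext t
      simp⟩

theorem osLift_osGen {A : Type*} [Ring A] [Algebra ℂ A] (F : reflections s → A)
    (h1 : ∀ t t', F t * F t' = -(F t' * F t))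
    (h2 : ∀ l, Dependent s ρ l → ∑ i ∈ Finset.range l.length,
      (-1 : ℂ) ^ (i + 1) • ((l.eraseIdx i).map F).prod = 0) (t : reflections s) :
    osLift (ρ := ρ) F h1 h2 (osGen s ρ t) = F t := by
  simp [osLift, osGen, RingQuot.liftAlgHom_mkAlgHom_apply]

end OrlikSolomon

section ParabolicOrlikSolomon

variable {B W : Type*} [Fintype B] [DecidableEq B] [Group W] {M : CoxeterMatrix B}

/-- Reflections of `W_L` are reflections of `W`. -/
def reflIncl (cs : CoxeterSystem M W) (L : Finset B) (t : reflections (paraSimple cs L)) :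
    reflections cs.simple :=
  ⟨((t : para cs L) : W), by
    obtain ⟨_, g, i, rfl⟩ := t
    exact ⟨g, i, rfl⟩⟩

theorem reflIncl_injective (cs : CoxeterSystem M W) (L : Finset B) :
    Function.Injective (reflIncl cs L) := fun _ _ h =>
  Subtype.ext (Subtype.ext (congrArg (fun x : reflections cs.simple => (x : W)) h))

variable [Finite W]

/-- The reflections in `W_L` are those whose hyperplane contains `Fix(W_L)`. -/
theorem mem_range_reflIncl_iff (cs : CoxeterSystem M W) {L : Finset B}
    {t : reflections cs.simple} :
    t ∈ Set.range (reflIncl cs L) ↔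
      fixedSpace cs (para cs L) ≤ hyperplane (reflRep cs) (t : W) := by
  constructor
  · rintro ⟨t, rfl⟩ v hv
    exact mem_hyperplane.mpr (hv _ (t : para cs L).2)
  · intro h
    obtain ⟨_, g, k, rfl⟩ := t
    obtain ⟨u, hu, j, hj, he⟩ := exists_conj_of_fixes cs (L := L) (g := g⁻¹) (k := k) fun v hv => by
      rw [inv_inv]
      exact mem_hyperplane.mp (h hv)
    rw [inv_inv] at he
    refine ⟨⟨⟨u, hu⟩ * paraSimple cs L ⟨j, hj⟩ * ⟨u, hu⟩⁻¹, ⟨⟨u, hu⟩⁻¹, ⟨j, hj⟩, by simp⟩⟩, ?_⟩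
    exact Subtype.ext he.symm

theorem map_meet_para (cs : CoxeterSystem M W) (L : Finset B)
    (l : List (reflections (paraSimple cs L))) :
    (meet (paraSimple cs L) (paraRep cs L) l).map (paraSpace cs L).subtype =
      paraSpace cs L ⊓ meet cs.simple (reflRep cs) (l.map (reflIncl cs L)) := by
  ext v
  constructor
  · rintro ⟨x, hx, rfl⟩
    refine ⟨x.2, mem_meet.mpr fun t ht => ?_⟩
    obtain ⟨t', ht', rfl⟩ := List.mem_map.mp ht
    exact congrArg Subtype.val (mem_meet.mp hx t' ht')
  · rintro ⟨hv, hm⟩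
    refine ⟨⟨v, hv⟩, mem_meet.mpr fun t ht => Subtype.ext ?_, rfl⟩
    exact mem_meet.mp hm _ (List.mem_map_of_mem ht)

theorem fixedSpace_le_meet (cs : CoxeterSystem M W) (L : Finset B)
    (l : List (reflections (paraSimple cs L))) :
    fixedSpace cs (para cs L) ≤ meet cs.simple (reflRep cs) (l.map (reflIncl cs L)) := by
  intro v hv
  refine mem_meet.mpr fun t ht => ?_
  obtain ⟨t, -, rfl⟩ := List.mem_map.mp ht
  exact hv _ (t : para cs L).2

theorem meet_reflIncl (cs : CoxeterSystem M W) (L : Finset B)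
    (l : List (reflections (paraSimple cs L))) :
    meet cs.simple (reflRep cs) (l.map (reflIncl cs L)) = fixedSpace cs (para cs L) ⊔
      (meet (paraSimple cs L) (paraRep cs L) l).map (paraSpace cs L).subtype := by
  rw [map_meet_para, ← sup_inf_assoc_of_le _ (fixedSpace_le_meet cs L l),
    (isCompl_paraSpace cs L).symm.sup_eq_top, top_inf_eq]

theorem finrank_meet_reflIncl (cs : CoxeterSystem M W) (L : Finset B)
    (l : List (reflections (paraSimple cs L))) :
    finrank ℝ (meet cs.simple (reflRep cs) (l.map (reflIncl cs L))) =
      finrank ℝ (meet (paraSimple cs L) (paraRep cs L) l) +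
        finrank ℝ (fixedSpace cs (para cs L)) := by
  have h := Submodule.finrank_sup_add_finrank_inf_eq (fixedSpace cs (para cs L))
    ((meet (paraSimple cs L) (paraRep cs L) l).map (paraSpace cs L).subtype)
  have hdisj : fixedSpace cs (para cs L) ⊓
      (meet (paraSimple cs L) (paraRep cs L) l).map (paraSpace cs L).subtype = ⊥ := by
    rw [eq_bot_iff, ← (isCompl_paraSpace cs L).symm.inf_eq_bot]
    exact inf_le_inf_left _ (Submodule.map_subtype_le _ _)
  rw [hdisj, finrank_bot, add_zero, ← meet_reflIncl, Submodule.finrank_map_subtype_eq] at h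
  rw [h, add_comm]

theorem finrank_paraSpace (cs : CoxeterSystem M W) (L : Finset B) :
    finrank ℝ (paraSpace cs L) + finrank ℝ (fixedSpace cs (para cs L)) = finrank ℝ (B → ℝ) :=
  Submodule.finrank_add_eq_of_isCompl (isCompl_paraSpace cs L)

theorem dependent_reflIncl_iff (cs : CoxeterSystem M W) (L : Finset B)
    (l : List (reflections (paraSimple cs L))) :
    Dependent cs.simple (reflRep cs) (l.map (reflIncl cs L)) ↔
      Dependent (paraSimple cs L) (paraRep cs L) l := by
  rw [Dependent, Dependent, finrank_meet_reflIncl, ← finrank_paraSpace cs L, List.length_map]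
  lia

/-- Removing a hyperplane not containing `Fix(W_L)` from a dependent family whose other members
contain `Fix(W_L)` leaves a dependent family. -/
theorem dependent_eraseIdx (cs : CoxeterSystem M W) {L : Finset B}
    {l : List (reflections cs.simple)} (hl : Dependent cs.simple (reflRep cs) l) {k : ℕ}
    (hk : k < l.length) (hlk : l[k] ∉ Set.range (reflIncl cs L))
    (hle : fixedSpace cs (para cs L) ≤ meet cs.simple (reflRep cs) (l.eraseIdx k)) :
    Dependent cs.simple (reflRep cs) (l.eraseIdx k) := by
  have hlt : meet cs.simple (reflRep cs) l < meet cs.simple (reflRep cs) (l.eraseIdx k) := by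
    refine lt_of_le_of_ne (fun v hv => mem_meet.mpr fun t ht =>
      mem_meet.mp hv t (List.mem_of_mem_eraseIdx ht)) fun heq => ?_
    refine hlk ((mem_range_reflIncl_iff cs).mpr fun v hv => ?_)
    rw [← heq] at hle
    exact mem_hyperplane.mpr (mem_meet.mp (hle hv) _ (List.getElem_mem hk))
  have h1 := Submodule.finrank_lt_finrank_of_lt hlt
  rw [Dependent] at hl ⊢
  rw [List.length_eraseIdx_of_lt hk]
  lia

/-- The inclusion of the Orlik-Solomon algebra of `W_L` in that of `W`. -/
noncomputable def osIncl (cs : CoxeterSystem M W) (L : Finset B) :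
    OSAlgebra (paraSimple cs L) (paraRep cs L) →ₐ[ℂ] OSAlgebra cs.simple (reflRep cs) :=
  osLift (fun t => osGen cs.simple (reflRep cs) (reflIncl cs L t))
    (fun t t' => osGen_mul_comm _ _) fun l hl => by
      have := sum_eraseIdx_eq_zero ((dependent_reflIncl_iff cs L l).mpr hl)
      simpa [List.eraseIdx_map, Function.comp_def] using this

theorem osIncl_osGen (cs : CoxeterSystem M W) (L : Finset B)
    (t : reflections (paraSimple cs L)) :
    osIncl cs L (osGen _ _ t) = osGen cs.simple (reflRep cs) (reflIncl cs L t) :=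
  osLift_osGen _ _ _ t

open Classical in
/-- The values on generators of the retraction of the Orlik-Solomon algebra of `W` onto that of
`W_L`, which kills the generators outside `W_L`. -/
noncomputable def retractGen (cs : CoxeterSystem M W) (L : Finset B) (t : reflections cs.simple) :
    OSAlgebra (paraSimple cs L) (paraRep cs L) :=
  if h : t ∈ Set.range (reflIncl cs L) then osGen _ _ h.choose else 0

theorem retractGen_reflIncl (cs : CoxeterSystem M W) (L : Finset B)
    (t : reflections (paraSimple cs L)) :
    retractGen cs L (reflIncl cs L t) = osGen _ _ t := by
  have h : reflIncl cs L t ∈ Set.range (reflIncl cs L) := ⟨t, rfl⟩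
  rw [retractGen, dif_pos h, reflIncl_injective cs L h.choose_spec]

theorem retractGen_of_notMem (cs : CoxeterSystem M W) {L : Finset B}
    {t : reflections cs.simple} (h : t ∉ Set.range (reflIncl cs L)) : retractGen cs L t = 0 :=
  dif_neg h

theorem exists_map_reflIncl (cs : CoxeterSystem M W) {L : Finset B}
    {l : List (reflections cs.simple)} (h : ∀ t ∈ l, t ∈ Set.range (reflIncl cs L)) :
    ∃ l' : List (reflections (paraSimple cs L)), l'.map (reflIncl cs L) = l := by
  have : l ∈ Set.range (List.map (reflIncl cs L)) := by
    rw [Set.range_list_map]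
    exact h
  exact this

/-- The retraction of the Orlik-Solomon algebra of `W` onto that of `W_L`. A defining relation of
the former with exactly one generator outside `W_L` is sent to a single monomial, in dependent
generators; one with several such generators is sent to `0`. -/
noncomputable def osRetract (cs : CoxeterSystem M W) (L : Finset B) :
    OSAlgebra cs.simple (reflRep cs) →ₐ[ℂ] OSAlgebra (paraSimple cs L) (paraRep cs L) :=
  osLift (retractGen cs L)
    (fun t t' => by
      by_cases h : t ∈ Set.range (reflIncl cs L)
      · by_cases h' : t' ∈ Set.range (reflIncl cs L)
        · obtain ⟨t, rfl⟩ := h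
          obtain ⟨t', rfl⟩ := h'
          simp only [retractGen_reflIncl]
          exact osGen_mul_comm t t'
        · simp [retractGen_of_notMem cs h']
      · simp [retractGen_of_notMem cs h])
    fun l hl => by
      have hzero : ∀ l : List (reflections cs.simple), ∀ t ∈ l, t ∉ Set.range (reflIncl cs L) →
          (l.map (retractGen cs L)).prod = 0 := fun l t ht h =>
        List.prod_eq_zero (List.mem_map.mpr ⟨t, ht, retractGen_of_notMem cs h⟩)
      have hmap : ∀ l : List (reflections (paraSimple cs L)),
          ((l.map (reflIncl cs L)).map (retractGen cs L)) = l.map (osGen _ _) := fun l => by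
        rw [List.map_map]
        exact List.map_congr_left fun t _ => retractGen_reflIncl cs L t
      by_cases hall : ∀ t ∈ l, t ∈ Set.range (reflIncl cs L)
      · obtain ⟨l, rfl⟩ := exists_map_reflIncl cs hall
        rw [dependent_reflIncl_iff] at hl
        simp only [List.length_map, List.eraseIdx_map, hmap]
        exact sum_eraseIdx_eq_zero hl
      · push Not at hall
        obtain ⟨t, ht, hnot⟩ := hall
        obtain ⟨k, hk, rfl⟩ := List.getElem_of_mem ht
        rw [Finset.sum_eq_single_of_mem k (Finset.mem_range.mpr hk)]
        · by_cases hall' : ∀ t ∈ l.eraseIdx k, t ∈ Set.range (reflIncl cs L)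
          · obtain ⟨l', hl'⟩ := exists_map_reflIncl cs hall'
            have hdep := dependent_eraseIdx cs hl hk hnot (by
              rw [← hl']; exact fixedSpace_le_meet cs L l')
            rw [← hl', dependent_reflIncl_iff] at hdep
            rw [← hl', hmap, prod_osGen_eq_zero hdep, smul_zero]
          · push Not at hall'
            obtain ⟨t, ht, hnot⟩ := hall'
            rw [hzero _ t ht hnot, smul_zero]
        · intro i hi hik
          rw [hzero _ l[k] ?_ hnot, smul_zero]
          rw [List.mem_eraseIdx_iff_getElem]
          exact ⟨k, hk, hik.symm, rfl⟩

/-- The inclusion of Orlik-Solomon algebras is split by the retraction `osRetract`. -/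
theorem osIncl_injective (cs : CoxeterSystem M W) (L : Finset B) :
    Function.Injective (osIncl cs L) := by
  have h : (osRetract cs L).comp (osIncl cs L) = AlgHom.id ℂ _ := osAlgebra_hom_ext fun t => by
    rw [AlgHom.comp_apply, osIncl_osGen, osRetract, osLift_osGen, retractGen_reflIncl]
    rfl
  exact Function.LeftInverse.injective (g := osRetract cs L) fun a => DFunLike.congr_fun h a

/-- An intersection of hyperplanes `H_t` of `W` that equals `Fix(W_L)` involves only `t ∈ W_L`, and
then the intersection of the corresponding hyperplanes of `V_L` is `0`. -/
theorem map_osComponent (cs : CoxeterSystem M W) (L : Finset B) :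
    (osComponent (paraSimple cs L) (paraRep cs L) ⊥).map (osIncl cs L).toLinearMap =
      osComponent cs.simple (reflRep cs) (fixedSpace cs (para cs L)) := by
  have hprod : ∀ l : List (reflections (paraSimple cs L)), osIncl cs L (l.map (osGen _ _)).prod =
      ((l.map (reflIncl cs L)).map (osGen cs.simple (reflRep cs))).prod := fun l => by
    rw [map_list_prod, List.map_map, List.map_map]
    congr 1
    exact List.map_congr_left fun t _ => osIncl_osGen cs L t
  rw [osComponent, osComponent, Submodule.map_span]
  congr 1
  ext a
  constructor
  · rintro ⟨_, ⟨l, hl, hp, rfl⟩, rfl⟩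
    refine ⟨l.map (reflIncl cs L), ?_, ?_, hprod l⟩
    · rw [meet_reflIncl, hl, Submodule.map_bot, sup_bot_eq]
    · rw [finrank_bot] at hp
      rw [List.length_map, ← finrank_paraSpace cs L]
      lia
  · rintro ⟨l, hl, hp, rfl⟩
    obtain ⟨l, rfl⟩ := exists_map_reflIncl cs (L := L) (l := l) fun t ht => by
      rw [mem_range_reflIncl_iff, ← hl]
      exact fun v hv => mem_hyperplane.mpr (mem_meet.mp hv t ht)
    refine ⟨_, ⟨l, ?_, ?_, rfl⟩, hprod l⟩
    · refine Submodule.map_injective_of_injective (paraSpace cs L).injective_subtype ?_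
      rw [map_meet_para, hl, (isCompl_paraSpace cs L).inf_eq_bot, Submodule.map_bot]
    · rw [List.length_map, ← finrank_paraSpace cs L] at hp
      rw [finrank_bot]
      lia

/-- An element of the normalizer of the form `u n`, with `n` fixing the simple roots in `L`, acts on
the component of `Fix(W_L)` as `u` acts on the top component for `W_L`. -/
theorem psiTilde_mul (cs : CoxeterSystem M W) {L : Finset B} (u : para cs L) {n : W}
    (hn : n ∈ RootData.fixingSubgroup (reflRep cs) id L)
    (hun : (u : W) * n ∈ paraNormalizer cs L) :
    psiTilde cs L ⟨u * n, hun⟩ = topPsi (paraSimple cs L) (paraRep cs L) u := by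
  have hact : (osIncl cs L).comp (osAct _ (paraRep cs L) u) =
      (osAct cs.simple (reflRep cs) (u * n)).comp (osIncl cs L) := osAlgebra_hom_ext fun t => by
    rw [AlgHom.comp_apply, AlgHom.comp_apply, osAct_osGen, osIncl_osGen, osIncl_osGen, osAct_osGen]
    congr 1
    refine Subtype.ext ?_
    have hcomm := (rootData cs).commute_of_rho_eq hn
    change ((u : W)⁻¹ * ((t : para cs L) : W) * u) =
      ((u : W) * n)⁻¹ * ((t : para cs L) : W) * (u * n)
    have h1 := hcomm ((u : W)⁻¹ * ((t : para cs L) : W) * u)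
      (mul_mem (mul_mem (inv_mem u.2) (t : para cs L).2) u.2)
    have h2 : ((u : W) * n)⁻¹ * ((t : para cs L) : W) * (u * n) =
        n⁻¹ * (((u : W)⁻¹ * ((t : para cs L) : W) * u) * n) := by group
    rw [h2, ← h1]
    simp
  symm
  refine RootData.trace_restrict_eq (osIncl cs L).toLinearMap (map_osComponent cs L) ?_ _ _ ?_
  · intro a _ h0
    exact osIncl_injective cs L (by rw [map_zero]; exact h0)
  · intro a _
    exact DFunLike.congr_fun hact a

end ParabolicOrlikSolomon

/-! ### Induction from centralizers in direct products -/

section DirectProduct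

variable {G : Type*} [Group G] {P Q N : Subgroup G} {E : P × Q ≃* N}

/-- If `(p, q) ↦ p q` is a homomorphism, then `P` and `Q` commute. -/
theorem commute_of_mulEquiv (hE : ∀ x, (E x : G) = x.1 * x.2) (p : P) (q : Q) :
    (q : G) * p = p * q := by
  have h1 := hE ((1, q) * (p, 1))
  rw [map_mul, Subgroup.coe_mul, hE, hE] at h1
  simpa using h1

theorem mul_mem_centralizer_iff (hE : ∀ x, (E x : G) = x.1 * x.2) {w p : P} (q : Q) :
    (p : G) * q ∈ Subgroup.centralizer {(w : G)} ↔ p ∈ Subgroup.centralizer {w} := by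
  have hq : (q : G) ∈ Subgroup.centralizer {(w : G)} :=
    Subgroup.mem_centralizer_singleton_iff.mpr (commute_of_mulEquiv hE w q)
  rw [Subgroup.mul_mem_cancel_right _ hq, Subgroup.mem_centralizer_singleton_iff,
    Subgroup.mem_centralizer_singleton_iff, ← Subgroup.coe_mul, ← Subgroup.coe_mul,
    Subtype.coe_inj]

theorem symm_fst_mem_centralizer (hE : ∀ x, (E x : G) = x.1 * x.2) {w : P} {g : N}
    (hg : (g : G) ∈ Subgroup.centralizer {(w : G)}) :
    (E.symm g).1 ∈ Subgroup.centralizer {w} := by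
  rw [← mul_mem_centralizer_iff hE (E.symm g).2, ← hE, E.apply_symm_apply]
  exact hg

/-- For an internal direct product `N = P × Q` containing the centralizer of `w ∈ P`, the
projection of this centralizer to `P`. -/
def centralizerProj (hE : ∀ x, (E x : G) = x.1 * x.2) {w : P}
    (hw : Subgroup.centralizer {(w : G)} ≤ N) :
    Subgroup.centralizer {(w : G)} →* Subgroup.centralizer {w} where
  toFun c := ⟨(E.symm ⟨c, hw c.2⟩).1, symm_fst_mem_centralizer hE (g := ⟨c, hw c.2⟩) c.2⟩
  map_one' := Subtype.ext (congrArg Prod.fst (map_one E.symm))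
  map_mul' c d := Subtype.ext (congrArg Prod.fst (map_mul E.symm ⟨c, hw c.2⟩ ⟨d, hw d.2⟩))

theorem centralizerProj_mul (hE : ∀ x, (E x : G) = x.1 * x.2) {w : P}
    (hw : Subgroup.centralizer {(w : G)} ≤ N) (u : Subgroup.centralizer {w}) (q : Q)
    (h : ((u : P) : G) * q ∈ Subgroup.centralizer {(w : G)}) :
    centralizerProj hE hw ⟨(u : P) * q, h⟩ = u := by
  refine Subtype.ext ?_
  have : (⟨(u : P) * q, hw h⟩ : N) = E (u, q) := Subtype.ext (hE (u, q)).symm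
  change (E.symm ⟨(u : P) * q, hw h⟩).1 = u
  rw [this, E.symm_apply_apply]

theorem card_centralizer_eq (hE : ∀ x, (E x : G) = x.1 * x.2) {w : P}
    (hw : Subgroup.centralizer {(w : G)} ≤ N) :
    Nat.card (Subgroup.centralizer {(w : G)}) =
      Nat.card (Subgroup.centralizer {w}) * Nat.card Q := by
  rw [← Nat.card_prod]
  refine Nat.card_congr (Equiv.ofBijective
    (fun c => (centralizerProj hE hw c, (E.symm ⟨c, hw c.2⟩).2)) ⟨fun c d h => ?_, fun x => ?_⟩)
  · have h1 := congrArg Subtype.val (Prod.ext_iff.mp h).1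
    have h2 := (Prod.ext_iff.mp h).2
    have := E.symm.injective (Prod.ext h1 h2)
    exact Subtype.ext (congrArg (fun x : N => (x : G)) this)
  · refine ⟨⟨(x.1 : P) * x.2, (mul_mem_centralizer_iff hE x.2).mpr x.1.2⟩,
      Prod.ext (centralizerProj_mul hE hw x.1 x.2 _) ?_⟩
    have : (⟨(x.1 : P) * x.2, hw ((mul_mem_centralizer_iff hE x.2).mpr x.1.2)⟩ : N) =
      E (x.1, x.2) := Subtype.ext (hE (x.1, x.2)).symm
    change (E.symm ⟨(x.1 : P) * x.2, _⟩).2 = x.2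
    rw [this, E.symm_apply_apply]

/-- Induction of a character `φ × 1` from the centralizer of `w ∈ P` to `P × Q` gives the product
of the induced character of `P` with the trivial character of `Q`. -/
theorem indChar_centralizerProj [Finite G] (hE : ∀ x, (E x : G) = x.1 * x.2) {w : P}
    (hw : Subgroup.centralizer {(w : G)} ≤ N) (χ : Subgroup.centralizer {w} → ℂ) (u : P) (q : Q) :
    indChar (Subgroup.centralizer {(w : G)}) N (fun c => χ (centralizerProj hE hw c)) (E (u, q)) =
      indChar (Subgroup.centralizer {w}) ⊤ χ ⟨u, Subgroup.mem_top u⟩ := by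
  classical
  have := Fintype.ofFinite P
  have := Fintype.ofFinite Q
  let F : P → ℂ := fun v =>
    if h : v * u * v⁻¹ ∈ Subgroup.centralizer {w} then χ ⟨v * u * v⁻¹, h⟩ else 0
  have hconj : ∀ x : P × Q, (E x : G) * (E (u, q) : G) * (E x : G)⁻¹ =
      ((x.1 * u * x.1⁻¹ : P) : G) * ((x.2 * q * x.2⁻¹ : Q) : G) := fun x => by
    rw [← hE (x.1 * u * x.1⁻¹, x.2 * q * x.2⁻¹)]
    change _ = (E (x * (u, q) * x⁻¹) : G)
    rw [map_mul, map_mul, map_inv]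
    rfl
  have hN : (∑ᶠ x : N, if h : (x : G) * (E (u, q) : G) * (x : G)⁻¹ ∈
        Subgroup.centralizer {(w : G)} then
        χ (centralizerProj hE hw ⟨(x : G) * (E (u, q) : G) * (x : G)⁻¹, h⟩) else 0) =
      Nat.card Q * ∑ v, F v := by
    rw [← finsum_comp_equiv E.toEquiv, finsum_eq_sum_of_fintype, Fintype.sum_prod_type,
      Finset.mul_sum]
    refine Finset.sum_congr rfl fun v _ => ?_
    rw [Nat.card_eq_fintype_card, ← nsmul_eq_mul, ← Finset.card_univ, ← Finset.sum_const]
    refine Finset.sum_congr rfl fun m _ => ?_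
    change (if h : (E (v, m) : G) * (E (u, q) : G) * (E (v, m) : G)⁻¹ ∈ _ then _ else _) = _
    simp only [hconj (v, m), mul_mem_centralizer_iff hE, F]
    split_ifs with h
    · rw [← centralizerProj_mul hE hw ⟨_, h⟩ (m * q * m⁻¹)
        ((mul_mem_centralizer_iff hE _).mpr h)]
      exact congrArg (fun c => χ (centralizerProj hE hw c)) (Subtype.ext (hconj (v, m)))
    · rfl
  have hP : (∑ᶠ x : (⊤ : Subgroup P), if h : (x : P) * u * (x : P)⁻¹ ∈
        Subgroup.centralizer {w} then χ ⟨(x : P) * u * (x : P)⁻¹, h⟩ else 0) = ∑ v, F v := by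
    rw [← finsum_eq_sum_of_fintype]
    exact finsum_comp_equiv (f := F) Subgroup.topEquiv.toEquiv
  have hQ : (Nat.card Q : ℂ) ≠ 0 := Nat.cast_ne_zero.mpr Nat.card_pos.ne'
  rw [indChar, indChar, hN, hP, card_centralizer_eq hE hw]
  push_cast
  rw [mul_inv, mul_assoc, inv_mul_cancel_left₀ hQ]

end DirectProduct

/-! ### The normalizer of a bulky parabolic subgroup -/

section Bulky

variable {B W : Type*} [Fintype B] [DecidableEq B] [Group W] [Finite W] {M : CoxeterMatrix B}

/-- The normalizer of a bulky parabolic subgroup `W_L` is the internal direct product of `W_L` and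
the pointwise stabilizer of the simple roots in `L`. -/
theorem exists_mulEquiv_normalizer (cs : CoxeterSystem M W) {L : Finset B}
    (hL : IsBulky cs.simple L) :
    ∃ E : para cs L × RootData.fixingSubgroup (reflRep cs) id L ≃* paraNormalizer cs L,
      ∀ x, (E x : W) = x.1 * x.2 := by
  have := Fintype.ofFinite W
  let D := rootData cs
  let F : para cs L × RootData.fixingSubgroup (reflRep cs) id L →* paraNormalizer cs L :=
    { toFun := fun x => ⟨x.1 * x.2, mul_mem (Subgroup.le_normalizer x.1.2)
        (D.fixingSubgroup_le_normalizer L x.2.2)⟩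
      map_one' := Subtype.ext (mul_one _)
      map_mul' := fun x y => Subtype.ext <| by
        change (x.1 : W) * y.1 * (x.2 * y.2) = x.1 * x.2 * (y.1 * y.2)
        have := D.commute_of_rho_eq x.2.2 y.1 y.1.2
        rw [mul_assoc, mul_assoc, ← mul_assoc (y.1 : W), ← this, mul_assoc] }
  refine ⟨MulEquiv.ofBijective F ⟨fun x y h => ?_, fun g => ?_⟩, fun x => rfl⟩
  · have := D.mul_fixing_injective x.1.2 y.1.2 x.2.2 y.2.2 (congrArg Subtype.val h)
    exact Prod.ext (Subtype.ext this.1) (Subtype.ext this.2)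
  · obtain ⟨u, hu, n, hn, h⟩ := D.exists_mul_of_mem_normalizer hL g.2
    exact ⟨(⟨u, hu⟩, ⟨n, hn⟩), Subtype.ext h.symm⟩

variable {cs : CoxeterSystem M W} {L : Finset B}
  {E : para cs L × RootData.fixingSubgroup (reflRep cs) id L ≃* paraNormalizer cs L}

theorem phiTilde_apply (hL : IsBulky cs.simple L) (hE : ∀ x, (E x : W) = x.1 * x.2)
    (x : para cs L × RootData.fixingSubgroup (reflRep cs) id L) :
    phiTilde cs L (E x) = topPhi (paraSimple cs L) x.1 := by
  have := Fintype.ofFinite W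
  have hx : E x = ⟨x.1 * x.2, by rw [← hE]; exact (E x).2⟩ := Subtype.ext (hE x)
  rw [hx]
  exact (rootData cs).descentChar_mul Subgroup.le_normalizer
    (fun g hg => (rootData cs).exists_mul_of_mem_normalizer hL hg) x.1 x.2.2 _

theorem psiTilde_apply (hE : ∀ x, (E x : W) = x.1 * x.2)
    (x : para cs L × RootData.fixingSubgroup (reflRep cs) id L) :
    psiTilde cs L (E x) = topPsi (paraSimple cs L) (paraRep cs L) x.1 := by
  have hx : E x = ⟨x.1 * x.2, by rw [← hE]; exact (E x).2⟩ := Subtype.ext (hE x)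
  rw [hx]
  exact psiTilde_mul cs x.1 x.2.2 _

theorem isTimesTrivial_comp_centralizerProj (hL : IsBulky cs.simple L)
    (hE : ∀ x, (E x : W) = x.1 * x.2) {w : para cs L}
    (hw : Subgroup.centralizer {(w : W)} ≤ paraNormalizer cs L)
    (φ : Subgroup.centralizer {w} →* ℂˣ) :
    IsTimesTrivial cs L w φ (φ.comp (centralizerProj hE hw)) where
  mul_mem u n hn := (mul_mem_centralizer_iff hE
    ⟨n, ((rootData cs).mem_normalizerComplement_iff hL).mp hn⟩).mpr u.2
  commute u n hn := (hL n hn u (u : para cs L).2).symm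
  existsUnique c hc := by
    have key := fun n => (rootData cs).mem_normalizerComplement_iff hL (n := n)
    refine ⟨(centralizerProj hE hw ⟨c, hc⟩,
      ⟨(E.symm ⟨c, hw hc⟩).2, (key _).mpr (E.symm ⟨c, hw hc⟩).2.2⟩), ?_, fun p hp => ?_⟩
    · have := hE (E.symm ⟨c, hw hc⟩)
      rw [E.apply_symm_apply] at this
      exact this
    · have h := hE (p.1, ⟨p.2, (key _).mp p.2.2⟩)
      have h' : E (p.1, ⟨p.2, (key _).mp p.2.2⟩) = ⟨c, hw hc⟩ := Subtype.ext (h.trans hp.symm)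
      rw [← E.eq_symm_apply] at h'
      exact Prod.ext (Subtype.ext (congrArg Prod.fst h'))
        (Subtype.ext (congrArg (fun y => (y.2 : W)) h'))
  apply_mul u n hn := congrArg φ (centralizerProj_mul hE hw u
    ⟨n, ((rootData cs).mem_normalizerComplement_iff hL).mp hn⟩ _)

/-- Extending the characters of the conjecture for `W_L` trivially across `N_L` gives characters as
in the relative conjecture for `L`. -/
theorem satisfiesC_comp_centralizerProj (hL : IsBulky cs.simple L)
    (hE : ∀ x, (E x : W) = x.1 * x.2) {w : CuspidalClass (paraRep cs L) → para cs L}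
    (hw : ∀ C, Subgroup.centralizer {(w C : W)} ≤ paraNormalizer cs L)
    {φ ψ : ∀ C : CuspidalClass (paraRep cs L), Subgroup.centralizer {w C} →* ℂˣ}
    (h : SatisfiesB (paraSimple cs L) (paraRep cs L) w φ ψ) :
    SatisfiesC cs L w (fun C => (φ C).comp (centralizerProj hE (hw C)))
      (fun C => (ψ C).comp (centralizerProj hE (hw C))) where
  centralizer_le := hw
  phi_eq g := by
    obtain ⟨x, rfl⟩ := E.surjective g
    rw [phiTilde_apply hL hE, h.phi_eq]
    exact finsum_congr fun C =>
      (indChar_centralizerProj hE (hw C) (fun c => (φ C c : ℂ)) x.1 x.2).symm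
  psi_eq g := by
    obtain ⟨x, rfl⟩ := E.surjective g
    rw [psiTilde_apply hE, h.psi_eq]
    exact finsum_congr fun C =>
      (indChar_centralizerProj hE (hw C) (fun c => (ψ C c : ℂ)) x.1 x.2).symm
  psi_eq_phi C c := by
    set x := E.symm ⟨c, hw C c.2⟩ with hx
    have hc : (c : W) = x.1 * x.2 := by rw [← hE, hx, E.apply_symm_apply]
    have hg : (x.1 : W) * x.2 ∈ paraNormalizer cs L := hc ▸ hw C c.2
    have hsgn := sgn_mul_alpha cs x.2.2 x.1 hg
    have h1 := h.psi_eq_phi C (centralizerProj hE (hw C) c)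
    simp only [hc]
    rw [mul_assoc, hsgn]
    exact h1

end Bulky

end CoxArr


theorem mainTheorem4 {B W : Type*} [Fintype B] [DecidableEq B] [Group W] [Finite W]
    {M : CoxeterMatrix B} (cs : CoxeterSystem M W) (L : Finset B)
    (hbulky : CoxArr.IsBulky cs.simple L)
    (w : CoxArr.CuspidalClass (CoxArr.paraRep cs L) → CoxArr.para cs L)
    (hw : ∀ C, ConjClasses.mk (w C) = C.1) :
    (CoxArr.ConjectureB (CoxArr.paraSimple cs L) (CoxArr.paraRep cs L) w →
      CoxArr.ConjectureC cs L w) ∧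
    ∀ φ ψ : ∀ C : CoxArr.CuspidalClass (CoxArr.paraRep cs L),
        Subgroup.centralizer {w C} →* ℂˣ,
      CoxArr.SatisfiesB (CoxArr.paraSimple cs L) (CoxArr.paraRep cs L) w φ ψ →
      ∃ φ' ψ' : ∀ C : CoxArr.CuspidalClass (CoxArr.paraRep cs L),
          Subgroup.centralizer {(w C : W)} →* ℂˣ,
        (∀ C, CoxArr.IsTimesTrivial cs L (w C) (φ C) (φ' C)) ∧
        (∀ C, CoxArr.IsTimesTrivial cs L (w C) (ψ C) (ψ' C)) ∧
        CoxArr.SatisfiesC cs L w φ' ψ' := by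
  obtain ⟨E, hE⟩ := CoxArr.exists_mulEquiv_normalizer cs hbulky
  have hle : ∀ C, Subgroup.centralizer {(w C : W)} ≤ CoxArr.paraNormalizer cs L := fun C =>
    CoxArr.centralizer_le_normalizer cs (C.2 (w C) (hw C))
  refine ⟨fun ⟨φ, ψ, h⟩ => ⟨_, _, CoxArr.satisfiesC_comp_centralizerProj hbulky hE hle h⟩,
    fun φ ψ h => ⟨_, _, fun C => ?_, fun C => ?_,
      CoxArr.satisfiesC_comp_centralizerProj hbulky hE hle h⟩⟩
  · exact CoxArr.isTimesTrivial_comp_centralizerProj hbulky hE (hle C) (φ C)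
  · exact CoxArr.isTimesTrivial_comp_centralizerProj hbulky hE (hle C) (ψ C)
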